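/- Let $K$ be a field, let $q\in K$ be nonzero and not a root of unity, and let $a,k\in K$ be nonzero with $aq^m\neq 1$ for all $m\ge 1$. Write $(x;q)_n=\prod_{i=0}^{n-1}(1-xq^i)$, $(x)_n=(x;q)_n$, and $(x_1,\dots,x_r)_n=(x_1)_n\cdots(x_r)_n$. Sequences $(\alpha_n),(\beta_n)$ in $K$ form a *WP-Bailey pair relative to $(a,k)$* if for all $n\ge 0$ $$\beta_n=\sum_{j=0}^n\frac{(k/a)_{n-j}(k)_{n+j}}{(q)_{n-j}(aq)_{n+j}}\,\alpha_j .$$ *General chain.* For a sequence $(g_n)$, parameters $e,c$ and sequences $(\alpha_n),(\beta_n)$ put $$A_n=g_n\alpha_n,\qquad B_n=\sum_{j=0}^n\beta_j\,\frac{(1-cq^{2j})(k/a)_{n-j}(k)_{n+j}(eq)_{2j}}{(1-c)(q)_{n-j}(aq)_{n+j}(cq)_{2j}}\,I_{n,j},$$ $$I_{n,j}=\sum_{r=0}^{n-j}\frac{(1-eq^{2j+2r})\,(q^{-(n-j)},kq^{n+j},e/c,eq^{2j})_r}{(1-eq^{2j})\,(aq^{n+j+1},aq^{1-(n-j)}/k,cq^{2j+1},q)_r}\Big(\frac{qac}{ke}\Big)^r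 g_{r+j}.$$ In each of the cases (1)–(4) below let $c$ be as indicated, assume that the denominators in the displayed formulas of that case do not vanish, let $g_n$ be the displayed factor with $\alpha'_n=g_n\alpha_n$, and let $\beta'_n$ be as displayed. (1) (Andrews' first chain) $\rho_1,\rho_2\ne 0$, $c=k\rho_1\rho_2/(aq)$, $$g_n=\frac{(\rho_1,\rho_2)_n}{(aq/\rho_1,aq/\rho_2)_n}\Big(\frac{aq}{\rho_1\rho_2}\Big)^n,$$ $$\beta'_n=\frac{(k\rho_1/a,k\rho_2/a)_n}{(aq/\rho_1,aq/\rho_2)_n}\sum_{j=0}^n\frac{(1-cq^{2j})(\rho_1,\rho_2)_j(k/c)_{n-j}(k)_{n+j}}{(1-c)(k\rho_1/a,k\rho_2/a)_j(q)_{n-j}(qc)_{n+j}}\Big(\frac{aq}{\rho_1\rho_2}\Big)^j\beta_j .$$ (2) (Andrews' second chain) $c=qa^2/k$, $$g_n=\frac{(qa^2/k)_{2n}}{(k)_{2n}}\Big(\frac{k^2}{qa^2}\Big)^n,\qquad \beta'_n=\sum_{j=0}^n\frac{(k^2/(qa^2))_{n-j}}{(q)_{n-j}}\Big(\frac{k^2}{qa^2}\Big)^j\beta_j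 .$$ (3) (Warnaar's first chain, $\sigma=1$) $s=k^{1/2}\in K$ is a square root of $k$, $c=a^2/k$, $$g_n=\frac{1-s}{1-q^ns}\,\frac{1+q^na/s}{1+a/s}\,\frac{(a^2/k)_{2n}}{(k)_{2n}}\Big(\frac{k^2}{a^2}\Big)^n,\qquad \beta'_n=\frac{1-s}{1-q^ns}\sum_{j=0}^n\frac{1+q^ja/s}{1+a/s}\,\frac{(k/c)_{n-j}}{(q)_{n-j}}\Big(\frac{k^2}{a^2}\Big)^j\beta_j .$$ (4) (Liu–Ma chain) $c=a^2/k$, $$g_n=\frac{(qa^2/k;q^2)_n}{(kq;q^2)_n}\Big(\frac{-k}{a}\Big)^n,$$ $$\beta'_n=\sum_{j=0}^{\lfloor n/2\rfloor}\frac{1-a^2q^{2n-4j}/k}{1-a^2/k}\,\frac{(k;q^2)_{n-j}(k^2/a^2;q^2)_j}{(a^2q^2/k;q^2)_{n-j}(q^2;q^2)_j}\Big(\frac{-k}{a}\Big)^{n-2j}\beta_{n-2j}.$$ Then in each case: (A) if $(\alpha_n,\beta_n)$ is a WP-Bailey pair relative to $(a,c)$, then $(\alpha'_n,\beta'_n)$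 is a WP-Bailey pair relative to $(a,k)$. (B) Suppose moreover that the denominators of the general chain with $e=a$ do not vanish, i.e. $c\ne 0$, $aq^{2m}\neq1$, $cq^m\ne 1$ and $kq^m\ne a$ for all $m\ge0$. Then the chain is the general chain with $e=a$ and this $c$ and $(g_n)$: for all sequences $(\alpha_n)$, $(\beta_n)$ one has $A_n=\alpha'_n$ and $B_n=\beta'_n$ for all $n$. Moreover, for $0\le j\le n$ the inner sum is $I_{n,j}=g_j\,S_{n-j}=g_j\,P_{n-j}$, where $S_N$ (defined when the square roots it contains exist in $K$, for any choice of them) and $P_N$ are the two sides of the following sums, in case (1) with $(a,b,c,d,e)$ replaced by $(aq^{2j},\rho_1q^j,\rho_2q^j,a/c,kq^{n+j})$, in cases (2), (3) with $(a,k)$ replaced by $(aq^{2j},kq^{2j})$, in case (4) with $(\lambda,b)=(aq^{2j},kq^{2j})$, and with $\sqrt a,\sqrt k,\sqrt\lambda,\sqrt b$ replaced by $q^j\sqrt a,q^j\sqrt k,q^j\sqrt a,q^j\sqrt k$ respectively (all series are terminating, summed over indices $0,\dots,N$): (1) Jackson's sum (the parameters satisfy $a^2q=bcde\,q^{-N}$):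 $$S_N={}_8\phi_7\left[\begin{matrix}a,q\sqrt a,-q\sqrt a,b,c,d,e,q^{-N}\\ \sqrt a,-\sqrt a,aq/b,aq/c,aq/d,aq/e,aq^{N+1}\end{matrix};q,q\right],\quad P_N=\frac{(aq,aq/bc,aq/bd,aq/cd)_N}{(aq/b,aq/c,aq/d,aq/bcd)_N}.$$ (2) The $_{10}\phi_9$ sum of Gasper–Rahman, Problem 2.12: $$S_N={}_{10}\phi_9\left[\begin{matrix}a,q\sqrt a,-q\sqrt a,a\sqrt{q/k},-a\sqrt{q/k},\frac{aq}{\sqrt k},-\frac{aq}{\sqrt k},\frac{k}{aq},kq^N,q^{-N}\\ \sqrt a,-\sqrt a,\sqrt{kq},-\sqrt{kq},\sqrt k,-\sqrt k,\frac{a^2q^2}{k},\frac{aq^{1-N}}{k},aq^{N+1}\end{matrix};q,q\right],\quad P_N=\frac{(aq,k^2/(qa^2))_N}{(k,k/a)_N}.$$ (3) The Andrews–Berkovich sum: $$S_N={}_{10}\phi_9\left[\begin{matrix}a,q\sqrt a,-q\sqrt a,a\sqrt{q/k},-a\sqrt{q/k},\frac{a}{\sqrt k},-\frac{aq}{\sqrt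 k},\frac{k}{a},kq^N,q^{-N}\\ \sqrt a,-\sqrt a,\sqrt{kq},-\sqrt{kq},q\sqrt k,-\sqrt k,\frac{a^2q}{k},\frac{aq^{1-N}}{k},aq^{N+1}\end{matrix};q,q\right],\quad P_N=\frac{(aq,\sqrt k,k^2/a^2)_N}{(k,k/a,q\sqrt k)_N},$$ with $\sqrt k=s$. (4) The $q$-analogue of Watson's sum: $$S_N={}_8\phi_7\left[\begin{matrix}\lambda,q\sqrt\lambda,-q\sqrt\lambda,q^{-N},bq^N,\lambda\sqrt{q/b},-\lambda\sqrt{q/b},b/\lambda\\ \sqrt\lambda,-\sqrt\lambda,\lambda q^{N+1},\lambda q^{1-N}/b,\lambda^2q/b,\sqrt{qb},-\sqrt{qb}\end{matrix};q,-\frac{q\lambda}{b}\right],$$ $P_N=0$ for odd $N$ and $$P_N=\frac{(\lambda q;q)_N}{(b/\lambda;q)_N}\,\frac{(q,b^2/\lambda^2;q^2)_{N/2}}{(bq,q^2\lambda^2/b;q^2)_{N/2}}\quad\text{for even }N .$$ Here $\sqrt{q/k}=\sqrt q/\sqrt k$, $\sqrt{kq}=\sqrt k\sqrt q$ (and likewise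 with $b$) for the chosen square roots. -/

import Mathlib

namespace WPBailey

variable {K : Type*} [Field K]

/-- The `q`-shifted factorial `(x; q)_n = (1 - x) (1 - x q) ⋯ (1 - x q^(n-1))`. -/
def qPoch (x q : K) (n : ℕ) : K := ∏ i ∈ Finset.range n, (1 - x * q ^ i)

/-- `(α, β)` is a WP-Bailey pair with base `q` relative to the parameters `(a, k)`. -/
def IsWPBaileyPair (q a k : K) (α β : ℕ → K) : Prop :=
  ∀ n : ℕ, β n = ∑ j ∈ Finset.range (n + 1),
    qPoch (k / a) q (n - j) * qPoch k q (n + j)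
      / (qPoch q q (n - j) * qPoch (a * q) q (n + j)) * α j

/-! ### The general WP-Bailey chain with multiplier sequence `g` and parameters `e`, `c` -/

/-- `α'_n = g_n α_n`, where `α` is the first member of a pair relative to `(e, c)`. -/
def generalAlpha (g α : ℕ → K) (n : ℕ) : K := g n * α n

/-- The inner sum over `r` in the general chain. -/
def generalInner (q a k e c : K) (g : ℕ → K) (n j : ℕ) : K :=
  ∑ r ∈ Finset.range (n - j + 1),
    (1 - e * q ^ (2 * j + 2 * r))
        * (qPoch ((q ^ (n - j))⁻¹) q r * qPoch (k * q ^ (n + j)) q r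
            * qPoch (e / c) q r * qPoch (e * q ^ (2 * j)) q r)
      / ((1 - e * q ^ (2 * j))
        * (qPoch (a * q ^ (n + j + 1)) q r * qPoch (a * q / (k * q ^ (n - j))) q r
            * qPoch (c * q ^ (2 * j + 1)) q r * qPoch q q r))
      * (q * a * c / (k * e)) ^ r * g (r + j)

/-- The second member of the pair produced by the general chain; `β` is the second member of
a pair relative to `(e, c)`. -/
def generalBeta (q a k e c : K) (g β : ℕ → K) (n : ℕ) : K :=
  ∑ j ∈ Finset.range (n + 1),
    β j * ((1 - c * q ^ (2 * j)) * qPoch (k / a) q (n - j) * qPoch k q (n + j)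
            * qPoch (e * q) q (2 * j)
          / ((1 - c) * qPoch q q (n - j) * qPoch (a * q) q (n + j) * qPoch (c * q) q (2 * j)))
      * generalInner q a k e c g n j

/-- All denominators in the general chain are nonzero, for `q` nonzero and not a root of unity.
The last condition says that `(a q^(1-N)/k; q)_r` with `r ≤ N` does not vanish. -/
structure GeneralChainDefined (q a k e c : K) : Prop where
  a_ne : a ≠ 0
  k_ne : k ≠ 0
  e_ne : e ≠ 0
  c_ne : c ≠ 0
  a_pow : ∀ m : ℕ, a * q ^ (m + 1) ≠ 1
  e_pow : ∀ m : ℕ, e * q ^ (2 * m) ≠ 1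
  c_pow : ∀ m : ℕ, c * q ^ m ≠ 1
  k_pow : ∀ m : ℕ, k * q ^ m ≠ a

/-! ### Terminating basic hypergeometric series -/

/-- The terminating series `_{s+1}φ_s [upper; lower; q, z]`, where `upper` has one entry more
than `lower` and contains `q^(-N)`, so that only the terms of index at most `N` occur. -/
def phi (q : K) (upper lower : List K) (z : K) (N : ℕ) : K :=
  ∑ r ∈ Finset.range (N + 1),
    (upper.map fun x => qPoch x q r).prod
      / (qPoch q q r * (lower.map fun x => qPoch x q r).prod) * z ^ r

/-- The `8φ7` in Jackson's sum; `t` is a square root of `a`. -/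
def jacksonSeries (q a t b c d e : K) (N : ℕ) : K :=
  phi q [a, q * t, -(q * t), b, c, d, e, (q ^ N)⁻¹]
    [t, -t, a * q / b, a * q / c, a * q / d, a * q / e, a * q ^ (N + 1)] q N

/-- The right side of Jackson's sum. -/
def jacksonProduct (q a b c d : K) (N : ℕ) : K :=
  qPoch (a * q) q N * qPoch (a * q / (b * c)) q N * qPoch (a * q / (b * d)) q N
      * qPoch (a * q / (c * d)) q N
    / (qPoch (a * q / b) q N * qPoch (a * q / c) q N * qPoch (a * q / d) q N
      * qPoch (a * q / (b * c * d)) q N)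

/-- The `10φ9` of Gasper and Rahman, Problem 2.12; `w`, `t`, `s` are square roots of
`q`, `a`, `k`. -/
def gasperRahmanSeries (q a k w t s : K) (N : ℕ) : K :=
  phi q [a, q * t, -(q * t), a * w / s, -(a * w / s), a * q / s, -(a * q / s), k / (a * q),
      k * q ^ N, (q ^ N)⁻¹]
    [t, -t, s * w, -(s * w), s, -s, a ^ 2 * q ^ 2 / k, a * q / (k * q ^ N), a * q ^ (N + 1)] q N

/-- The value of the `10φ9` of Gasper and Rahman, Problem 2.12. -/
def gasperRahmanProduct (q a k : K) (N : ℕ) : K :=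
  qPoch (a * q) q N * qPoch (k ^ 2 / (q * a ^ 2)) q N / (qPoch k q N * qPoch (k / a) q N)

/-- The `10φ9` of Andrews and Berkovich; `w`, `t`, `s` are square roots of `q`, `a`, `k`. -/
def andrewsBerkovichSeries (q a k w t s : K) (N : ℕ) : K :=
  phi q [a, q * t, -(q * t), a * w / s, -(a * w / s), a / s, -(a * q / s), k / a,
      k * q ^ N, (q ^ N)⁻¹]
    [t, -t, s * w, -(s * w), q * s, -s, a ^ 2 * q / k, a * q / (k * q ^ N), a * q ^ (N + 1)] q N

/-- The value of the `10φ9` of Andrews and Berkovich; `s` is a square root of `k`. -/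
def andrewsBerkovichProduct (q a k s : K) (N : ℕ) : K :=
  qPoch (a * q) q N * qPoch s q N * qPoch (k ^ 2 / a ^ 2) q N
    / (qPoch k q N * qPoch (k / a) q N * qPoch (q * s) q N)

/-- The `8φ7` in the `q`-analogue of Watson's sum; `w`, `t`, `s` are square roots of
`q`, `l`, `b`. -/
def watsonSeries (q l b w t s : K) (N : ℕ) : K :=
  phi q [l, q * t, -(q * t), (q ^ N)⁻¹, b * q ^ N, l * w / s, -(l * w / s), b / l]
    [t, -t, l * q ^ (N + 1), l * q / (b * q ^ N), l ^ 2 * q / b, w * s, -(w * s)]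
    (-(q * l / b)) N

/-- The value of the `8φ7` in the `q`-analogue of Watson's sum. -/
def watsonProduct (q l b : K) (N : ℕ) : K :=
  if Even N then
    qPoch (l * q) q N / qPoch (b / l) q N
      * (qPoch q (q ^ 2) (N / 2) * qPoch (b ^ 2 / l ^ 2) (q ^ 2) (N / 2)
        / (qPoch (b * q) (q ^ 2) (N / 2) * qPoch (q ^ 2 * l ^ 2 / b) (q ^ 2) (N / 2)))
  else 0

/-! ### The four chains: multiplier of `α_n(a, c)`, and new `β` in terms of `β_n(a, c)` -/

/-- Andrews' first chain, where `c = k ρ₁ ρ₂ / (a q)`: the factor multiplying `α_n(a, c)`. -/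
def andrewsOneMul (q a ρ₁ ρ₂ : K) (n : ℕ) : K :=
  qPoch ρ₁ q n * qPoch ρ₂ q n / (qPoch (a * q / ρ₁) q n * qPoch (a * q / ρ₂) q n)
    * (a * q / (ρ₁ * ρ₂)) ^ n

/-- Andrews' first chain: the new `β`. -/
def andrewsOneBeta (q a k c ρ₁ ρ₂ : K) (β : ℕ → K) (n : ℕ) : K :=
  qPoch (k * ρ₁ / a) q n * qPoch (k * ρ₂ / a) q n
      / (qPoch (a * q / ρ₁) q n * qPoch (a * q / ρ₂) q n)
    * ∑ j ∈ Finset.range (n + 1),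
        (1 - c * q ^ (2 * j)) * (qPoch ρ₁ q j * qPoch ρ₂ q j) * qPoch (k / c) q (n - j)
            * qPoch k q (n + j)
          / ((1 - c) * (qPoch (k * ρ₁ / a) q j * qPoch (k * ρ₂ / a) q j) * qPoch q q (n - j)
            * qPoch (q * c) q (n + j))
          * (a * q / (ρ₁ * ρ₂)) ^ j * β j

/-- Andrews' second chain, where `c = q a² / k`: the factor multiplying `α_n(a, c)`. -/
def andrewsTwoMul (q a k : K) (n : ℕ) : K :=
  qPoch (q * a ^ 2 / k) q (2 * n) / qPoch k q (2 * n) * (k ^ 2 / (q * a ^ 2)) ^ n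

/-- Andrews' second chain: the new `β`. -/
def andrewsTwoBeta (q a k : K) (β : ℕ → K) (n : ℕ) : K :=
  ∑ j ∈ Finset.range (n + 1),
    qPoch (k ^ 2 / (q * a ^ 2)) q (n - j) / qPoch q q (n - j) * (k ^ 2 / (q * a ^ 2)) ^ j * β j

/-- Warnaar's first chain (`σ = 1`), where `s² = k` and `c = a² / k`: the factor
multiplying `α_n(a, c)`. -/
def warnaarMul (q a k s : K) (n : ℕ) : K :=
  (1 - s) / (1 - q ^ n * s) * ((1 + q ^ n * a / s) / (1 + a / s))
    * (qPoch (a ^ 2 / k) q (2 * n) / qPoch k q (2 * n)) * (k ^ 2 / a ^ 2) ^ n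

/-- Warnaar's first chain (`σ = 1`): the new `β`. -/
def warnaarBeta (q a k s c : K) (β : ℕ → K) (n : ℕ) : K :=
  (1 - s) / (1 - q ^ n * s)
    * ∑ j ∈ Finset.range (n + 1),
        (1 + q ^ j * a / s) / (1 + a / s) * (qPoch (k / c) q (n - j) / qPoch q q (n - j))
          * (k ^ 2 / a ^ 2) ^ j * β j

/-- The Liu–Ma chain, where `c = a² / k`: the factor multiplying `α_n(a, c)`. -/
def liuMaMul (q a k : K) (n : ℕ) : K :=
  qPoch (q * a ^ 2 / k) (q ^ 2) n / qPoch (k * q) (q ^ 2) n * (-k / a) ^ n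

/-- The Liu–Ma chain: the new `β`. -/
def liuMaBeta (q a k : K) (β : ℕ → K) (n : ℕ) : K :=
  ∑ j ∈ Finset.range (n / 2 + 1),
    (1 - a ^ 2 * q ^ (2 * n - 4 * j) / k) / (1 - a ^ 2 / k)
      * (qPoch k (q ^ 2) (n - j) * qPoch (k ^ 2 / a ^ 2) (q ^ 2) j
        / (qPoch (a ^ 2 * q ^ 2 / k) (q ^ 2) (n - j) * qPoch (q ^ 2) (q ^ 2) j))
      * (-k / a) ^ (n - 2 * j) * β (n - 2 * j)

end WPBailey

open WPBailey

/-! Write L_k for the lower triangular matrix `wpKernel q a k`, so that a WP-Bailey pair relative to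
(a, k) is β = L_k α. A chain multiplies α by the diagonal matrix G of the g_n and β by a lower
triangular matrix M. Hence (A) follows from the matrix identity M L_c = L_k G
(`isWPBaileyPair_of_kernel`). Entry (i + N, i) of that identity is a terminating summation:
Jackson's sum with base parameter c q^(2i) in case (1), the q-Saalschütz sum in case (2), a
combination of two Saalschütz sums in case (3) (`warnaar_sum`), and Jackson's sum in base q²,
separately for even and odd N, in case (4).

For (B), multiplying a, k, c by q^(2j) reduces the inner sum to j = 0 (`generalInner_shift`). The
sequence u = `unitAlpha` satisfies L_c u = e_0 (`unit_pair`), so M e_0 = M L_c u = L_k G u. Row N of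
this says that M(N, 0) is the inner sum I_{N,0} times an explicit factor. So in cases (2) and (3)
the identities already proved for (A) evaluate the inner sums, and `generalBeta_eq` then identifies
the kernel of the general chain with M; case (4) uses a normalized variant of its identity. In case
(1) the inner sum is directly an instance of Jackson's sum. The equality with the series S_N is
termwise: the square roots disappear through (x; q)_n (-x; q)_n = (x²; q²)_n.

Jackson's and Saalschütz's sums are both proved by a telescoping relation between consecutive values
of N (`sum_eq_prod_of_telescoping`). They are stated with (f; q)_{N-r} / (q; q)_{N-r} in place of a
quotient containing (q^(-N); q)_r. This puts no condition on f itself, which matters because (A)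
allows parameters such as k/c to be powers of q.

The Liu-Ma chain needs extra care: only k q^(2m+1) = 1 is excluded, so (k; q)_N may vanish and
cannot be cancelled. Its kernel identity is therefore proved with a general sequence p in the role
of (k; q²)_n. -/

namespace WPBailey

/-! ### q-shifted factorials, reversal of products, and telescoping. -/

section Basics
variable {K : Type*} [Field K]

@[simp] theorem qPoch_zero (x q : K) : qPoch x q 0 = 1 := by simp [qPoch]

theorem qPoch_succ (x q : K) (n : ℕ) : qPoch x q (n + 1) = qPoch x q n * (1 - x * q ^ n) := by
  simp [qPoch, Finset.prod_range_succ]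

theorem qPoch_succ_left (x q : K) (n : ℕ) :
    qPoch x q (n + 1) = (1 - x) * qPoch (x * q) q n := by
  simp only [qPoch, Finset.prod_range_succ', pow_zero, mul_one]
  rw [mul_comm]
  congr 1
  exact Finset.prod_congr rfl fun i _ => by ring

theorem qPoch_add (x q : K) (m n : ℕ) :
    qPoch x q (m + n) = qPoch x q m * qPoch (x * q ^ m) q n := by
  simp only [qPoch, Finset.prod_range_add]
  congr 1
  exact Finset.prod_congr rfl fun i _ => by ring

theorem qPoch_ne_zero {x q : K} (h : ∀ m : ℕ, x * q ^ m ≠ 1) (n : ℕ) : qPoch x q n ≠ 0 :=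
  Finset.prod_ne_zero_iff.2 fun i _ => sub_ne_zero.2 (h i).symm

theorem qPoch_one (q : K) (n : ℕ) : qPoch 1 q (n + 1) = 0 := by
  simp [qPoch_succ_left]

/-- `(x; q)_{2n} = (x; q²)_n (x q; q²)_n`. -/
theorem qPoch_two_mul (x q : K) (n : ℕ) :
    qPoch x q (2 * n) = qPoch x (q ^ 2) n * qPoch (x * q) (q ^ 2) n := by
  induction n with
  | zero => simp
  | succ n ih =>
    rw [show 2 * (n + 1) = 2 * n + 1 + 1 by ring, qPoch_succ, qPoch_succ, ih, qPoch_succ,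
      qPoch_succ]
    ring

/-- `(x; q)_{2n+1} = (1 - x) (x q; q²)_n (x q²; q²)_n`. -/
theorem qPoch_two_mul_add_one (x q : K) (n : ℕ) :
    qPoch x q (2 * n + 1) = (1 - x) * (qPoch (x * q) (q ^ 2) n * qPoch (x * q ^ 2) (q ^ 2) n) := by
  rw [qPoch_succ_left, qPoch_two_mul]
  ring_nf

/-- Reversal of a quotient of two terminating `q`-shifted factorials. -/
theorem qPoch_reverse {q x : K} (hq0 : q ≠ 0) (hq : ∀ m : ℕ, q * q ^ m ≠ 1) (hx0 : x ≠ 0)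
    (hx : ∀ m : ℕ, x * q ^ m ≠ 1) (r m : ℕ) :
    qPoch ((q ^ (r + m))⁻¹) q r / qPoch (q / (x * q ^ (r + m))) q r * (q / x) ^ r
      = qPoch q q (r + m) / qPoch x q (r + m) * (qPoch x q m / qPoch q q m) := by
  -- Each factor is rewritten by 1 - y = -y (1 - 1/y), and the resulting product is read backwards.
  -- Using this for z = x and z = q, the monomial prefactors differ exactly by (q/x)^r.
  have key : ∀ z : K, z ≠ 0 → ∀ r m : ℕ, qPoch (q / (z * q ^ (r + m))) q r * qPoch z q m
      = qPoch z q (r + m) * ∏ i ∈ Finset.range r, (-(q / (z * q ^ (r + m)) * q ^ i)) := by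
    intro z hz r m
    rw [add_comm r m, qPoch_add z, mul_comm, mul_assoc]
    congr 1
    rw [qPoch, qPoch, ← Finset.prod_range_reflect (fun i => 1 - z * q ^ m * q ^ i),
      ← Finset.prod_mul_distrib]
    refine Finset.prod_congr rfl fun i hi => ?_
    have hi := Finset.mem_range.1 hi
    obtain ⟨t, rfl⟩ : ∃ t, r = i + 1 + t := ⟨r - (i + 1), by omega⟩
    rw [show i + 1 + t - 1 - i = t by omega]
    field_simp
    ring
  have hxr := key x hx0 r m
  have hqr := key q hq0 r m
  have e1 : q / (q * q ^ (r + m)) = (q ^ (r + m))⁻¹ := by field_simp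
  rw [e1] at hqr
  have hprod : (∏ i ∈ Finset.range r, (-((q ^ (r + m))⁻¹ * q ^ i))) * (q / x) ^ r
      = ∏ i ∈ Finset.range r, (-(q / (x * q ^ (r + m)) * q ^ i)) := by
    rw [← Finset.card_range r, ← Finset.prod_const, Finset.card_range, ← Finset.prod_mul_distrib]
    refine Finset.prod_congr rfl fun i _ => ?_
    field_simp
  have hP0 : (∏ i ∈ Finset.range r, (-(q / (x * q ^ (r + m)) * q ^ i))) ≠ 0 := by
    refine Finset.prod_ne_zero_iff.2 fun i _ => ?_
    simp [hq0, hx0]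
  have h1 := qPoch_ne_zero hx (r + m)
  have h2 := qPoch_ne_zero hx m
  have h3 := qPoch_ne_zero hq m
  have h4 : qPoch (q / (x * q ^ (r + m))) q r ≠ 0 := fun h0 => by
    rw [h0, zero_mul] at hxr
    exact mul_ne_zero h1 hP0 hxr.symm
  rw [← hprod] at hxr
  rw [div_mul_eq_mul_div, div_mul_div_comm, div_eq_div_iff h4 (mul_ne_zero h1 h3)]
  linear_combination (q / x) ^ r * qPoch x q (r + m) * hqr - qPoch q q (r + m) * hxr

/-- Summation from a telescoping relation between consecutive sums. -/
theorem sum_eq_prod_of_telescoping (F G : ℕ → ℕ → K) (ρ : ℕ → K) (hG : ∀ m, G 0 m = 0)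
    (hlast : ∀ r, F (r + 1) 0 = -G (r + 1) 0)
    (hstep : ∀ r m, F r (m + 1) = ρ (r + m) * F r m + G (r + 1) m - G r (m + 1)) (N : ℕ) :
    ∑ r ∈ Finset.range (N + 1), F r (N - r) = (∏ i ∈ Finset.range N, ρ i) * F 0 0 := by
  induction N with
  | zero => simp
  | succ N ih =>
    have h : ∀ r ∈ Finset.range (N + 1), F r (N + 1 - r)
        = ρ N * F r (N - r) + (G (r + 1) (N + 1 - (r + 1)) - G r (N + 1 - r)) := by
      intro r hr
      obtain ⟨m, rfl⟩ : ∃ m, N = r + m := ⟨N - r, by have := Finset.mem_range.1 hr; omega⟩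
      rw [show r + m + 1 - r = m + 1 by omega, show r + m - r = m by omega,
        show r + m + 1 - (r + 1) = m by omega, hstep]
      ring
    -- The differences of G collapse to G (N+1) 0 - G 0 (N+1). The second term is zero by `hG`, and
    -- the first cancels the new last summand F (N+1) 0 by `hlast`.
    rw [Finset.sum_range_succ, Finset.sum_congr rfl h, Finset.sum_add_distrib, ← Finset.mul_sum,
      ih, Finset.sum_range_sub (fun r => G r (N + 1 - r)), Nat.sub_self, hlast, hG,
      Finset.prod_range_succ]
    ring

end Basics

/-! ### The polynomial identity behind Jackson's sum. -/

section Jackson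
variable {K : Type*} [Field K]

/-- This is the telescoping relation for Jackson's sum at index r + 1, cleared of denominators and
common factors, with Z = q^r, Y = q^m and a eliminated through a q = b c d f. -/
theorem jackson_step_identity (b c d f q Z Y : K) :
    (1 - b*c*d*f*q*Z^2) * ((1 - f*Y) * (1 - b*c*d*f^2*q*Z^2*Y)
        * ((1 - c*d*f*q*Z*Y) * (1 - b*d*f*q*Z*Y) * (1 - b*c*f*q*Z*Y) * (1 - q^2*Z*Y))
      - (1 - q*Y) * (1 - b*c*d*f*q^2*Z^2*Y) * (1 - b*c*d*f^2*Z*Y)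
        * (1 - d*f*q*Z*Y) * (1 - c*f*q*Z*Y) * (1 - b*f*q*Z*Y))
    = (1 - b*c*d*f^2*q^2*Z^2*Y^2) * Y
      * (q * (1 - q*Z) * (1 - c*d*f*Z) * (1 - b*d*f*Z) * (1 - b*c*f*Z) * (1 - f*Y)
          * (1 - b*c*d*f*q^2*Z^2*Y)
        - f * (1 - b*c*d*f*Z) * (1 - b*q*Z) * (1 - c*q*Z) * (1 - d*q*Z) * (1 - q*Y)
          * (1 - b*c*d*f^2*q*Z^2*Y)) := by
  ring

end Jackson

/-! ### Jackson's sum by telescoping. -/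

section Summations
variable {K : Type*} [Field K]

/-- The part of the Jackson summand depending only on the summation index. -/
def jacksonWeight (q a b c d f : K) (r : ℕ) : K :=
  qPoch a q r * qPoch b q r * qPoch c q r * qPoch d q r
    / (qPoch q q r * qPoch (c * d * f) q r * qPoch (b * d * f) q r * qPoch (b * c * f) q r) * f ^ r
    / (1 - a)

/-- The summand of Jackson's sum, free of the denominator `(a q / (b c d); q)_N`. -/
def jacksonTerm (q a b c d f : K) (r m : ℕ) : K :=
  (1 - a * q ^ (2 * r)) * jacksonWeight q a b c d f r * (qPoch f q m / qPoch q q m)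
    * (qPoch (a * f * q ^ (r + m)) q r / qPoch (a * q ^ (r + m + 1)) q r)

/-- The companion of `jacksonTerm` in its telescoping relation. -/
def jacksonMate (q a b c d f : K) : ℕ → ℕ → K
  | 0, _ => 0
  | r + 1, m =>
    -((1 - a * q ^ (r + m + 1))
        / ((1 - c * d * f * q ^ (r + m)) * (1 - b * d * f * q ^ (r + m))
          * (1 - b * c * f * q ^ (r + m)) * (1 - q ^ (r + m + 1)))
      * (1 - a * f * q ^ (2 * (r + m) + 1)) * q ^ m * jacksonWeight q a b c d f r
      * (f * (1 - a * q ^ r) * (1 - b * q ^ r) * (1 - c * q ^ r) * (1 - d * q ^ r))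
      * (qPoch f q m / qPoch q q m)
      * (qPoch (a * f * q ^ (r + m + 1)) q r / qPoch (a * q ^ (r + m + 1)) q (r + 1)))

/-- Quotient of consecutive values of Jackson's sum. -/
def jacksonRatio (q a b c d f : K) (N : ℕ) : K :=
  (1 - a * q ^ (N + 1)) * (1 - d * f * q ^ N) * (1 - c * f * q ^ N) * (1 - b * f * q ^ N)
    / ((1 - c * d * f * q ^ N) * (1 - b * d * f * q ^ N)
          * (1 - b * c * f * q ^ N) * (1 - q ^ (N + 1)))

theorem jacksonWeight_succ (q a b c d f : K) (r : ℕ) :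
    jacksonWeight q a b c d f (r + 1) = jacksonWeight q a b c d f r
      * (f * (1 - a * q ^ r) * (1 - b * q ^ r) * (1 - c * q ^ r) * (1 - d * q ^ r))
      / ((1 - q * q ^ r) * (1 - c * d * f * q ^ r) * (1 - b * d * f * q ^ r)
        * (1 - b * c * f * q ^ r)) := by
  simp only [jacksonWeight, qPoch_succ, pow_succ, div_eq_mul_inv, mul_inv]
  ring

variable {q a b c d f : K}

/-- The boundary condition of the telescoping: at m = 0 the weight recurrence turns the companion
into the newest summand, up to sign. -/
theorem jacksonTerm_last (ha : ∀ m : ℕ, a * q ^ m ≠ 1) (r : ℕ) :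
    jacksonTerm q a b c d f (r + 1) 0 = -jacksonMate q a b c d f (r + 1) 0 := by
  have h5 := sub_ne_zero.2 (ha (r + 1)).symm
  have h7 := sub_ne_zero.2 (ha (2 * (r + 1))).symm
  have t1 : qPoch (a * f * q ^ (r + 1)) q (r + 1)
      = qPoch (a * f * q ^ (r + 1)) q r * (1 - a * f * q ^ (2 * r + 1)) := by
    rw [qPoch_succ]; ring_nf
  have t2 : qPoch (a * q ^ (r + 1 + 1)) q (r + 1)
      = qPoch (a * q ^ (r + 1 + 1)) q r * (1 - a * q ^ (2 * (r + 1))) := by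
    rw [qPoch_succ]; ring_nf
  have t3 : qPoch (a * q ^ (r + 1)) q (r + 1)
      = (1 - a * q ^ (r + 1)) * qPoch (a * q ^ (r + 1 + 1)) q r := by
    rw [qPoch_succ_left]; ring_nf
  simp only [jacksonTerm, jacksonMate, jacksonWeight_succ, add_zero, qPoch_zero, pow_zero, mul_one,
    div_one, neg_neg]
  rw [t1, t2, t3, pow_succ' q r]
  rw [pow_succ'] at h5
  generalize 1 - a * q ^ (2 * (r + 1)) = x at *
  generalize 1 - a * f * q ^ (2 * r + 1) = v
  generalize f * (1 - a * q ^ r) * (1 - b * q ^ r) * (1 - c * q ^ r) * (1 - d * q ^ r) = u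
  generalize 1 - q * q ^ r = y
  generalize (1 - a * (q * q ^ r)) = z at *
  generalize 1 - c * d * f * q ^ r = y1
  generalize 1 - b * d * f * q ^ r = y2
  generalize 1 - b * c * f * q ^ r = y3
  field_simp

/-- `jackson_step_identity` with the denominators put back. W stands for the weight at r + 1, E₃ /
E₄ for (f)_m / (q)_m, and E₁ / E₂ for the parts of the last quotient of products shared by all four
terms. -/
theorem jackson_step_algebra {b c d f q Z Y E₂ E₄ : K} (W E₁ E₃ : K)
    (k1 : 1 - q * (q * Z * Y) ≠ 0) (k2 : 1 - c * d * f * (q * Z * Y) ≠ 0)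
    (k3 : 1 - b * d * f * (q * Z * Y) ≠ 0) (k4 : 1 - b * c * f * (q * Z * Y) ≠ 0)
    (k5 : 1 - q * Y ≠ 0) (k6 : E₄ ≠ 0) (k7 : E₂ ≠ 0)
    (u1 : 1 - b * c * d * f * q * Z * Y ≠ 0) (u2 : 1 - b * c * d * f * q ^ 2 * Z ^ 2 * Y ≠ 0) :
    (1 - b * c * d * f * q * Z ^ 2) * W * (E₃ * (1 - f * Y) / (E₄ * (1 - q * Y)))
        * (E₁ * (1 - b * c * d * f ^ 2 * q * Z ^ 2 * Y)
          / (E₂ * (1 - b * c * d * f * q ^ 2 * Z ^ 2 * Y)))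
      = (1 - b * c * d * f * q * Z * Y) * (1 - d * f * (q * Z * Y)) * (1 - c * f * (q * Z * Y))
            * (1 - b * f * (q * Z * Y))
          / ((1 - c * d * f * (q * Z * Y)) * (1 - b * d * f * (q * Z * Y))
            * (1 - b * c * f * (q * Z * Y)) * (1 - q * (q * Z * Y)))
          * ((1 - b * c * d * f * q * Z ^ 2) * W * (E₃ / E₄)
            * ((1 - b * c * d * f ^ 2 * Z * Y) * E₁ / ((1 - b * c * d * f * q * Z * Y) * E₂)))
        + -((1 - b * c * d * f * q * Z * Y)
            / ((1 - c * d * f * (q * Z * Y)) * (1 - b * d * f * (q * Z * Y))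
              * (1 - b * c * f * (q * Z * Y)) * (1 - q * (q * Z * Y)))
          * (1 - b * c * d * f ^ 2 * q ^ 2 * Z ^ 2 * Y ^ 2) * Y * W
          * (f * (1 - b * c * d * f * Z) * (1 - b * (q * Z)) * (1 - c * (q * Z))
            * (1 - d * (q * Z)))
          * (E₃ / E₄)
          * (E₁ * (1 - b * c * d * f ^ 2 * q * Z ^ 2 * Y)
            / ((1 - b * c * d * f * q * Z * Y) * E₂ * (1 - b * c * d * f * q ^ 2 * Z ^ 2 * Y))))
        - -((1 - b * c * d * f * q * Z * Y)
            / ((1 - c * d * f * (q * Z * Y)) * (1 - b * d * f * (q * Z * Y))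
              * (1 - b * c * f * (q * Z * Y)) * (1 - q * (q * Z * Y)))
          * (1 - b * c * d * f ^ 2 * q ^ 2 * Z ^ 2 * Y ^ 2) * (q * Y)
          * (W * ((1 - q * Z) * (1 - c * d * f * Z) * (1 - b * d * f * Z) * (1 - b * c * f * Z)))
          * (E₃ * (1 - f * Y) / (E₄ * (1 - q * Y)))
          * (E₁ / ((1 - b * c * d * f * q * Z * Y) * E₂))) := by
  have key := jackson_step_identity b c d f q Z Y
  have g1 : 1 - q ^ 2 * Z * Y = 1 - q * (q * Z * Y) := by ring
  have g2 : 1 - c * d * f * q * Z * Y = 1 - c * d * f * (q * Z * Y) := by ring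
  have g3 : 1 - b * d * f * q * Z * Y = 1 - b * d * f * (q * Z * Y) := by ring
  have g4 : 1 - b * c * f * q * Z * Y = 1 - b * c * f * (q * Z * Y) := by ring
  have g5 : 1 - d * f * q * Z * Y = 1 - d * f * (q * Z * Y) := by ring
  have g6 : 1 - c * f * q * Z * Y = 1 - c * f * (q * Z * Y) := by ring
  have g7 : 1 - b * f * q * Z * Y = 1 - b * f * (q * Z * Y) := by ring
  have g8 : 1 - b * q * Z = 1 - b * (q * Z) := by ring
  have g9 : 1 - c * q * Z = 1 - c * (q * Z) := by ring
  have g10 : 1 - d * q * Z = 1 - d * (q * Z) := by ring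
  rw [g1, g2, g3, g4, g5, g6, g7, g8, g9, g10] at key
  clear g1 g2 g3 g4 g5 g6 g7 g8 g9 g10
  -- Once every linear factor is an atom, the claim is a multiple of `key`, so clearing denominators
  -- never expands the polynomials.
  generalize 1 - q * (q * Z * Y) = x1 at *
  generalize 1 - c * d * f * (q * Z * Y) = x2 at *
  generalize 1 - b * d * f * (q * Z * Y) = x3 at *
  generalize 1 - b * c * f * (q * Z * Y) = x4 at *
  generalize 1 - q * Y = x5 at *
  generalize 1 - b * c * d * f * q * Z * Y = x6 at *
  generalize 1 - b * c * d * f * q ^ 2 * Z ^ 2 * Y = x7 at *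
  generalize 1 - b * c * d * f * q * Z ^ 2 = x8 at *
  generalize 1 - b * c * d * f ^ 2 * q * Z ^ 2 * Y = x9 at *
  generalize 1 - b * c * d * f ^ 2 * q ^ 2 * Z ^ 2 * Y ^ 2 = x10 at *
  generalize 1 - f * Y = x11 at *
  generalize 1 - b * c * d * f ^ 2 * Z * Y = x12 at *
  generalize 1 - b * c * d * f * Z = x13 at *
  generalize 1 - d * f * (q * Z * Y) = x14 at *
  generalize 1 - c * f * (q * Z * Y) = x15 at *
  generalize 1 - b * f * (q * Z * Y) = x16 at *
  generalize 1 - b * (q * Z) = x17 at *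
  generalize 1 - c * (q * Z) = x18 at *
  generalize 1 - d * (q * Z) = x19 at *
  generalize 1 - q * Z = x20 at *
  generalize 1 - c * d * f * Z = x21 at *
  generalize 1 - b * d * f * Z = x22 at *
  generalize 1 - b * c * f * Z = x23 at *
  have hsub := congrArg (fun t => W * E₃ * E₁ / (E₄ * x5 * E₂ * x7 * (x2 * x3 * x4 * x1)) * t) key
  field_simp at hsub ⊢
  linear_combination hsub

theorem jacksonTerm_step (hq0 : q ≠ 0) (hq : ∀ m : ℕ, q * q ^ m ≠ 1)
    (ha : ∀ m : ℕ, a * q ^ m ≠ 1)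
    (hb : ∀ m : ℕ, c * d * f * q ^ m ≠ 1) (hc : ∀ m : ℕ, b * d * f * q ^ m ≠ 1)
    (hd : ∀ m : ℕ, b * c * f * q ^ m ≠ 1) (habcd : a * q = b * c * d * f) (r m : ℕ) :
    jacksonTerm q a b c d f r (m + 1) = jacksonRatio q a b c d f (r + m)
      * jacksonTerm q a b c d f r m + jacksonMate q a b c d f (r + 1) m
      - jacksonMate q a b c d f r (m + 1) := by
  have ha' : a = b * c * d * f / q := by rw [← habcd]; field_simp
  have k1 := sub_ne_zero.2 (hq (r + m)).symm
  have k2 := sub_ne_zero.2 (hb (r + m)).symm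
  have k3 := sub_ne_zero.2 (hc (r + m)).symm
  have k4 := sub_ne_zero.2 (hd (r + m)).symm
  have k5 := sub_ne_zero.2 (hq m).symm
  have k6 := qPoch_ne_zero hq m
  -- The companion vanishes by definition at r = 0. The polynomial identity, in which Z = q^r
  -- belongs to index r + 1, covers only positive indices.
  cases r with
  | zero =>
    have h0 := sub_ne_zero.2 (ha 0).symm
    have h1 := sub_ne_zero.2 (ha (m + 1)).symm
    simp only [jacksonTerm, jacksonMate, jacksonWeight, jacksonRatio, qPoch_zero, zero_add,
      pow_zero, mul_zero, mul_one, one_mul, div_one, qPoch_succ _ _ m, qPoch_succ _ _ 0] at *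
    rw [pow_succ] at *
    have h1' : 1 - b * c * d * f * q ^ m ≠ 0 := by
      rw [← habcd]; convert h1 using 1; ring
    have h0' : q - b * c * d * f ≠ 0 := by
      rw [← habcd]
      have := mul_ne_zero hq0 h0
      convert this using 1; ring
    subst ha'
    field_simp
    ring
  | succ r =>
    set Z := q ^ r with hZ
    set Y := q ^ m with hY
    have e1 : q ^ (r + 1 + m) = q * Z * Y := by rw [hZ, hY]; ring
    have h1 := sub_ne_zero.2 (hq r).symm
    have h2 := sub_ne_zero.2 (hb r).symm
    have h3 := sub_ne_zero.2 (hc r).symm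
    have h4 := sub_ne_zero.2 (hd r).symm
    have h5 := sub_ne_zero.2 (ha (r + 1 + m + 1)).symm
    have h6 := sub_ne_zero.2 (ha (r + 1 + m + 1 + (r + 1))).symm
    have h7 := sub_ne_zero.2 (ha (r + 1 + m + 1 + 1 + (r + 1))).symm
    have h8 : qPoch (a * q ^ (r + 1 + m + 1) * q) q r ≠ 0 := qPoch_ne_zero (fun i => by
      have := ha (r + 1 + m + 1 + 1 + i)
      rwa [pow_add, pow_succ, ← mul_assoc, ← mul_assoc] at this) r
    have t1 : qPoch (a * f * q ^ (r + 1 + (m + 1))) q (r + 1)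
        = qPoch (a * f * q ^ (r + 1 + m) * q) q r * (1 - b * c * d * f ^ 2 * q * Z ^ 2 * Y) := by
      rw [qPoch_succ]
      congr 1
      · ring_nf
      · rw [show a * f * q ^ (r + 1 + (m + 1)) * q ^ r = a * q * f * (q * Z ^ 2 * Y) by
          rw [hZ, hY]; ring, habcd]
        ring
    have t2 : qPoch (a * q ^ (r + 1 + (m + 1) + 1)) q (r + 1)
        = qPoch (a * q ^ (r + 1 + m + 1) * q) q r
          * (1 - b * c * d * f * q ^ 2 * Z ^ 2 * Y) := by
      rw [qPoch_succ]
      congr 1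
      · ring_nf
      · rw [show a * q ^ (r + 1 + (m + 1) + 1) * q ^ r = a * q * (q ^ 2 * Z ^ 2 * Y) by
          rw [hZ, hY]; ring, habcd]
        ring
    have t3 : qPoch (a * f * q ^ (r + 1 + m)) q (r + 1)
        = (1 - b * c * d * f ^ 2 * Z * Y) * qPoch (a * f * q ^ (r + 1 + m) * q) q r := by
      rw [qPoch_succ_left]
      congr 1
      rw [show a * f * q ^ (r + 1 + m) = a * q * f * (Z * Y) by rw [hZ, hY]; ring, habcd]
      ring
    have t4 : qPoch (a * q ^ (r + 1 + m + 1)) q (r + 1)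
        = (1 - b * c * d * f * q * Z * Y) * qPoch (a * q ^ (r + 1 + m + 1) * q) q r := by
      rw [qPoch_succ_left]
      congr 1
      rw [show a * q ^ (r + 1 + m + 1) = a * q * (q * Z * Y) by rw [hZ, hY]; ring, habcd]
      ring
    have t5 : qPoch (a * q ^ (r + 1 + m + 1)) q (r + 1 + 1)
        = (1 - b * c * d * f * q * Z * Y) * qPoch (a * q ^ (r + 1 + m + 1) * q) q r
          * (1 - b * c * d * f * q ^ 2 * Z ^ 2 * Y) := by
      rw [qPoch_succ, t4]
      congr 2
      rw [show a * q ^ (r + 1 + m + 1) * q ^ (r + 1) = a * q * (q ^ 2 * Z ^ 2 * Y) by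
        rw [hZ, hY]; ring, habcd]
      ring
    have t6 : qPoch (a * f * q ^ (r + 1 + m + 1)) q (r + 1)
        = qPoch (a * f * q ^ (r + 1 + m) * q) q r * (1 - b * c * d * f ^ 2 * q * Z ^ 2 * Y) := t1
    have t7 : qPoch (a * f * q ^ (r + (m + 1) + 1)) q r
        = qPoch (a * f * q ^ (r + 1 + m) * q) q r := by
      ring_nf
    have t8 : qPoch (a * q ^ (r + (m + 1) + 1)) q (r + 1)
        = (1 - b * c * d * f * q * Z * Y) * qPoch (a * q ^ (r + 1 + m + 1) * q) q r := by
      rw [← t4]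
      ring_nf
    have u1 : 1 - b * c * d * f * q * Z * Y ≠ 0 := by
      rw [← habcd]; convert h5 using 2; rw [hZ, hY]; ring
    have u2 : 1 - b * c * d * f * q ^ 2 * Z ^ 2 * Y ≠ 0 := by
      rw [← habcd]; convert h6 using 2; rw [hZ, hY]; ring
    have a1 : a * q ^ (2 * (r + 1)) = b * c * d * f * q * Z ^ 2 := by
      rw [← habcd, hZ]; ring
    have a2 : a * q ^ (r + 1 + m + 1) = b * c * d * f * q * Z * Y := by
      rw [← habcd, hZ, hY]; ring
    have a3 : a * f * q ^ (2 * (r + 1 + m) + 1) = b * c * d * f ^ 2 * q ^ 2 * Z ^ 2 * Y ^ 2 := by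
      rw [show a * f * q ^ (2 * (r + 1 + m) + 1) = a * q * (f * q ^ 2 * Z ^ 2 * Y ^ 2) by
        rw [hZ, hY]; ring, habcd]
      ring
    have a4 : a * q ^ (r + 1) = b * c * d * f * Z := by rw [← habcd, hZ]; ring
    -- The companion at (r + 1, m + 1) involves the weight at r. This expresses it through the
    -- weight at r + 1, which the other three terms share.
    have w' : jacksonWeight q a b c d f r
          * (f * (1 - a * Z) * (1 - b * Z) * (1 - c * Z) * (1 - d * Z))
        = jacksonWeight q a b c d f (r + 1) * ((1 - q * Z) * (1 - c * d * f * Z)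
          * (1 - b * d * f * Z) * (1 - b * c * f * Z)) := by
      rw [jacksonWeight_succ, ← hZ, div_mul_cancel₀]
      exact mul_ne_zero (mul_ne_zero (mul_ne_zero h1 h2) h3) h4
    rw [e1] at k1 k2 k3 k4
    have main := jackson_step_algebra (jacksonWeight q a b c d f (r + 1))
      (qPoch (a * f * q ^ (r + 1 + m) * q) q r) (qPoch f q m) k1 k2 k3 k4 k5 k6 h8 u1 u2
    simp only [jacksonTerm, jacksonMate, jacksonRatio, ← hZ]
    rw [t1, t2, t3, t4, t5, t6, t7, t8, mul_assoc _ (jacksonWeight q a b c d f r), w', a1, a2,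
      show r + (m + 1) = r + 1 + m by ring, a2, a3, a4, qPoch_succ f, qPoch_succ q, ← hY, e1,
      show q ^ (r + 1 + m + 1) = q * (q * Z * Y) by rw [pow_succ', e1],
      show q ^ (r + 1) = q * Z by rw [pow_succ'], show q ^ (m + 1) = q * Y by rw [pow_succ']]
    rw [a2, e1] at main
    exact main

/-- Jackson's `8φ7` sum in a form whose only denominators are those of the well-poised part. -/
theorem jackson_sum (hq0 : q ≠ 0) (hq : ∀ m : ℕ, q * q ^ m ≠ 1) (ha : ∀ m : ℕ, a * q ^ m ≠ 1)
    (hb : ∀ m : ℕ, c * d * f * q ^ m ≠ 1) (hc : ∀ m : ℕ, b * d * f * q ^ m ≠ 1)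
    (hd : ∀ m : ℕ, b * c * f * q ^ m ≠ 1) (habcd : a * q = b * c * d * f) (N : ℕ) :
    ∑ r ∈ Finset.range (N + 1),
      (1 - a * q ^ (2 * r)) / (1 - a)
        * (qPoch a q r * qPoch b q r * qPoch c q r * qPoch d q r
          / (qPoch q q r * qPoch (c * d * f) q r * qPoch (b * d * f) q r * qPoch (b * c * f) q r))
        * f ^ r * (qPoch f q (N - r) / qPoch q q (N - r))
        * (qPoch (a * f * q ^ N) q r / qPoch (a * q ^ (N + 1)) q r)
      = qPoch (a * q) q N * qPoch (d * f) q N * qPoch (c * f) q N * qPoch (b * f) q N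
        / (qPoch (c * d * f) q N * qPoch (b * d * f) q N * qPoch (b * c * f) q N
          * qPoch q q N) := by
  have h := sum_eq_prod_of_telescoping (jacksonTerm q a b c d f) (jacksonMate q a b c d f)
    (jacksonRatio q a b c d f) (fun _ => rfl) (jacksonTerm_last ha)
    (jacksonTerm_step hq0 hq ha hb hc hd habcd) N
  have h00 : jacksonTerm q a b c d f 0 0 = 1 := by
    have := sub_ne_zero.2 (ha 0).symm
    simp only [pow_zero, mul_one] at this
    simp [jacksonTerm, jacksonWeight, this]
  rw [h00, mul_one] at h
  refine Eq.trans (Finset.sum_congr rfl fun r hr => ?_) (h.trans ?_)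
  · rw [jacksonTerm, jacksonWeight,
      show r + (N - r) = N by have := Finset.mem_range.1 hr; omega]
    ring
  · simp only [jacksonRatio, qPoch, ← Finset.prod_mul_distrib, ← Finset.prod_div_distrib]
    refine Finset.prod_congr rfl fun i _ => ?_
    ring

end Summations

/-! ### The q-Saalschütz sum and the combination of two such sums for Warnaar's chain. -/

section Saalschutz
variable {K : Type*} [Field K]

/-- The part of the Saalschütz summand depending only on the summation index. -/
def saalschutzWeight (q x u c e : K) (r : ℕ) : K :=
  qPoch u q r * qPoch c q r / (qPoch q q r * qPoch e q r) * x ^ r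

/-- The companion of the Saalschütz summand in its telescoping relation. -/
def saalschutzMate (q x u c e : K) : ℕ → ℕ → K
  | 0, _ => 0
  | r + 1, m =>
    -(q ^ m * (x * (1 - u * q ^ r) * (1 - c * q ^ r)) * saalschutzWeight q x u c e r
      * (qPoch x q m / qPoch q q m) / ((1 - q * q ^ (r + m)) * (1 - e * q ^ (r + m))))

theorem saalschutzWeight_succ (q x u c e : K) (r : ℕ) :
    saalschutzWeight q x u c e (r + 1) = saalschutzWeight q x u c e r
      * (x * (1 - u * q ^ r) * (1 - c * q ^ r)) / ((1 - q * q ^ r) * (1 - e * q ^ r)) := by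
  simp only [saalschutzWeight, qPoch_succ, pow_succ, div_eq_mul_inv, mul_inv]
  ring

variable {q x u c e : K}

/-- The `q`-Saalschütz sum. -/
theorem saalschutz_sum (hq : ∀ m : ℕ, q * q ^ m ≠ 1) (he : ∀ m : ℕ, e * q ^ m ≠ 1)
    (hxuc : e = x * u * c) (N : ℕ) :
    ∑ r ∈ Finset.range (N + 1), saalschutzWeight q x u c e r
        * (qPoch x q (N - r) / qPoch q q (N - r))
      = qPoch (x * c) q N * qPoch (x * u) q N / (qPoch q q N * qPoch e q N) := by
  have h := sum_eq_prod_of_telescoping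
    (fun r m => saalschutzWeight q x u c e r * (qPoch x q m / qPoch q q m))
    (saalschutzMate q x u c e)
    (fun N => (1 - x * c * q ^ N) * (1 - x * u * q ^ N) / ((1 - q * q ^ N) * (1 - e * q ^ N)))
    (fun _ => rfl)
    (fun r => by
      simp only [saalschutzMate, saalschutzWeight_succ, qPoch_zero, add_zero]
      ring)
    (fun r m => by
      have k1 := sub_ne_zero.2 (hq (r + m)).symm
      have k2 := sub_ne_zero.2 (he (r + m)).symm
      have k3 := sub_ne_zero.2 (hq m).symm
      have k4 := qPoch_ne_zero hq m
      cases r with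
      | zero =>
        simp only [saalschutzMate, zero_add, pow_zero, mul_one, qPoch_succ _ _ m] at *
        generalize saalschutzWeight q x u c e 0 = W
        generalize qPoch x q m = E
        generalize qPoch q q m = E' at *
        generalize q ^ m = Y at *
        obtain ⟨D₁, hD₁⟩ : ∃ D, D = 1 - q * Y := ⟨_, rfl⟩
        obtain ⟨D₂, hD₂⟩ : ∃ D, D = 1 - e * Y := ⟨_, rfl⟩
        rw [← hD₁] at k1 ⊢
        rw [← hD₂] at k2 ⊢
        field_simp
        rw [hD₁, hD₂, hxuc]
        ring
      | succ r =>
        have h1 := sub_ne_zero.2 (hq r).symm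
        have h2 := sub_ne_zero.2 (he r).symm
        have w : saalschutzWeight q x u c e r * (x * (1 - u * q ^ r) * (1 - c * q ^ r))
            = saalschutzWeight q x u c e (r + 1) * ((1 - q * q ^ r) * (1 - e * q ^ r)) := by
          rw [saalschutzWeight_succ, div_mul_cancel₀]
          exact mul_ne_zero h1 h2
        have e1 : q ^ (r + 1 + m) = q * q ^ r * q ^ m := by ring
        simp only [saalschutzMate, qPoch_succ _ _ m]
        rw [show r + (m + 1) = r + 1 + m by ring, mul_assoc (q ^ (m + 1)),
          mul_comm (x * (1 - u * q ^ r) * (1 - c * q ^ r)), w, e1, pow_succ' q r, pow_succ' q m]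
        rw [e1] at k1 k2
        generalize saalschutzWeight q x u c e (r + 1) = W
        generalize qPoch x q m = E
        generalize qPoch q q m = E' at *
        generalize q ^ m = Y at *
        generalize q ^ r = Z at *
        obtain ⟨D₁, hD₁⟩ : ∃ D, D = 1 - q * (q * Z * Y) := ⟨_, rfl⟩
        obtain ⟨D₂, hD₂⟩ : ∃ D, D = 1 - e * (q * Z * Y) := ⟨_, rfl⟩
        obtain ⟨D₃, hD₃⟩ : ∃ D, D = 1 - q * Y := ⟨_, rfl⟩
        rw [← hD₁] at k1 ⊢
        rw [← hD₂] at k2 ⊢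
        rw [← hD₃] at k3 ⊢
        field_simp
        rw [hD₁, hD₂, hD₃, hxuc]
        ring) N
  rw [h]
  simp only [qPoch, saalschutzWeight, Finset.range_zero, Finset.prod_empty,
    ← Finset.prod_mul_distrib, ← Finset.prod_div_distrib]
  simp

theorem saalschutzWeight_bump (he : ∀ m : ℕ, e * q ^ m ≠ 1) (r : ℕ) :
    saalschutzWeight q x u c (e * q) r * (1 - e * q ^ r)
      = (1 - e) * saalschutzWeight q x u c e r := by
  have h1 := qPoch_ne_zero he r
  have h2 : qPoch (e * q) q r ≠ 0 := qPoch_ne_zero (fun m => by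
    have := he (m + 1); rwa [pow_succ', ← mul_assoc] at this) r
  have h3 : qPoch e q r * (1 - e * q ^ r) = (1 - e) * qPoch (e * q) q r := by
    rw [← qPoch_succ, qPoch_succ_left]
  rw [saalschutzWeight, saalschutzWeight]
  rw [div_mul_eq_mul_div, div_mul_eq_mul_div, div_mul_eq_mul_div, mul_div_assoc',
    mul_comm (qPoch q q r), mul_comm (qPoch q q r), ← div_div, ← div_div]
  congr 1
  rw [div_eq_div_iff h2 h1]
  linear_combination qPoch u q r * qPoch c q r * x ^ r * h3

/-- A `q`-Saalschütz sum with an additional linear factor, valid also for `e = 1`. -/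
theorem saalschutz_sum_mul (hq : ∀ m : ℕ, q * q ^ m ≠ 1)
    (he : ∀ m : ℕ, e * q ^ (m + 1) ≠ 1) (hxuc : e = x * u * c) (N : ℕ) :
    ∑ r ∈ Finset.range (N + 1), saalschutzWeight q x u c (e * q) r * (1 - e * q ^ r)
        * (qPoch x q (N - r) / qPoch q q (N - r))
      = (1 - e * q ^ N) * (qPoch (x * c) q N * qPoch (x * u) q N)
        / (qPoch q q N * qPoch (e * q) q N) := by
  -- For e ≠ 1 the factor 1 - e q^r turns (e q; q)_r into (e; q)_r up to a constant. At e = 1 this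
  -- fails because (e; q)_r = 0 for r ≥ 1. This case occurs for Warnaar's chain with a = 1, which
  -- part (A) allows.
  by_cases h1 : e = 1
  · rw [h1] at hxuc ⊢
    cases N with
    | zero => simp
    | succ N =>
      have hq' : ∀ m : ℕ, q * q * q ^ m ≠ 1 := fun m => by
        have := hq (m + 1); rwa [pow_succ', ← mul_assoc] at this
      -- At e = 1 the term r = 0 vanishes. The rest, shifted by one, is a Saalschütz sum with
      -- parameters u q, c q, q², which is again balanced since x u c = 1.
      have hw : ∀ r, saalschutzWeight q x u c (1 * q) (r + 1) * (1 - 1 * q ^ (r + 1))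
          = x * (1 - u) * (1 - c) / (1 - q)
            * saalschutzWeight q x (u * q) (c * q) (q * q) r := by
        intro r
        have a1 := qPoch_ne_zero hq r
        have a2 := qPoch_ne_zero hq' r
        have a3 := sub_ne_zero.2 (hq r).symm
        have a4 := sub_ne_zero.2 (hq 0).symm
        rw [pow_zero, mul_one] at a4
        simp only [saalschutzWeight, one_mul]
        rw [qPoch_succ_left u, qPoch_succ_left c]
        nth_rw 1 [qPoch_succ]
        rw [qPoch_succ_left, pow_succ' q, pow_succ x]
        field_simp
      rw [Finset.sum_range_succ']
      simp only [pow_zero, mul_one, sub_self, mul_zero, zero_mul, add_zero, hw,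
        Nat.add_sub_add_right, mul_assoc (x * (1 - u) * (1 - c) / (1 - q))]
      have hS := saalschutz_sum (x := x) (u := u * q) (c := c * q) (e := q * q) hq hq'
        (by linear_combination q ^ 2 * hxuc) N
      rw [← Finset.mul_sum, hS]
      have a1 := qPoch_ne_zero hq N
      have a2 := qPoch_ne_zero hq' N
      have a3 := sub_ne_zero.2 (hq N).symm
      have a4 := sub_ne_zero.2 (hq 0).symm
      rw [pow_zero, mul_one] at a4
      rw [qPoch_succ_left (x * c), qPoch_succ_left (x * u), one_mul, one_mul]
      nth_rw 1 [qPoch_succ q q N]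
      rw [qPoch_succ_left q, pow_succ' q, ← mul_assoc x, ← mul_assoc x]
      have key : x * (1 - u) * (1 - c) = (1 - x * c) * (1 - x * u) := by
        linear_combination (x - 1) * hxuc
      rw [key]
      field_simp
  · have he' : ∀ m : ℕ, e * q ^ m ≠ 1 := fun m => by
      cases m with
      | zero => simpa using h1
      | succ m => exact he m
    simp only [saalschutzWeight_bump he', mul_assoc (1 - e)]
    rw [← Finset.mul_sum, saalschutz_sum hq he' hxuc]
    have b1 := qPoch_ne_zero he' N
    have b2 := qPoch_ne_zero hq N
    have b3 : qPoch (e * q) q N ≠ 0 := qPoch_ne_zero (fun m => by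
      have := he m; rwa [pow_succ', ← mul_assoc] at this) N
    have h3 : qPoch e q N * (1 - e * q ^ N) = (1 - e) * qPoch (e * q) q N := by
      rw [← qPoch_succ, qPoch_succ_left]
    rw [mul_div_assoc', div_eq_div_iff (mul_ne_zero b2 b1) (mul_ne_zero b2 b3)]
    linear_combination -qPoch (x * c) q N * qPoch (x * u) q N * qPoch q q N * h3

/-- The summation behind Warnaar's first chain. -/
theorem warnaar_sum {s v : K} (hq : ∀ m : ℕ, q * q ^ m ≠ 1) (hs : s ≠ 0) (hv : v ≠ 0)
    (he : ∀ m : ℕ, v * s * q ^ (m + 1) ≠ 1) (N : ℕ) :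
    (1 - s) * ∑ r ∈ Finset.range (N + 1), (1 + v * q ^ r)
        * saalschutzWeight q (s ^ 2 / v ^ 2) (v / s) (v ^ 2) (v * s * q) r
        * (qPoch (s ^ 2 / v ^ 2) q (N - r) / qPoch q q (N - r))
      = (1 + v) * (1 - s * q ^ N) * (qPoch (s / v) q N * qPoch (s ^ 2) q N)
        / (qPoch q q N * qPoch (v * s * q) q N) := by
  have e1 : s ^ 2 / v ^ 2 * v ^ 2 = s ^ 2 := by field_simp
  have e2 : s ^ 2 / v ^ 2 * (v / s) = s / v := by field_simp
  have e3 : s ^ 2 / v ^ 2 * (v / s * q) = s / v * q := by field_simp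
  have S1 := saalschutz_sum_mul (x := s ^ 2 / v ^ 2) (u := v / s) (c := v ^ 2) hq he
    (by field_simp) N
  have he' : ∀ m : ℕ, v * s * q * q ^ m ≠ 1 := fun m => by
    have := he m; rwa [pow_succ', ← mul_assoc] at this
  have S2 := saalschutz_sum (x := s ^ 2 / v ^ 2) (u := v / s * q) (c := v ^ 2) hq he'
    (by field_simp) N
  -- The factor 1 - (v/s) q^r raises the parameter v/s to q v/s, giving an ordinary Saalschütz sum
  -- with lower parameter v s q.
  have hw : ∀ r, (1 - v / s * q ^ r) * saalschutzWeight q (s ^ 2 / v ^ 2) (v / s) (v ^ 2)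
      (v * s * q) r = (1 - v / s) * saalschutzWeight q (s ^ 2 / v ^ 2) (v / s * q) (v ^ 2)
        (v * s * q) r := by
    intro r
    have h3 : qPoch (v / s) q r * (1 - v / s * q ^ r) = (1 - v / s) * qPoch (v / s * q) q r := by
      rw [← qPoch_succ, qPoch_succ_left]
    simp only [saalschutzWeight, div_eq_mul_inv] at h3 ⊢
    linear_combination qPoch (v ^ 2) q r * (qPoch q q r * qPoch (v * s * q) q r)⁻¹
      * (s ^ 2 * (v ^ 2)⁻¹) ^ r * h3
  rw [e1, e2] at S1
  rw [e1, e3] at S2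
  have h4 : qPoch (s / v) q N * (1 - s / v * q ^ N) = (1 - s / v) * qPoch (s / v * q) q N := by
    rw [← qPoch_succ, qPoch_succ_left]
  have h5 : (v - s) * qPoch (s / v * q) q N = qPoch (s / v) q N * (v - s * q ^ N) := by
    have : v - s = v * (1 - s / v) := by field_simp
    rw [this, mul_assoc, ← h4]
    field_simp
  have split : ∀ r ∈ Finset.range (N + 1), (1 - s) * ((1 + v * q ^ r)
        * saalschutzWeight q (s ^ 2 / v ^ 2) (v / s) (v ^ 2) (v * s * q) r
        * (qPoch (s ^ 2 / v ^ 2) q (N - r) / qPoch q q (N - r)))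
      = saalschutzWeight q (s ^ 2 / v ^ 2) (v / s) (v ^ 2) (v * s * q) r * (1 - v * s * q ^ r)
        * (qPoch (s ^ 2 / v ^ 2) q (N - r) / qPoch q q (N - r))
        + (v - s) * (saalschutzWeight q (s ^ 2 / v ^ 2) (v / s * q) (v ^ 2) (v * s * q) r
        * (qPoch (s ^ 2 / v ^ 2) q (N - r) / qPoch q q (N - r))) := by
    intro r _
    -- This splitting of the linear factor produces the two Saalschütz sums: its first part is the
    -- extra factor of `saalschutz_sum_mul` with e = v s, its second the factor treated in `hw`.
    have h6 : (1 - s) * (1 + v * q ^ r) = (1 - v * s * q ^ r) - s * (1 - v / s * q ^ r) := by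
      field_simp
      ring
    have h7 : -s * (1 - v / s) = v - s := by field_simp; ring
    generalize qPoch (s ^ 2 / v ^ 2) q (N - r) / qPoch q q (N - r) = E
    rw [← h7]
    linear_combination E * saalschutzWeight q (s ^ 2 / v ^ 2) (v / s) (v ^ 2) (v * s * q) r * h6
      - s * E * hw r
  rw [Finset.mul_sum, Finset.sum_congr rfl split, Finset.sum_add_distrib, ← Finset.mul_sum, S1, S2]
  rw [mul_div_assoc', ← add_div]
  congr 1
  -- After `h5` extracts a common (s/v; q)_N, the two results combine by (1 - v s q^N) + (v - s q^N)
  -- = (1 + v)(1 - s q^N).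
  linear_combination qPoch (s ^ 2) q N * h5

end Saalschutz

/-! ### Chains as matrix identities, and the unit pair. -/

section Kernels
variable {K : Type*} [Field K]

/-- The matrix expressing `β` in terms of `α` in a WP-Bailey pair. -/
def wpKernel (q a k : K) (n j : ℕ) : K :=
  qPoch (k / a) q (n - j) * qPoch k q (n + j) / (qPoch q q (n - j) * qPoch (a * q) q (n + j))

theorem wpKernel_add (q a k : K) (i N : ℕ) :
    wpKernel q a k (i + N) i = qPoch (k / a) q N * (qPoch k q (2 * i) * qPoch (k * q ^ (2 * i)) q N)
      / (qPoch q q N * (qPoch (a * q) q (2 * i) * qPoch (a * q ^ (2 * i) * q) q N)) := by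
  rw [wpKernel, show i + N - i = N by omega, show i + N + i = 2 * i + N by ring, qPoch_add k,
    qPoch_add (a * q)]
  ring_nf

/-- Associativity M(Tα) = (MT)α for one row of lower triangular matrices. -/
theorem sum_mul_sum_lower (M : ℕ → K) (T : ℕ → ℕ → K) (α : ℕ → K) (n : ℕ) :
    ∑ j ∈ Finset.range (n + 1), M j * ∑ i ∈ Finset.range (j + 1), T j i * α i
      = ∑ i ∈ Finset.range (n + 1),
        (∑ r ∈ Finset.range (n - i + 1), M (i + r) * T (i + r) i) * α i := by
  have h : ∀ i ∈ Finset.range (n + 1),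
      (∑ r ∈ Finset.range (n - i + 1), M (i + r) * T (i + r) i) * α i
        = ∑ j ∈ Finset.Ico i (n + 1), M j * (T j i * α i) := by
    intro i hi
    have hi := Finset.mem_range.1 hi
    rw [Finset.sum_Ico_eq_sum_range, show n + 1 - i = n - i + 1 by omega, Finset.sum_mul]
    exact Finset.sum_congr rfl fun r _ => by ring
  rw [Finset.sum_congr rfl h]
  simp only [Finset.mul_sum]
  refine Finset.sum_comm' fun j i => ?_
  simp only [Finset.mem_range, Finset.mem_Ico]
  omega

/-- A chain with kernel `M` intertwining the matrices of two parameter pairs maps WP-Bailey pairs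
to WP-Bailey pairs. -/
theorem isWPBaileyPair_of_kernel {q a c k : K} {g : ℕ → K} {M : ℕ → ℕ → K}
    (hM : ∀ i N, ∑ r ∈ Finset.range (N + 1), M (i + N) (i + r) * wpKernel q a c (i + r) i
      = g i * wpKernel q a k (i + N) i) {α β : ℕ → K} (h : IsWPBaileyPair q a c α β)
    {β' : ℕ → K} (hβ' : ∀ n, β' n = ∑ j ∈ Finset.range (n + 1), M n j * β j) :
    IsWPBaileyPair q a k (fun n => g n * α n) β' := by
  intro n
  have h1 : ∀ j ∈ Finset.range (n + 1), M n j * β j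
      = M n j * ∑ i ∈ Finset.range (j + 1), wpKernel q a c j i * α i := fun j _ => by
    rw [h j]; rfl
  rw [hβ', Finset.sum_congr rfl h1, sum_mul_sum_lower]
  refine Finset.sum_congr rfl fun i hi => ?_
  obtain ⟨N, rfl⟩ : ∃ N, n = i + N := ⟨n - i, by have := Finset.mem_range.1 hi; omega⟩
  rw [show i + N - i = N by omega, hM]
  simp only [wpKernel]
  rw [show i + N - i = N by omega]
  ring

/-- The first member of the WP-Bailey pair relative to `(a, c)` with `β_n = δ_{n,0}`. -/
def unitAlpha (q a c : K) (r : ℕ) : K :=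
  (1 - a * q ^ (2 * r)) / (1 - a)
    * (qPoch a q r * qPoch (a / c) q r / (qPoch q q r * qPoch (c * q) q r)) * (c / a) ^ r

variable {q a k c : K}

/-- A case of Jackson's sum with parameters b = q, c = a, d = a/c, f = c/a. The factors (q)_r and
(a)_r cancel from the weight, and d f = 1 puts (1; q)_N into the product side, which is zero for N ≥
1. -/
theorem unit_pair (hq0 : q ≠ 0) (hq : ∀ m : ℕ, q * q ^ m ≠ 1) (ha0 : a ≠ 0) (hc0 : c ≠ 0)
    (ha : ∀ m : ℕ, a * q ^ m ≠ 1) (hc : ∀ m : ℕ, c * q ^ m ≠ 1) (N : ℕ) :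
    ∑ r ∈ Finset.range (N + 1), wpKernel q a c N r * unitAlpha q a c r
      = if N = 0 then 1 else 0 := by
  rcases Nat.eq_zero_or_pos N with rfl | hN
  · have := sub_ne_zero.2 (ha 0).symm
    simp only [pow_zero, mul_one] at this
    simp [wpKernel, unitAlpha, this]
  have e1 : a * (a / c) * (c / a) = a := by field_simp
  have e2 : q * (a / c) * (c / a) = q := by field_simp
  have e3 : q * a * (c / a) = c * q := by field_simp
  have e4 : a / c * (c / a) = 1 := by field_simp
  have e5 : a * (c / a) = c := by field_simp
  have hc' : ∀ m : ℕ, c * q * q ^ m ≠ 1 := fun m => by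
    have := hc (m + 1); rwa [pow_succ', ← mul_assoc] at this
  have J := jackson_sum (q := q) (a := a) (b := q) (c := a) (d := a / c) (f := c / a) hq0 hq ha
    (by rwa [e1]) (by rwa [e2]) (by rwa [e3]) (by field_simp) N
  rw [e1, e2, e3, e4, e5] at J
  obtain ⟨M, rfl⟩ : ∃ M, N = M + 1 := ⟨N - 1, by omega⟩
  rw [qPoch_one q M, mul_zero, zero_mul, zero_mul, zero_div] at J
  rw [if_neg (by omega), ← mul_zero (qPoch c q (M + 1) / qPoch (a * q) q (M + 1)), ← J,
    Finset.mul_sum]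
  refine Finset.sum_congr rfl fun r _ => ?_
  have h1 := qPoch_ne_zero hq r
  have h2 := qPoch_ne_zero ha r
  rw [wpKernel, unitAlpha, qPoch_add c, qPoch_add (a * q),
    show a * q * q ^ (M + 1) = a * q ^ (M + 1 + 1) by ring]
  have h3 : qPoch a q r * qPoch q q r * qPoch a q r * qPoch (a / c) q r
      / (qPoch q q r * qPoch a q r * qPoch q q r * qPoch (c * q) q r)
      = qPoch a q r * qPoch (a / c) q r / (qPoch q q r * qPoch (c * q) q r) := by
    rw [mul_assoc (qPoch a q r * qPoch q q r), mul_comm (qPoch a q r) (qPoch q q r),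
      mul_assoc (qPoch q q r * qPoch a q r) (qPoch q q r),
      mul_div_mul_left _ _ (mul_ne_zero h1 h2)]
  rw [h3]
  simp only [div_eq_mul_inv, mul_inv]
  ring

/-- The chain with kernel `M` applied to the unit pair. -/
theorem sum_unitAlpha {M T : ℕ → K} {g : ℕ → K} (hq0 : q ≠ 0) (hq : ∀ m : ℕ, q * q ^ m ≠ 1)
    (ha0 : a ≠ 0) (hc0 : c ≠ 0)
    (ha : ∀ m : ℕ, a * q ^ m ≠ 1) (hc : ∀ m : ℕ, c * q ^ m ≠ 1) (N : ℕ)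
    (hM : ∀ i ≤ N, ∑ r ∈ Finset.range (N - i + 1), M (i + r) * wpKernel q a c (i + r) i
      = T i * g i) :
    ∑ r ∈ Finset.range (N + 1), T r * unitAlpha q a c r * g r = M 0 := by
  -- Since L_c applied to the unit sequence is e_0, only the entry M 0 survives on the left.
  have h := sum_mul_sum_lower M (wpKernel q a c) (unitAlpha q a c) N
  simp only [unit_pair hq0 hq ha0 hc0 ha hc] at h
  simp only [mul_ite, mul_one, mul_zero, Finset.sum_ite_eq', Finset.mem_range, Nat.zero_lt_succ,
    if_true] at h
  rw [h]
  refine Finset.sum_congr rfl fun i hi => ?_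
  rw [hM i (by have := Finset.mem_range.1 hi; omega)]
  ring

end Kernels

/-! ### The general chain with e = a: reduction to j = 0 and to a kernel. -/

section GeneralChain
variable {K : Type*} [Field K] {q a k c : K}

theorem GeneralChainDefined.a_pow' (h : GeneralChainDefined q a k a c) (m : ℕ) :
    a * q ^ m ≠ 1 := by
  cases m with
  | zero => simpa using h.e_pow 0
  | succ m => exact h.a_pow m

theorem GeneralChainDefined.k_div (h : GeneralChainDefined q a k a c) (m : ℕ) :
    k / a * q ^ m ≠ 1 := by
  have ha := h.a_ne
  intro h1
  apply h.k_pow m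
  field_simp at h1
  exact h1

theorem GeneralChainDefined.shift (hq0 : q ≠ 0) (h : GeneralChainDefined q a k a c) (j : ℕ) :
    GeneralChainDefined q (a * q ^ (2 * j)) (k * q ^ (2 * j)) (a * q ^ (2 * j))
      (c * q ^ (2 * j)) where
  a_ne := mul_ne_zero h.a_ne (pow_ne_zero _ hq0)
  k_ne := mul_ne_zero h.k_ne (pow_ne_zero _ hq0)
  e_ne := mul_ne_zero h.a_ne (pow_ne_zero _ hq0)
  c_ne := mul_ne_zero h.c_ne (pow_ne_zero _ hq0)
  a_pow m := by rw [mul_assoc, ← pow_add]; exact h.a_pow' _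
  e_pow m := by rw [mul_assoc, ← pow_add]; exact h.a_pow' _
  c_pow m := by rw [mul_assoc, ← pow_add]; exact h.c_pow _
  k_pow m h1 := h.k_pow m (mul_right_cancel₀ (pow_ne_zero (2 * j) hq0) (by rw [← h1]; ring))

/-- Multiplying a, k, c by q^(2j) leaves a/c, k/a and the base q a c / (k e) of the powers unchanged
and absorbs every other occurrence of j. Only the multiplier needs its own shift rule, supplied by
`hg`. -/
theorem generalInner_shift (hq0 : q ≠ 0) {g g' : ℕ → K} (j N : ℕ)
    (hg : ∀ r, g (r + j) = g j * g' r) :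
    generalInner q a k a c g (j + N) j
      = g j * generalInner q (a * q ^ (2 * j)) (k * q ^ (2 * j)) (a * q ^ (2 * j))
        (c * q ^ (2 * j)) g' N 0 := by
  have hj : q ^ (2 * j) ≠ 0 := pow_ne_zero _ hq0
  rw [generalInner, generalInner, Finset.mul_sum, show j + N - j = N by omega, Nat.sub_zero]
  refine Finset.sum_congr rfl fun r _ => ?_
  have e1 : a * q ^ (2 * j) * q / (k * q ^ (2 * j) * q ^ N) = a * q / (k * q ^ N) := by
    rw [mul_right_comm a, mul_right_comm k, mul_div_mul_right _ _ hj]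
  have e2 : a * q ^ (2 * j) / (c * q ^ (2 * j)) = a / c := mul_div_mul_right _ _ hj
  have e3 : q * (a * q ^ (2 * j)) * (c * q ^ (2 * j)) / (k * q ^ (2 * j) * (a * q ^ (2 * j)))
      = q * a * c / (k * a) := by
    rw [← mul_div_mul_right (q * a * c) (k * a) (mul_ne_zero hj hj)]
    ring_nf
  rw [e1, e2, e3, hg, show q ^ (2 * j + 2 * r) = q ^ (2 * j) * q ^ (2 * 0 + 2 * r) by ring,
    show q ^ (j + N + j) = q ^ (2 * j) * q ^ (N + 0) by ring,
    show q ^ (j + N + j + 1) = q ^ (2 * j) * q ^ (N + 0 + 1) by ring,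
    show q ^ (2 * j + 1) = q ^ (2 * j) * q ^ (2 * 0 + 1) by ring]
  simp only [← mul_assoc, mul_zero, pow_zero, mul_one]
  ring_nf

/-- The general inner sum in terms of the unit pair. -/
theorem generalInner_zero (hq0 : q ≠ 0) (hq : ∀ m : ℕ, q * q ^ m ≠ 1)
    (h : GeneralChainDefined q a k a c) (g : ℕ → K) (N : ℕ) :
    qPoch (k / a) q N / qPoch q q N * generalInner q a k a c g N 0
      = ∑ r ∈ Finset.range (N + 1), qPoch (k / a) q (N - r) / qPoch q q (N - r)
        * (qPoch (k * q ^ N) q r / qPoch (a * q ^ (N + 1)) q r) * unitAlpha q a c r * g r := by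
  have ha0 := h.a_ne
  have hk0 := h.k_ne
  rw [generalInner, Finset.mul_sum, Nat.sub_zero]
  refine Finset.sum_congr rfl fun r hr => ?_
  obtain ⟨m, rfl⟩ : ∃ m, N = r + m := ⟨N - r, by have := Finset.mem_range.1 hr; omega⟩
  -- Reversal trades the quotient containing q^(-N) for (k/a)_{N-r} / (q)_{N-r}. It uses the factor
  -- (q a / k)^r of the power in the summand; the remaining (c/a)^r is the one in `unitAlpha`.
  have R := qPoch_reverse (x := k / a) hq0 hq (div_ne_zero hk0 ha0) h.k_div r m
  have e1 : q / (k / a * q ^ (r + m)) = a * q / (k * q ^ (r + m)) := by field_simp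
  have e2 : q * a * c / (k * a) = q / (k / a) * (c / a) := by field_simp
  rw [e1] at R
  rw [e2, unitAlpha, show r + m - r = m by omega, mul_pow]
  have h1 := qPoch_ne_zero hq (r + m)
  have h2 := qPoch_ne_zero h.k_div (r + m)
  have R' : qPoch (k / a) q m / qPoch q q m = qPoch (k / a) q (r + m) / qPoch q q (r + m)
      * (qPoch ((q ^ (r + m))⁻¹) q r / qPoch (a * q / (k * q ^ (r + m))) q r
        * (q / (k / a)) ^ r) := by
    rw [R]
    field_simp
  rw [R']
  simp only [mul_zero, zero_add, add_zero, pow_zero, mul_one, pow_one, div_eq_mul_inv, mul_inv]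
  ring

/-- Since e = a, the factor (e q)_{2j} cancels the first 2j factors of (a q)_{n+j}, and (1 - c
q^(2j)) / ((1 - c)(c q)_{2j}) = 1 / (c)_{2j}. What remains is the left side of `hM`, so a chain is
identified by comparing this expression with its kernel. -/
theorem generalBeta_eq {g : ℕ → K} {M : ℕ → ℕ → K} (hq0 : q ≠ 0)
    (h : GeneralChainDefined q a k a c) (g' : ℕ → ℕ → K)
    (hg : ∀ j r, g (r + j) = g j * g' j r)
    (hM : ∀ j N, qPoch k q (2 * j) / qPoch c q (2 * j) * g j
      * (qPoch (k / a) q N * qPoch (k * q ^ (2 * j)) q N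
          / (qPoch q q N * qPoch (a * q ^ (2 * j) * q) q N)
        * generalInner q (a * q ^ (2 * j)) (k * q ^ (2 * j)) (a * q ^ (2 * j))
            (c * q ^ (2 * j)) (g' j) N 0) = M (j + N) j) (β : ℕ → K) (n : ℕ) :
    generalBeta q a k a c g β n = ∑ j ∈ Finset.range (n + 1), M n j * β j := by
  refine Finset.sum_congr rfl fun j hj => ?_
  obtain ⟨N, rfl⟩ : ∃ N, n = j + N := ⟨n - j, by have := Finset.mem_range.1 hj; omega⟩
  rw [← hM, generalInner_shift hq0 j N (hg j), show j + N - j = N by omega,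
    show j + N + j = 2 * j + N by ring, qPoch_add k, qPoch_add (a * q)]
  have h1 : qPoch c q (2 * j) * (1 - c * q ^ (2 * j)) = (1 - c) * qPoch (c * q) q (2 * j) := by
    rw [← qPoch_succ, qPoch_succ_left]
  have h2 := qPoch_ne_zero h.c_pow (2 * j)
  have h3 := sub_ne_zero.2 (h.c_pow (2 * j)).symm
  have h4 : qPoch (a * q) q (2 * j) ≠ 0 := qPoch_ne_zero (fun m => by
    have := h.a_pow m; rwa [pow_succ', ← mul_assoc] at this) _
  have h5 : (1 - c * q ^ (2 * j)) / ((1 - c) * qPoch (c * q) q (2 * j))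
      = 1 / qPoch c q (2 * j) := by
    rw [← h1]
    field_simp
  rw [show a * q * q ^ (2 * j) = a * q ^ (2 * j) * q by ring]
  generalize generalInner q (a * q ^ (2 * j)) (k * q ^ (2 * j)) (a * q ^ (2 * j))
    (c * q ^ (2 * j)) (g' j) N 0 = I
  calc _ = β j * ((1 - c * q ^ (2 * j)) / ((1 - c) * qPoch (c * q) q (2 * j)))
        * (qPoch (k / a) q N * (qPoch k q (2 * j) * qPoch (k * q ^ (2 * j)) q N)
          / (qPoch q q N * qPoch (a * q ^ (2 * j) * q) q N))
        * (qPoch (a * q) q (2 * j) / qPoch (a * q) q (2 * j)) * (g j * I) := by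
        simp only [div_eq_mul_inv, mul_inv]
        ring
    _ = _ := by
        rw [h5, div_self h4]
        simp only [div_eq_mul_inv, mul_inv]
        ring

end GeneralChain

/-! ### Andrews' first chain, preceded by tools shared by all four chains. -/

section AndrewsOne
variable {K : Type*} [Field K] {q a k c ρ₁ ρ₂ : K}

theorem qPoch_mul_eq (x q : K) (n : ℕ) :
    qPoch x q n * (1 - x * q ^ n) = (1 - x) * qPoch (x * q) q n := by
  rw [← qPoch_succ, qPoch_succ_left]

/-- A cancellation device: u is taken to be a product of quotients z / z with z ≠ 0. The equation x
= u y then balances as a commutative ring identity in which inverses are independent atoms. -/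
theorem eq_of_eq_mul_of_eq_one {x y u : K} (hu : u = 1) (h : x = u * y) : x = y := by
  rw [h, hu, one_mul]

/-- Pairing x with -x removes the square roots from the series S_N. -/
theorem qPoch_mul_neg (x q : K) (n : ℕ) :
    qPoch x q n * qPoch (-x) q n = qPoch (x ^ 2) (q ^ 2) n := by
  simp only [qPoch, ← Finset.prod_mul_distrib]
  exact Finset.prod_congr rfl fun i _ => by ring

theorem very_well_poised_factor {t : K} (ha : ∀ m : ℕ, a * q ^ m ≠ 1) (ht : t ^ 2 = a) (r : ℕ) :
    (1 - a * q ^ (2 * r)) / (1 - a)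
      = qPoch (q * t) q r * qPoch (-(q * t)) q r / (qPoch t q r * qPoch (-t) q r) := by
  have h0 := sub_ne_zero.2 (ha 0).symm
  rw [pow_zero, mul_one] at h0
  have h1 : qPoch a (q ^ 2) r ≠ 0 := qPoch_ne_zero (fun m => by
    rw [← pow_mul]; exact ha _) r
  rw [qPoch_mul_neg, qPoch_mul_neg, mul_pow, ht, div_eq_div_iff h0 h1, pow_mul, mul_comm,
    qPoch_mul_eq]
  ring_nf

theorem generalInner_zero_eq (h : GeneralChainDefined q a k a c) (g : ℕ → K) (N : ℕ) :
    generalInner q a k a c g N 0 = ∑ r ∈ Finset.range (N + 1),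
      (1 - a * q ^ (2 * r)) / (1 - a) * (qPoch ((q ^ N)⁻¹) q r * qPoch (k * q ^ N) q r
          * qPoch (a / c) q r * qPoch a q r
        / (qPoch (a * q ^ (N + 1)) q r * qPoch (a * q / (k * q ^ N)) q r
            * qPoch (c * q) q r * qPoch q q r)) * (q * c / k) ^ r * g r := by
  have ha0 := h.a_ne
  have hk0 := h.k_ne
  rw [generalInner, Nat.sub_zero]
  refine Finset.sum_congr rfl fun r _ => ?_
  rw [show q * a * c / (k * a) = q * c / k by field_simp]
  simp only [mul_zero, zero_add, add_zero, pow_zero, mul_one, pow_one]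
  rw [div_mul_div_comm]

/-- The kernel of Andrews' first chain. -/
def andrewsOneKernel (q a k c ρ₁ ρ₂ : K) (n j : ℕ) : K :=
  qPoch (k * ρ₁ / a) q n * qPoch (k * ρ₂ / a) q n
      / (qPoch (a * q / ρ₁) q n * qPoch (a * q / ρ₂) q n)
    * ((1 - c * q ^ (2 * j)) * (qPoch ρ₁ q j * qPoch ρ₂ q j) * qPoch (k / c) q (n - j)
            * qPoch k q (n + j)
          / ((1 - c) * (qPoch (k * ρ₁ / a) q j * qPoch (k * ρ₂ / a) q j) * qPoch q q (n - j)
            * qPoch (q * c) q (n + j))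
          * (a * q / (ρ₁ * ρ₂)) ^ j)

theorem andrewsOneBeta_eq (β : ℕ → K) (n : ℕ) :
    andrewsOneBeta q a k c ρ₁ ρ₂ β n
      = ∑ j ∈ Finset.range (n + 1), andrewsOneKernel q a k c ρ₁ ρ₂ n j * β j := by
  rw [andrewsOneBeta, Finset.mul_sum]
  exact Finset.sum_congr rfl fun j _ => by rw [andrewsOneKernel]; ring

theorem mul_pow_ne_one_of_add {x q : K} (i : ℕ) (h : ∀ m : ℕ, x * q ^ m ≠ 1) (m : ℕ) :
    x * q ^ i * q ^ m ≠ 1 := by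
  rw [mul_assoc, ← pow_add]
  exact h _

theorem mul_self_pow_ne_one {x q : K} (h : ∀ m : ℕ, x * q ^ (m + 1) ≠ 1) (m : ℕ) :
    x * q * q ^ m ≠ 1 := by
  rw [mul_assoc, ← pow_succ']
  exact h _

theorem andrewsOne_kernel_sum (hq0 : q ≠ 0) (hq : ∀ m : ℕ, q * q ^ m ≠ 1) (ha0 : a ≠ 0)
    (hk0 : k ≠ 0) (ha : ∀ m : ℕ, a * q ^ (m + 1) ≠ 1) (hρ₁ : ρ₁ ≠ 0) (hρ₂ : ρ₂ ≠ 0)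
    (hc : c = k * ρ₁ * ρ₂ / (a * q))
    (h1 : ∀ m : ℕ, a * q / ρ₁ * q ^ m ≠ 1) (h2 : ∀ m : ℕ, a * q / ρ₂ * q ^ m ≠ 1)
    (h3 : ∀ m : ℕ, k * ρ₁ / a * q ^ m ≠ 1) (h4 : ∀ m : ℕ, k * ρ₂ / a * q ^ m ≠ 1)
    (h5 : ∀ m : ℕ, c * q ^ m ≠ 1) (i N : ℕ) :
    ∑ r ∈ Finset.range (N + 1), andrewsOneKernel q a k c ρ₁ ρ₂ (i + N) (i + r)
        * wpKernel q a c (i + r) i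
      = andrewsOneMul q a ρ₁ ρ₂ i * wpKernel q a k (i + N) i := by
  have hc0 : c ≠ 0 := by rw [hc]; positivity
  have e1 : ρ₂ * q ^ i * (c / a) * (k / c) = k * ρ₂ / a * q ^ i := by field_simp
  have e2 : ρ₁ * q ^ i * (c / a) * (k / c) = k * ρ₁ / a * q ^ i := by field_simp
  have e3 : ρ₁ * q ^ i * (ρ₂ * q ^ i) * (k / c) = a * q * q ^ (2 * i) := by
    rw [hc, pow_mul']; field_simp
  have e4 : c / a * (k / c) = k / a := by field_simp
  have e5 : ρ₂ * q ^ i * (k / c) = a * q / ρ₁ * q ^ i := by rw [hc]; field_simp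
  have e6 : ρ₁ * q ^ i * (k / c) = a * q / ρ₂ * q ^ i := by rw [hc]; field_simp
  have e7 : c * q ^ (2 * i) * (k / c) = k * q ^ (2 * i) := by field_simp
  have e8 : k / c = a * q / (ρ₁ * ρ₂) := by rw [hc]; field_simp
  -- The sum over the kernel is well-poised in c q^(2i) rather than in a. The balancing condition is
  -- the defining relation of c.
  have J := jackson_sum (q := q) (a := c * q ^ (2 * i)) (b := ρ₁ * q ^ i) (c := ρ₂ * q ^ i)
    (d := c / a) (f := k / c) hq0 hq (mul_pow_ne_one_of_add _ h5)
    (by rw [e1]; exact mul_pow_ne_one_of_add _ h4) (by rw [e2]; exact mul_pow_ne_one_of_add _ h3)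
    (by rw [e3]; exact mul_pow_ne_one_of_add _ (mul_self_pow_ne_one ha))
    (by rw [mul_assoc (_ * _), e4, hc, pow_mul']; field_simp) N
  rw [e1, e2, e3, e4, e5, e6, e7] at J
  have hC := sub_ne_zero.2 (h5 (2 * i)).symm
  have hterm : ∀ r ∈ Finset.range (N + 1), andrewsOneKernel q a k c ρ₁ ρ₂ (i + N) (i + r)
        * wpKernel q a c (i + r) i
      = qPoch (k * ρ₁ / a) q (i + N) * qPoch (k * ρ₂ / a) q (i + N)
          / (qPoch (a * q / ρ₁) q (i + N) * qPoch (a * q / ρ₂) q (i + N))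
        * (qPoch ρ₁ q i * qPoch ρ₂ q i / (qPoch (k * ρ₁ / a) q i * qPoch (k * ρ₂ / a) q i))
        * (qPoch k q (2 * i + N) / qPoch (c * q) q (2 * i + N)) * (a * q / (ρ₁ * ρ₂)) ^ i
        * (qPoch c q (2 * i) / qPoch (a * q) q (2 * i)) * ((1 - c * q ^ (2 * i)) / (1 - c))
        * ((1 - c * q ^ (2 * i) * q ^ (2 * r)) / (1 - c * q ^ (2 * i))
          * (qPoch (c * q ^ (2 * i)) q r * qPoch (ρ₁ * q ^ i) q r * qPoch (ρ₂ * q ^ i) q r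
              * qPoch (c / a) q r
            / (qPoch q q r * qPoch (k * ρ₂ / a * q ^ i) q r * qPoch (k * ρ₁ / a * q ^ i) q r
              * qPoch (a * q * q ^ (2 * i)) q r))
          * (k / c) ^ r * (qPoch (k / c) q (N - r) / qPoch q q (N - r))
          * (qPoch (k * q ^ (2 * i) * q ^ N) q r
            / qPoch (c * q ^ (2 * i) * q ^ (N + 1)) q r)) := by
    intro r hr
    have hr := Finset.mem_range.1 hr
    have t1 : (1 - c * q ^ (2 * (i + r))) / (1 - c) = (1 - c * q ^ (2 * i)) / (1 - c)
        * ((1 - c * q ^ (2 * i) * q ^ (2 * r)) / (1 - c * q ^ (2 * i))) := by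
      rw [div_mul_div_comm, mul_comm (1 - c), mul_div_mul_left _ _ hC]
      ring_nf
    rw [andrewsOneKernel, wpKernel, show i + N - (i + r) = N - r by omega,
      show i + N + (i + r) = 2 * i + N + r by ring, show i + r - i = r by omega,
      show i + r + i = 2 * i + r by ring, mul_comm q c, qPoch_add k q (2 * i + N) r,
      qPoch_add (c * q) q (2 * i + N) r, qPoch_add c q (2 * i) r, qPoch_add (a * q) q (2 * i) r,
      qPoch_add ρ₁ q i r, qPoch_add ρ₂ q i r, qPoch_add (k * ρ₁ / a) q i r,
      qPoch_add (k * ρ₂ / a) q i r, e8, pow_add _ i r, pow_add q (2 * i) N, ← mul_assoc k,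
      show c * q * (q ^ (2 * i) * q ^ N) = c * q ^ (2 * i) * q ^ (N + 1) by ring]
    clear J e1 e2 e3 e4 e5 e6 e7 e8
    generalize k * ρ₁ / a = p₁
    generalize k * ρ₂ / a = p₂
    generalize a * q / ρ₁ = p₃
    generalize a * q / ρ₂ = p₄
    generalize a * q / (ρ₁ * ρ₂) = z
    generalize c / a = u
    generalize 1 - c * q ^ (2 * i) = D at t1 ⊢
    generalize 1 - c = D' at t1 ⊢
    simp only [div_eq_mul_inv, mul_inv] at t1 ⊢
    linear_combination qPoch (p₁) q (i + N) * qPoch (p₂) q (i + N)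
          / (qPoch (p₃) q (i + N) * qPoch (p₄) q (i + N))
        * (qPoch ρ₁ q i * qPoch ρ₂ q i / (qPoch (p₁) q i * qPoch (p₂) q i))
        * (qPoch k q (2 * i + N) / qPoch (c * q) q (2 * i + N)) * z ^ i
        * (qPoch c q (2 * i) / qPoch (a * q) q (2 * i))
        * ((qPoch (c * q ^ (2 * i)) q r * qPoch (ρ₁ * q ^ i) q r * qPoch (ρ₂ * q ^ i) q r
              * qPoch (u) q r
            / (qPoch q q r * qPoch (p₂ * q ^ i) q r * qPoch (p₁ * q ^ i) q r
              * qPoch (a * q * q ^ (2 * i)) q r))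
          * z ^ r
          * (qPoch z q (N - r) / qPoch q q (N - r))
          * (qPoch (k * q ^ (2 * i) * q ^ N) q r
            / qPoch (c * q ^ (2 * i) * q ^ (N + 1)) q r)) * t1
  rw [Finset.sum_congr rfl hterm, ← Finset.mul_sum, J, wpKernel_add, andrewsOneMul,
    qPoch_add k q (2 * i) N, qPoch_add (c * q) q (2 * i) N, qPoch_add (a * q / ρ₁) q i N,
    qPoch_add (a * q / ρ₂) q i N, qPoch_add (k * ρ₁ / a) q i N, qPoch_add (k * ρ₂ / a) q i N]
  have n1 := qPoch_ne_zero h3 i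
  have n2 := qPoch_ne_zero h4 i
  have n3 := qPoch_ne_zero (mul_pow_ne_one_of_add i h3) N
  have n4 := qPoch_ne_zero (mul_pow_ne_one_of_add i h4) N
  have n5 := qPoch_ne_zero (mul_pow_ne_one_of_add i h1) N
  have n6 := qPoch_ne_zero (mul_pow_ne_one_of_add i h2) N
  have hc' : ∀ m : ℕ, c * q * q ^ m ≠ 1 := mul_self_pow_ne_one fun m => h5 _
  have n7 := qPoch_ne_zero hc' (2 * i)
  have n8 := qPoch_ne_zero (mul_pow_ne_one_of_add (2 * i) hc') N
  have n9 := sub_ne_zero.2 (h5 0).symm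
  rw [pow_zero, mul_one] at n9
  have t2 := qPoch_mul_eq c q (2 * i)
  rw [show c * q ^ (2 * i) * q = c * q * q ^ (2 * i) by ring,
    show a * q ^ (2 * i) * q = a * q * q ^ (2 * i) by ring]
  have t3 : qPoch c q (2 * i) / qPoch (a * q) q (2 * i) * ((1 - c * q ^ (2 * i)) / (1 - c))
      = qPoch (c * q) q (2 * i) / qPoch (a * q) q (2 * i) := by
    rw [div_mul_div_comm, t2, mul_comm (1 - c), mul_div_mul_right _ _ n9]
  rw [mul_assoc _ (_ / _) ((1 - c * q ^ (2 * i)) / (1 - c)), t3]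
  clear J hterm t2 t3 e1 e2 e3 e4 e5 e6 e7 e8
  generalize qPoch (k * ρ₁ / a) q i = x1 at *
  generalize qPoch (k * ρ₂ / a) q i = x2 at *
  generalize qPoch (k * ρ₁ / a * q ^ i) q N = x3 at *
  generalize qPoch (k * ρ₂ / a * q ^ i) q N = x4 at *
  generalize qPoch (a * q / ρ₁ * q ^ i) q N = x5 at *
  generalize qPoch (a * q / ρ₂ * q ^ i) q N = x6 at *
  generalize qPoch (c * q) q (2 * i) = x7 at *
  generalize qPoch (c * q * q ^ (2 * i)) q N = x8 at *
  generalize qPoch (a * q / ρ₁) q i = x9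
  generalize qPoch (a * q / ρ₂) q i = x10
  generalize qPoch (a * q) q (2 * i) = x11
  generalize qPoch (a * q * q ^ (2 * i)) q N = x12
  generalize qPoch q q N = x13
  generalize (a * q / (ρ₁ * ρ₂)) ^ i = x14
  refine eq_of_eq_mul_of_eq_one (u := x1 / x1 * (x2 / x2) * (x3 / x3) * (x4 / x4) * (x5 / x5)
    * (x6 / x6) * (x7 / x7) * (x8 / x8)) ?_ ?_
  · simp only [div_self n1, div_self n2, div_self n3, div_self n4, div_self n5, div_self n6,
      div_self n7, div_self n8, mul_one]
  · simp only [div_eq_mul_inv, mul_inv]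
    ring

/-- Andrews' first chain: evaluation of the inner sum. -/
theorem andrewsOne_inner (hq0 : q ≠ 0) (hq : ∀ m : ℕ, q * q ^ m ≠ 1)
    (h : GeneralChainDefined q a k a c) (hρ₁ : ρ₁ ≠ 0) (hρ₂ : ρ₂ ≠ 0)
    (hc : c = k * ρ₁ * ρ₂ / (a * q))
    (h1 : ∀ m : ℕ, a * q / ρ₁ * q ^ m ≠ 1) (h2 : ∀ m : ℕ, a * q / ρ₂ * q ^ m ≠ 1) (N : ℕ) :
    generalInner q a k a c (andrewsOneMul q a ρ₁ ρ₂) N 0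
      = jacksonProduct q a ρ₁ ρ₂ (a / c) N := by
  have ha0 := h.a_ne
  have hk0 := h.k_ne
  have hc0 := h.c_ne
  have n1 := qPoch_ne_zero hq N
  have n2 := qPoch_ne_zero h.k_div N
  have e1 : ρ₂ * (a / c) * (k / a) = a * q / ρ₁ := by rw [hc]; field_simp
  have e2 : ρ₁ * (a / c) * (k / a) = a * q / ρ₂ := by rw [hc]; field_simp
  have e3 : ρ₁ * ρ₂ * (k / a) = c * q := by rw [hc]; field_simp
  have e4 : a / c * (k / a) = a * q / (ρ₁ * ρ₂) := by rw [hc]; field_simp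
  have e5 : a * (k / a) = k := by field_simp
  have f1 : a * q / (ρ₁ * (a / c)) = ρ₂ * (k / a) := by rw [hc]; field_simp
  have f2 : a * q / (ρ₂ * (a / c)) = ρ₁ * (k / a) := by rw [hc]; field_simp
  have f3 : a * q / (a / c) = c * q := by field_simp
  have f4 : a * q / (ρ₁ * ρ₂ * (a / c)) = k / a := by rw [hc]; field_simp
  -- Multiplying the unit sequence by g adds ρ₁ and ρ₂ to its parameters a and a/c; the result is
  -- Jackson's summand with f = k/a.
  have J := jackson_sum (q := q) (a := a) (b := ρ₁) (c := ρ₂)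
    (d := a / c) (f := k / a) hq0 hq h.a_pow'
    (by rwa [e1]) (by rwa [e2])
    (by rw [e3]; exact mul_self_pow_ne_one fun m => h.c_pow _)
    (by rw [hc]; field_simp) N
  rw [e1, e2, e3, e4, e5] at J
  have G := generalInner_zero hq0 hq h (andrewsOneMul q a ρ₁ ρ₂) N
  have hsum : qPoch (k / a) q N / qPoch q q N
      * generalInner q a k a c (andrewsOneMul q a ρ₁ ρ₂) N 0
      = qPoch (k / a) q N / qPoch q q N * jacksonProduct q a ρ₁ ρ₂ (a / c) N := by
    rw [G]
    refine Eq.trans (Finset.sum_congr rfl fun r _ => ?_) (J.trans ?_)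
    · rw [unitAlpha, andrewsOneMul, show k / a = c / a * (a * q / (ρ₁ * ρ₂)) by
        rw [hc]; field_simp, mul_pow]
      simp only [div_eq_mul_inv, mul_inv]
      ring
    · rw [jacksonProduct, f1, f2, f3, f4]
      generalize qPoch (k / a) q N = x1 at *
      generalize qPoch q q N = x2 at *
      generalize qPoch (a * q / ρ₁) q N = x3
      generalize qPoch (a * q / ρ₂) q N = x4
      generalize qPoch (c * q) q N = x5
      field_simp
  exact mul_left_cancel₀ (div_ne_zero n2 n1) hsum

theorem andrewsOneMul_shift (hq0 : q ≠ 0) (hρ₁ : ρ₁ ≠ 0) (hρ₂ : ρ₂ ≠ 0) (j r : ℕ) :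
    andrewsOneMul q a ρ₁ ρ₂ (r + j) = andrewsOneMul q a ρ₁ ρ₂ j
      * andrewsOneMul q (a * q ^ (2 * j)) (ρ₁ * q ^ j) (ρ₂ * q ^ j) r := by
  have hj : q ^ j ≠ 0 := pow_ne_zero _ hq0
  have e1 : a * q ^ (2 * j) * q / (ρ₁ * q ^ j) = a * q / ρ₁ * q ^ j := by
    rw [pow_mul']; field_simp
  have e2 : a * q ^ (2 * j) * q / (ρ₂ * q ^ j) = a * q / ρ₂ * q ^ j := by
    rw [pow_mul']; field_simp
  have e3 : a * q ^ (2 * j) * q / (ρ₁ * q ^ j * (ρ₂ * q ^ j)) = a * q / (ρ₁ * ρ₂) := by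
    rw [pow_mul']; field_simp
  rw [andrewsOneMul, andrewsOneMul, andrewsOneMul, e1, e2, e3, add_comm r j]
  simp only [qPoch_add, pow_add, div_eq_mul_inv, mul_inv]
  ring

/-- Andrews' first chain: the kernel of the general chain. -/
theorem andrewsOne_generalBeta (hq0 : q ≠ 0) (hq : ∀ m : ℕ, q * q ^ m ≠ 1)
    (h : GeneralChainDefined q a k a c) (hρ₁ : ρ₁ ≠ 0) (hρ₂ : ρ₂ ≠ 0)
    (hc : c = k * ρ₁ * ρ₂ / (a * q))
    (h1 : ∀ m : ℕ, a * q / ρ₁ * q ^ m ≠ 1) (h2 : ∀ m : ℕ, a * q / ρ₂ * q ^ m ≠ 1)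
    (h3 : ∀ m : ℕ, k * ρ₁ / a * q ^ m ≠ 1) (h4 : ∀ m : ℕ, k * ρ₂ / a * q ^ m ≠ 1)
    (β : ℕ → K) (n : ℕ) :
    generalBeta q a k a c (andrewsOneMul q a ρ₁ ρ₂) β n
      = andrewsOneBeta q a k c ρ₁ ρ₂ β n := by
  rw [andrewsOneBeta_eq]
  refine generalBeta_eq hq0 h _ (andrewsOneMul_shift hq0 hρ₁ hρ₂) (fun j N => ?_) β n
  have ha0 := h.a_ne
  have hk0 := h.k_ne
  have hc0 := h.c_ne
  have hj : q ^ j ≠ 0 := pow_ne_zero _ hq0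
  have e1 : a * q ^ (2 * j) * q / (ρ₁ * q ^ j) = a * q / ρ₁ * q ^ j := by
    rw [pow_mul']; field_simp
  have e2 : a * q ^ (2 * j) * q / (ρ₂ * q ^ j) = a * q / ρ₂ * q ^ j := by
    rw [pow_mul']; field_simp
  have e3 : a * q ^ (2 * j) * q / (ρ₁ * q ^ j * (ρ₂ * q ^ j)) = a * q / (ρ₁ * ρ₂) := by
    rw [pow_mul']; field_simp
  have e4 : a * q ^ (2 * j) / (c * q ^ (2 * j)) = a / c := by field_simp
  have f1 : a * q ^ (2 * j) * q / (ρ₁ * q ^ j * (a / c)) = k * ρ₂ / a * q ^ j := by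
    rw [hc, pow_mul']; field_simp
  have f2 : a * q ^ (2 * j) * q / (ρ₂ * q ^ j * (a / c)) = k * ρ₁ / a * q ^ j := by
    rw [hc, pow_mul']; field_simp
  have f3 : a * q ^ (2 * j) * q / (a / c) = c * q * q ^ (2 * j) := by field_simp
  have f4 : a * q ^ (2 * j) * q / (ρ₁ * q ^ j * (ρ₂ * q ^ j) * (a / c)) = k / a := by
    rw [hc, pow_mul']; field_simp
  have e5 : k / c = a * q / (ρ₁ * ρ₂) := by rw [hc]; field_simp
  -- The shift sends ρ₁, ρ₂ to ρ₁ q^j, ρ₂ q^j and preserves the relation defining c, so the case j =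
  -- 0 applies and its product side can be compared with the kernel.
  rw [andrewsOne_inner hq0 hq (h.shift hq0 j) (mul_ne_zero hρ₁ hj) (mul_ne_zero hρ₂ hj)
    (by rw [hc, pow_mul']; field_simp)
    (by rw [e1]; exact mul_pow_ne_one_of_add _ h1) (by rw [e2]; exact mul_pow_ne_one_of_add _ h2),
    e4, jacksonProduct, f1, f2, f3, f4, e1, e2, e3, andrewsOneMul, andrewsOneKernel,
    show j + N - j = N by omega, show j + N + j = 2 * j + N by ring, mul_comm q c,
    qPoch_add k, qPoch_add (c * q), qPoch_add (k * ρ₁ / a), qPoch_add (k * ρ₂ / a),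
    qPoch_add (a * q / ρ₁), qPoch_add (a * q / ρ₂), e5]
  have t2 := qPoch_mul_eq c q (2 * j)
  have n1 := qPoch_ne_zero h3 j
  have n2 := qPoch_ne_zero h4 j
  have n3 := qPoch_ne_zero h.k_div N
  have n4 : qPoch (a * q ^ (2 * j) * q) q N ≠ 0 := qPoch_ne_zero (fun m => by
    rw [mul_assoc a, ← pow_succ, mul_assoc, ← pow_add]; exact h.a_pow' _) N
  have n5 := qPoch_ne_zero h.c_pow (2 * j)
  have n6 := qPoch_ne_zero (x := c * q) (mul_self_pow_ne_one fun m => h.c_pow _) (2 * j)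
  have n7 := sub_ne_zero.2 (h.c_pow 0).symm
  rw [pow_zero, mul_one] at n7
  have t3 : (1 - c * q ^ (2 * j)) / ((1 - c) * qPoch (c * q) q (2 * j))
      = 1 / qPoch c q (2 * j) := by
    rw [div_eq_div_iff (mul_ne_zero n7 n6) n5]
    linear_combination t2
  clear e1 e2 e3 e4 e5 f1 f2 f3 f4
  generalize qPoch (k * ρ₁ / a) q j = x1 at *
  generalize qPoch (k * ρ₂ / a) q j = x2 at *
  generalize qPoch (k / a) q N = x3 at *
  generalize qPoch (a * q ^ (2 * j) * q) q N = x4 at *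
  generalize qPoch c q (2 * j) = x5 at *
  generalize qPoch (c * q) q (2 * j) = x6 at *
  generalize qPoch (c * q * q ^ (2 * j)) q N = x7
  generalize qPoch q q N = x8
  generalize qPoch (k * ρ₁ / a * q ^ j) q N = y1
  generalize qPoch (k * ρ₂ / a * q ^ j) q N = y2
  generalize qPoch (a * q / ρ₁ * q ^ j) q N = y3
  generalize qPoch (a * q / ρ₂ * q ^ j) q N = y4
  generalize qPoch (a * q / ρ₁) q j = y5
  generalize qPoch (a * q / ρ₂) q j = y6
  generalize qPoch (a * q / (ρ₁ * ρ₂)) q N = y7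
  generalize (a * q / (ρ₁ * ρ₂)) ^ j = y8
  generalize 1 - c * q ^ (2 * j) = D at *
  generalize 1 - c = D' at *
  refine Eq.trans (b := 1 / x5 * (qPoch k q (2 * j)
      * (qPoch ρ₁ q j * qPoch ρ₂ q j / (y5 * y6) * y8)
      * (qPoch (k * q ^ (2 * j)) q N / x8) * (y7 * y2 * y1 / (y3 * y4 * x7)))) ?_ ?_
  · refine eq_of_eq_mul_of_eq_one (u := x3 / x3 * (x4 / x4)) ?_ ?_
    · simp only [div_self n3, div_self n4, mul_one]
    · simp only [div_eq_mul_inv, mul_inv]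
      ring
  · rw [← t3]
    symm
    refine eq_of_eq_mul_of_eq_one (u := x1 / x1 * (x2 / x2)) ?_ ?_
    · simp only [div_self n1, div_self n2, mul_one]
    · simp only [div_eq_mul_inv, mul_inv]
      ring

/-- Andrews' first chain: the inner sum is the series in Jackson's sum. -/
theorem andrewsOne_series (h : GeneralChainDefined q a k a c) (hρ₁ : ρ₁ ≠ 0) (hρ₂ : ρ₂ ≠ 0)
    (hq0 : q ≠ 0) (hc : c = k * ρ₁ * ρ₂ / (a * q)) {t : K} (ht : t ^ 2 = a) (N : ℕ) :
    generalInner q a k a c (andrewsOneMul q a ρ₁ ρ₂) N 0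
      = jacksonSeries q a t ρ₁ ρ₂ (a / c) (k * q ^ N) N := by
  have ha0 := h.a_ne
  have hk0 := h.k_ne
  have hc0 := h.c_ne
  rw [generalInner_zero_eq h, jacksonSeries, phi]
  refine Finset.sum_congr rfl fun r _ => ?_
  simp only [List.map_cons, List.map_nil, List.prod_cons, List.prod_nil, mul_one]
  -- The argument q of the series is the inner-sum factor q c / k times the geometric ratio
  -- contained in g.
  have e1 : q ^ r = (q * c / k) ^ r * (a * q / (ρ₁ * ρ₂)) ^ r := by
    rw [← mul_pow, hc]
    congr 1
    field_simp
  rw [very_well_poised_factor h.a_pow' ht, andrewsOneMul, e1,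
    show a * q / (a / c) = c * q by field_simp]
  generalize a * q / ρ₁ = p₁
  generalize a * q / ρ₂ = p₂
  generalize a * q / (ρ₁ * ρ₂) = p₃
  generalize a * q / (k * q ^ N) = p₄
  generalize a / c = p₅
  generalize (q ^ N)⁻¹ = p₆
  generalize (q * c / k) ^ r = p₇
  simp only [div_eq_mul_inv, mul_inv]
  ring

end AndrewsOne

/-! ### Inner sums read off from kernel identities. -/

section ResponseToUnitPair
variable {K : Type*} [Field K] {q a k c : K}

/-- The general inner sum is read off from a kernel intertwining the matrices of `(a, c)` and
`(a, k)`. -/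
theorem generalInner_of_kernel {g : ℕ → K} {M : ℕ → ℕ → K} (hq0 : q ≠ 0)
    (hq : ∀ m : ℕ, q * q ^ m ≠ 1) (h : GeneralChainDefined q a k a c)
    (hM : ∀ i N, ∑ r ∈ Finset.range (N + 1), M (i + N) (i + r) * wpKernel q a c (i + r) i
      = g i * wpKernel q a k (i + N) i) (N : ℕ) :
    qPoch (k / a) q N * qPoch k q N / (qPoch q q N * qPoch (a * q) q N)
      * generalInner q a k a c g N 0 = M N 0 := by
  -- Row N of M L_c = L_k G, applied to the unit sequence.
  have h1 := sum_unitAlpha (M := M N) (T := wpKernel q a k N) (g := g) hq0 hq h.a_ne h.c_ne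
    h.a_pow' h.c_pow N (fun i hi => by
      obtain ⟨n, rfl⟩ : ∃ n, N = i + n := ⟨N - i, by omega⟩
      rw [show i + n - i = n by omega, hM]
      ring)
  rw [← h1, show qPoch (k / a) q N * qPoch k q N / (qPoch q q N * qPoch (a * q) q N)
    = qPoch k q N / qPoch (a * q) q N * (qPoch (k / a) q N / qPoch q q N) by ring, mul_assoc,
    generalInner_zero hq0 hq h, Finset.mul_sum]
  refine Finset.sum_congr rfl fun r _ => ?_
  rw [wpKernel, qPoch_add k, qPoch_add (a * q), show a * q * q ^ N = a * q ^ (N + 1) by ring]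
  simp only [div_eq_mul_inv, mul_inv]
  ring

end ResponseToUnitPair

/-! ### Andrews' second chain and the Gasper-Rahman sum. -/

section AndrewsTwo
variable {K : Type*} [Field K] {q a k c : K}

/-- The kernel of Andrews' second chain. -/
def andrewsTwoKernel (q a k : K) (n j : ℕ) : K :=
  qPoch (k ^ 2 / (q * a ^ 2)) q (n - j) / qPoch q q (n - j) * (k ^ 2 / (q * a ^ 2)) ^ j

theorem andrewsTwoMul_eq (hc : c = q * a ^ 2 / k) (n : ℕ) :
    andrewsTwoMul q a k n = qPoch c q (2 * n) / qPoch k q (2 * n) * (k ^ 2 / (q * a ^ 2)) ^ n := by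
  rw [andrewsTwoMul, hc]

/-- Each entry is a q-Saalschütz sum with x = k²/(q a²), upper parameters c/a and c q^(2i), and
lower parameter a q^(2i+1). The choice c = q a²/k is what balances it. -/
theorem andrewsTwo_kernel_sum (hq0 : q ≠ 0) (hq : ∀ m : ℕ, q * q ^ m ≠ 1) (ha0 : a ≠ 0)
    (hk0 : k ≠ 0) (ha : ∀ m : ℕ, a * q ^ (m + 1) ≠ 1) (hc : c = q * a ^ 2 / k)
    (hk : ∀ m : ℕ, k * q ^ m ≠ 1) (i N : ℕ) :
    ∑ r ∈ Finset.range (N + 1), andrewsTwoKernel q a k (i + N) (i + r)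
        * wpKernel q a c (i + r) i
      = andrewsTwoMul q a k i * wpKernel q a k (i + N) i := by
  have e1 : k ^ 2 / (q * a ^ 2) * (c * q ^ (2 * i)) = k * q ^ (2 * i) := by
    rw [hc]; field_simp
  have e2 : k ^ 2 / (q * a ^ 2) * (c / a) = k / a := by rw [hc]; field_simp
  have ha' : ∀ m : ℕ, a * q ^ (2 * i) * q * q ^ m ≠ 1 := fun m => by
    have := ha (2 * i + m)
    rwa [show a * q ^ (2 * i) * q * q ^ m = a * q ^ (2 * i + m + 1) by ring]
  have S := saalschutz_sum (x := k ^ 2 / (q * a ^ 2)) (u := c / a) (c := c * q ^ (2 * i)) hq ha'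
    (by rw [hc]; field_simp) N
  rw [e1, e2] at S
  have hterm : ∀ r ∈ Finset.range (N + 1), andrewsTwoKernel q a k (i + N) (i + r)
        * wpKernel q a c (i + r) i
      = (k ^ 2 / (q * a ^ 2)) ^ i * (qPoch c q (2 * i) / qPoch (a * q) q (2 * i))
        * (saalschutzWeight q (k ^ 2 / (q * a ^ 2)) (c / a) (c * q ^ (2 * i))
            (a * q ^ (2 * i) * q) r
          * (qPoch (k ^ 2 / (q * a ^ 2)) q (N - r) / qPoch q q (N - r))) := by
    intro r hr
    have hr := Finset.mem_range.1 hr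
    rw [andrewsTwoKernel, wpKernel_add, saalschutzWeight, show i + N - (i + r) = N - r by omega,
      pow_add]
    generalize k ^ 2 / (q * a ^ 2) = x
    generalize c / a = u
    simp only [div_eq_mul_inv, mul_inv]
    ring
  have n1 := qPoch_ne_zero hk (2 * i)
  rw [Finset.sum_congr rfl hterm, ← Finset.mul_sum, S, wpKernel_add, andrewsTwoMul_eq hc]
  generalize k ^ 2 / (q * a ^ 2) = x
  generalize qPoch k q (2 * i) = y at *
  symm
  refine eq_of_eq_mul_of_eq_one (div_self n1) ?_
  generalize k / a = u
  simp only [div_eq_mul_inv, mul_inv]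
  ring

theorem andrewsTwo_inner (hq0 : q ≠ 0) (hq : ∀ m : ℕ, q * q ^ m ≠ 1)
    (h : GeneralChainDefined q a k a c) (hc : c = q * a ^ 2 / k)
    (hk : ∀ m : ℕ, k * q ^ m ≠ 1) (N : ℕ) :
    qPoch (k / a) q N * qPoch k q N / (qPoch q q N * qPoch (a * q) q N)
      * generalInner q a k a c (andrewsTwoMul q a k) N 0 = andrewsTwoKernel q a k N 0 :=
  generalInner_of_kernel hq0 hq h
    (andrewsTwo_kernel_sum hq0 hq h.a_ne h.k_ne h.a_pow hc hk) N

/-- Andrews' second chain: evaluation of the inner sum. -/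
theorem andrewsTwo_inner_eq (hq0 : q ≠ 0) (hq : ∀ m : ℕ, q * q ^ m ≠ 1)
    (h : GeneralChainDefined q a k a c) (hc : c = q * a ^ 2 / k)
    (hk : ∀ m : ℕ, k * q ^ m ≠ 1) (N : ℕ) :
    generalInner q a k a c (andrewsTwoMul q a k) N 0 = gasperRahmanProduct q a k N := by
  have h1 := andrewsTwo_inner hq0 hq h hc hk N
  have n1 := qPoch_ne_zero hk N
  have n2 := qPoch_ne_zero h.k_div N
  have n3 := qPoch_ne_zero hq N
  have n4 := qPoch_ne_zero (mul_self_pow_ne_one h.a_pow) N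
  rw [andrewsTwoKernel, Nat.sub_zero, pow_zero, mul_one] at h1
  rw [gasperRahmanProduct]
  generalize generalInner q a k a c (andrewsTwoMul q a k) N 0 = I at *
  generalize qPoch k q N = x1 at *
  generalize qPoch (k / a) q N = x2 at *
  generalize qPoch q q N = x3 at *
  generalize qPoch (a * q) q N = x4 at *
  generalize qPoch (k ^ 2 / (q * a ^ 2)) q N = x5 at *
  field_simp at h1 ⊢
  linear_combination h1

theorem andrewsTwoMul_shift (hq0 : q ≠ 0) (j r : ℕ) :
    andrewsTwoMul q a k (r + j) = andrewsTwoMul q a k j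
      * andrewsTwoMul q (a * q ^ (2 * j)) (k * q ^ (2 * j)) r := by
  have hj : q ^ j ≠ 0 := pow_ne_zero _ hq0
  have e1 : q * (a * q ^ (2 * j)) ^ 2 / (k * q ^ (2 * j)) = q * a ^ 2 / k * q ^ (2 * j) := by
    rw [pow_mul']; field_simp
  have e2 : (k * q ^ (2 * j)) ^ 2 / (q * (a * q ^ (2 * j)) ^ 2) = k ^ 2 / (q * a ^ 2) := by
    rw [pow_mul']; field_simp
  rw [andrewsTwoMul, andrewsTwoMul, andrewsTwoMul, e1, e2, show 2 * (r + j) = 2 * j + 2 * r by ring,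
    pow_add _ r j]
  simp only [qPoch_add, div_eq_mul_inv, mul_inv]
  ring

/-- Andrews' second chain: the kernel of the general chain. -/
theorem andrewsTwo_generalBeta (hq0 : q ≠ 0) (hq : ∀ m : ℕ, q * q ^ m ≠ 1)
    (h : GeneralChainDefined q a k a c) (hc : c = q * a ^ 2 / k)
    (hk : ∀ m : ℕ, k * q ^ m ≠ 1) (β : ℕ → K) (n : ℕ) :
    generalBeta q a k a c (andrewsTwoMul q a k) β n = andrewsTwoBeta q a k β n := by
  refine generalBeta_eq (M := andrewsTwoKernel q a k) hq0 h _ (andrewsTwoMul_shift hq0)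
    (fun j N => ?_) β n
  have ha0 := h.a_ne
  have hk0 := h.k_ne
  have hj : q ^ j ≠ 0 := pow_ne_zero _ hq0
  have h1 := andrewsTwo_inner hq0 hq (h.shift hq0 j)
    (by rw [hc, pow_mul']; field_simp) (mul_pow_ne_one_of_add _ hk) N
  rw [mul_div_mul_right _ _ (pow_ne_zero _ hq0)] at h1
  rw [h1, andrewsTwoMul_eq hc, andrewsTwoKernel, andrewsTwoKernel,
    show (k * q ^ (2 * j)) ^ 2 / (q * (a * q ^ (2 * j)) ^ 2) = k ^ 2 / (q * a ^ 2) by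
      rw [pow_mul']; field_simp,
    show j + N - j = N by omega, Nat.sub_zero, pow_zero, mul_one]
  have n1 := qPoch_ne_zero hk (2 * j)
  have n2 := qPoch_ne_zero h.c_pow (2 * j)
  refine eq_of_eq_mul_of_eq_one (u := qPoch k q (2 * j) / qPoch k q (2 * j)
    * (qPoch c q (2 * j) / qPoch c q (2 * j))) (by rw [div_self n1, div_self n2, mul_one]) ?_
  generalize k ^ 2 / (q * a ^ 2) = x
  simp only [div_eq_mul_inv]
  ring

/-- Andrews' second chain: the inner sum is the `10φ9` of Gasper and Rahman. -/
theorem andrewsTwo_series (hq0 : q ≠ 0) (h : GeneralChainDefined q a k a c)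
    (hc : c = q * a ^ 2 / k) {w t s : K} (hw : w ^ 2 = q) (ht : t ^ 2 = a) (hs : s ^ 2 = k)
    (N : ℕ) :
    generalInner q a k a c (andrewsTwoMul q a k) N 0 = gasperRahmanSeries q a k w t s N := by
  have ha0 := h.a_ne
  have hk0 := h.k_ne
  have hc0 := h.c_ne
  rw [generalInner_zero_eq h, gasperRahmanSeries, phi]
  refine Finset.sum_congr rfl fun r _ => ?_
  simp only [List.map_cons, List.map_nil, List.prod_cons, List.prod_nil, mul_one]
  have e1 : q ^ r = (q * c / k) ^ r * (k ^ 2 / (q * a ^ 2)) ^ r := by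
    rw [← mul_pow, hc]
    congr 1
    field_simp
  have p1 := qPoch_mul_neg (a * w / s) q r
  have p2 := qPoch_mul_neg (a * q / s) q r
  have p3 := qPoch_mul_neg (s * w) q r
  have p4 := qPoch_mul_neg s q r
  rw [show (a * w / s) ^ 2 = c by rw [div_pow, mul_pow, hw, hs, hc]; ring] at p1
  rw [show (a * q / s) ^ 2 = c * q by rw [div_pow, mul_pow, hs, hc]; ring] at p2
  rw [show (s * w) ^ 2 = k * q by rw [mul_pow, hw, hs]] at p3
  rw [hs] at p4
  rw [very_well_poised_factor h.a_pow' ht, andrewsTwoMul_eq hc, qPoch_two_mul, qPoch_two_mul,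
    ← p1, ← p2, ← p3, ← p4, e1, show a / c = k / (a * q) by rw [hc]; field_simp,
    show c * q = a ^ 2 * q ^ 2 / k by rw [hc]; field_simp]
  clear p1 p2 p3 p4
  generalize k ^ 2 / (q * a ^ 2) = x
  generalize -(a * w / s) = p₁
  generalize a * w / s = p₂
  generalize -(a * q / s) = p₃
  generalize a * q / s = p₄
  generalize a * q / (k * q ^ N) = p₅
  generalize a ^ 2 * q ^ 2 / k = p₆
  generalize (q ^ N)⁻¹ = p₇
  generalize (q * c / k) ^ r = p₈
  generalize k / (a * q) = p₉
  simp only [div_eq_mul_inv, mul_inv]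
  ring

end AndrewsTwo

/-! ### Warnaar's first chain and the Andrews-Berkovich sum. -/

section Warnaar
variable {K : Type*} [Field K] {q a k c s : K}

/-- The kernel of Warnaar's first chain. -/
def warnaarKernel (q a k s : K) (n j : ℕ) : K :=
  (1 - s) / (1 - q ^ n * s)
    * ((1 + q ^ j * a / s) / (1 + a / s)
      * (qPoch (k ^ 2 / a ^ 2) q (n - j) / qPoch q q (n - j)) * (k ^ 2 / a ^ 2) ^ j)

theorem warnaarBeta_eq (ha0 : a ≠ 0) (hk0 : k ≠ 0) (hc : c = a ^ 2 / k) (β : ℕ → K) (n : ℕ) :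
    warnaarBeta q a k s c β n = ∑ j ∈ Finset.range (n + 1), warnaarKernel q a k s n j * β j := by
  rw [warnaarBeta, Finset.mul_sum, show k / c = k ^ 2 / a ^ 2 by rw [hc]; field_simp]
  exact Finset.sum_congr rfl fun j _ => by rw [warnaarKernel]; ring

theorem one_sub_pow_mul_ne_zero (hs : s ^ 2 = k) (hk : ∀ m : ℕ, k * q ^ m ≠ 1) (n : ℕ) :
    1 - q ^ n * s ≠ 0 := by
  intro h
  apply hk (2 * n)
  have h1 : q ^ n * s = 1 := (sub_eq_zero.1 h).symm
  calc k * q ^ (2 * n) = (q ^ n * s) ^ 2 := by rw [← hs]; ring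
    _ = 1 := by rw [h1, one_pow]

theorem warnaarMul_eq (hc : c = a ^ 2 / k) (n : ℕ) :
    warnaarMul q a k s n = (1 - s) / (1 - q ^ n * s) * ((1 + q ^ n * a / s) / (1 + a / s))
      * (qPoch c q (2 * n) / qPoch k q (2 * n)) * (k ^ 2 / a ^ 2) ^ n := by
  rw [warnaarMul, hc]

/-- `warnaar_sum` applies with s replaced by s q^i and v = q^i a / s: then v s becomes a q^(2i), v²
becomes c q^(2i), and the factor 1 + v q^r is the numerator factor of the kernel at column i + r. -/
theorem warnaar_kernel_sum (hq0 : q ≠ 0) (hq : ∀ m : ℕ, q * q ^ m ≠ 1) (ha0 : a ≠ 0)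
    (hk0 : k ≠ 0) (ha : ∀ m : ℕ, a * q ^ (m + 1) ≠ 1) (hs : s ^ 2 = k) (hc : c = a ^ 2 / k)
    (hk : ∀ m : ℕ, k * q ^ m ≠ 1) (i N : ℕ) :
    ∑ r ∈ Finset.range (N + 1), warnaarKernel q a k s (i + N) (i + r)
        * wpKernel q a c (i + r) i
      = warnaarMul q a k s i * wpKernel q a k (i + N) i := by
  have hs0 : s ≠ 0 := by rintro rfl; exact hk0 (by rw [← hs]; ring)
  have hi : q ^ i ≠ 0 := pow_ne_zero _ hq0
  have e0 : q ^ i * a / s * (s * q ^ i) = a * q ^ (2 * i) := by rw [pow_mul']; field_simp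
  have e1 : (s * q ^ i) ^ 2 / (q ^ i * a / s) ^ 2 = k ^ 2 / a ^ 2 := by
    rw [← hs]; field_simp
  have e2 : q ^ i * a / s / (s * q ^ i) = c / a := by rw [hc, ← hs]; field_simp
  have e3 : (q ^ i * a / s) ^ 2 = c * q ^ (2 * i) := by rw [hc, ← hs]; field_simp; ring
  have e4 : s * q ^ i / (q ^ i * a / s) = k / a := by rw [← hs]; field_simp
  have e5 : (s * q ^ i) ^ 2 = k * q ^ (2 * i) := by rw [← hs]; ring
  have S := warnaar_sum (q := q) (s := s * q ^ i) (v := q ^ i * a / s) hq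
    (mul_ne_zero hs0 hi) (div_ne_zero (mul_ne_zero hi ha0) hs0)
    (fun m => by
      rw [e0, mul_assoc, ← pow_add]
      exact ha (2 * i + m)) N
  rw [e0, e1, e2, e3, e4, e5] at S
  have n0 : 1 - s * q ^ i ≠ 0 := by
    rw [mul_comm]; exact one_sub_pow_mul_ne_zero hs hk i
  have n1 := qPoch_ne_zero hk (2 * i)
  have n2 := one_sub_pow_mul_ne_zero hs hk (i + N)
  have hterm : ∀ r ∈ Finset.range (N + 1), warnaarKernel q a k s (i + N) (i + r)
        * wpKernel q a c (i + r) i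
      = (1 - s) / (1 - q ^ (i + N) * s) / (1 + a / s) * (k ^ 2 / a ^ 2) ^ i
        * (qPoch c q (2 * i) / qPoch (a * q) q (2 * i))
        * ((1 + q ^ i * a / s * q ^ r) * saalschutzWeight q (k ^ 2 / a ^ 2) (c / a)
            (c * q ^ (2 * i)) (a * q ^ (2 * i) * q) r
          * (qPoch (k ^ 2 / a ^ 2) q (N - r) / qPoch q q (N - r))) := by
    intro r hr
    have hr := Finset.mem_range.1 hr
    rw [warnaarKernel, wpKernel_add, saalschutzWeight, show i + N - (i + r) = N - r by omega,
      pow_add (k ^ 2 / a ^ 2), show q ^ (i + r) * a / s = q ^ i * a / s * q ^ r by ring]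
    generalize k ^ 2 / a ^ 2 = x
    generalize c / a = u
    generalize 1 + q ^ i * a / s * q ^ r = z
    generalize 1 + a / s = d
    generalize 1 - q ^ (i + N) * s = d'
    generalize 1 - s = d''
    simp only [div_eq_mul_inv, mul_inv]
    ring
  -- The factor 1 - s q^i can be removed because its vanishing would give k q^(2i) = 1.
  have S' := congrArg (fun z => z / (1 - s * q ^ i)) S
  simp only [mul_div_cancel_left₀ _ n0] at S'
  rw [Finset.sum_congr rfl hterm, ← Finset.mul_sum, S', wpKernel_add, warnaarMul_eq hc,
    show s * q ^ i * q ^ N = q ^ (i + N) * s by ring, mul_comm s]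
  have n0' : 1 - q ^ i * s ≠ 0 := one_sub_pow_mul_ne_zero hs hk i
  clear S S' hterm e0 e1 e2 e3 e4 e5
  generalize k ^ 2 / a ^ 2 = x
  generalize k / a = u
  generalize 1 + q ^ i * a / s = z
  generalize 1 + a / s = d
  generalize 1 - q ^ (i + N) * s = d' at *
  generalize 1 - q ^ i * s = d₃ at *
  generalize 1 - s = d''
  generalize qPoch k q (2 * i) = y at *
  refine Eq.trans (b := d'' / d₃ * (z / d) * qPoch c q (2 * i) * x ^ i
    * (qPoch u q N * qPoch (k * q ^ (2 * i)) q N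
      / (qPoch q q N * (qPoch (a * q) q (2 * i) * qPoch (a * q ^ (2 * i) * q) q N)))) ?_ ?_
  · refine eq_of_eq_mul_of_eq_one (div_self n2) ?_
    simp only [div_eq_mul_inv, mul_inv]
    ring
  · symm
    refine eq_of_eq_mul_of_eq_one (div_self n1) ?_
    simp only [div_eq_mul_inv, mul_inv]
    ring

theorem warnaar_inner (hq0 : q ≠ 0) (hq : ∀ m : ℕ, q * q ^ m ≠ 1)
    (h : GeneralChainDefined q a k a c) (hs : s ^ 2 = k) (hc : c = a ^ 2 / k)
    (hk : ∀ m : ℕ, k * q ^ m ≠ 1) (N : ℕ) :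
    qPoch (k / a) q N * qPoch k q N / (qPoch q q N * qPoch (a * q) q N)
      * generalInner q a k a c (warnaarMul q a k s) N 0 = warnaarKernel q a k s N 0 :=
  generalInner_of_kernel hq0 hq h
    (warnaar_kernel_sum hq0 hq h.a_ne h.k_ne h.a_pow hs hc hk) N

theorem one_add_pow_mul_ne_zero (hs : s ^ 2 = k)
    (h : GeneralChainDefined q a k a c) (hc : c = a ^ 2 / k) (n : ℕ) :
    1 + q ^ n * a / s ≠ 0 := by
  intro h0
  apply h.c_pow (2 * n)
  have h1 : q ^ n * a / s = -1 := by linear_combination h0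
  calc c * q ^ (2 * n) = (q ^ n * a / s) ^ 2 := by rw [hc, ← hs]; ring
    _ = 1 := by rw [h1]; ring

/-- Warnaar's first chain: evaluation of the inner sum. -/
theorem warnaar_inner_eq (hq0 : q ≠ 0) (hq : ∀ m : ℕ, q * q ^ m ≠ 1)
    (h : GeneralChainDefined q a k a c) (hs : s ^ 2 = k) (hc : c = a ^ 2 / k)
    (hk : ∀ m : ℕ, k * q ^ m ≠ 1) (N : ℕ) :
    generalInner q a k a c (warnaarMul q a k s) N 0 = andrewsBerkovichProduct q a k s N := by
  have h1 := warnaar_inner hq0 hq h hs hc hk N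
  have hk0 := h.k_ne
  have hs0 : s ≠ 0 := by rintro rfl; exact hk0 (by rw [← hs]; ring)
  have hsq : ∀ m : ℕ, s * q ^ m ≠ 1 := fun m h0 =>
    one_sub_pow_mul_ne_zero hs hk m (by rw [mul_comm, h0, sub_self])
  have n1 := qPoch_ne_zero hk N
  have n2 := qPoch_ne_zero h.k_div N
  have n3 := qPoch_ne_zero hq N
  have n4 := qPoch_ne_zero (mul_self_pow_ne_one h.a_pow) N
  have n5 : qPoch (q * s) q N ≠ 0 := by
    rw [mul_comm]; exact qPoch_ne_zero (mul_self_pow_ne_one fun m => hsq _) N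
  have n6 := one_sub_pow_mul_ne_zero hs hk N
  have n7 := one_add_pow_mul_ne_zero hs h hc 0
  rw [pow_zero, one_mul] at n7
  have t1 := qPoch_mul_eq s q N
  rw [mul_comm s (q ^ N), mul_comm s q] at t1
  rw [warnaarKernel, Nat.sub_zero, pow_zero, pow_zero, mul_one, one_mul, div_self n7,
    one_mul] at h1
  rw [andrewsBerkovichProduct]
  generalize generalInner q a k a c (warnaarMul q a k s) N 0 = I at *
  generalize qPoch k q N = x1 at *
  generalize qPoch (k / a) q N = x2 at *
  generalize qPoch q q N = x3 at *
  generalize qPoch (a * q) q N = x4 at *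
  generalize qPoch (k ^ 2 / a ^ 2) q N = x5 at *
  generalize qPoch (q * s) q N = x6 at *
  generalize qPoch s q N = x7 at *
  generalize 1 - q ^ N * s = d at *
  generalize 1 - s = d' at *
  rw [eq_div_iff (mul_ne_zero (mul_ne_zero n1 n2) n5)]
  have h2 : x2 * x1 * I = d' / d * x5 * x4 := by
    have : x2 * x1 * I = x3 * x4 * (x2 * x1 / (x3 * x4) * I) := by field_simp
    rw [this, h1]
    field_simp
  have h3 : d' / d * x6 = x7 := by
    rw [div_mul_eq_mul_div, ← t1, mul_div_cancel_right₀ _ n6]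
  linear_combination x6 * h2 + x5 * x4 * h3

theorem warnaarMul_shift (hq0 : q ≠ 0) (hs : s ^ 2 = k) (h : GeneralChainDefined q a k a c)
    (hc : c = a ^ 2 / k) (hk : ∀ m : ℕ, k * q ^ m ≠ 1) (j r : ℕ) :
    warnaarMul q a k s (r + j) = warnaarMul q a k s j
      * warnaarMul q (a * q ^ (2 * j)) (k * q ^ (2 * j)) (s * q ^ j) r := by
  have ha0 := h.a_ne
  have hk0 := h.k_ne
  have hs0 : s ≠ 0 := by rintro rfl; exact hk0 (by rw [← hs]; ring)
  have hj : q ^ j ≠ 0 := pow_ne_zero _ hq0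
  have e1 : (a * q ^ (2 * j)) ^ 2 / (k * q ^ (2 * j)) = a ^ 2 / k * q ^ (2 * j) := by
    rw [pow_mul']; field_simp
  have e2 : (k * q ^ (2 * j)) ^ 2 / (a * q ^ (2 * j)) ^ 2 = k ^ 2 / a ^ 2 := by
    rw [pow_mul']; field_simp
  have e3 : a * q ^ (2 * j) / (s * q ^ j) = q ^ j * a / s := by
    rw [pow_mul']; field_simp
  have e4 : q ^ r * (a * q ^ (2 * j)) / (s * q ^ j) = q ^ (r + j) * a / s := by
    rw [pow_mul', pow_add]; field_simp
  have n1 := one_sub_pow_mul_ne_zero hs hk j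
  have n2 := one_add_pow_mul_ne_zero hs h hc j
  rw [warnaarMul, warnaarMul, warnaarMul, e1, e2, e3, e4,
    show 2 * (r + j) = 2 * j + 2 * r by ring, pow_add (k ^ 2 / a ^ 2) r j,
    show q ^ r * (s * q ^ j) = q ^ (r + j) * s by ring, mul_comm s (q ^ j)]
  rw [qPoch_add _ _ (2 * j), qPoch_add k _ (2 * j)]
  symm
  generalize a ^ 2 / k = x
  generalize k ^ 2 / a ^ 2 = y
  refine eq_of_eq_mul_of_eq_one (u := (1 - q ^ j * s) / (1 - q ^ j * s)
    * ((1 + q ^ j * a / s) / (1 + q ^ j * a / s))) (by rw [div_self n1, div_self n2, mul_one]) ?_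
  generalize 1 - q ^ j * s = d
  generalize 1 + q ^ j * a / s = d'
  generalize 1 - q ^ (r + j) * s = f
  generalize 1 + q ^ (r + j) * a / s = f'
  generalize 1 + a / s = f''
  simp only [div_eq_mul_inv, mul_inv]
  ring

/-- Warnaar's first chain: the kernel of the general chain. -/
theorem warnaar_generalBeta (hq0 : q ≠ 0) (hq : ∀ m : ℕ, q * q ^ m ≠ 1)
    (h : GeneralChainDefined q a k a c) (hs : s ^ 2 = k) (hc : c = a ^ 2 / k)
    (hk : ∀ m : ℕ, k * q ^ m ≠ 1) (β : ℕ → K) (n : ℕ) :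
    generalBeta q a k a c (warnaarMul q a k s) β n = warnaarBeta q a k s c β n := by
  have ha0 := h.a_ne
  have hk0 := h.k_ne
  have hs0 : s ≠ 0 := by rintro rfl; exact hk0 (by rw [← hs]; ring)
  rw [warnaarBeta_eq ha0 hk0 hc]
  refine generalBeta_eq (M := warnaarKernel q a k s) hq0 h _ (warnaarMul_shift hq0 hs h hc hk)
    (fun j N => ?_) β n
  have hj : q ^ j ≠ 0 := pow_ne_zero _ hq0
  have h1 := warnaar_inner (s := s * q ^ j) hq0 hq (h.shift hq0 j) (by rw [← hs]; ring)
    (by rw [hc, pow_mul']; field_simp) (mul_pow_ne_one_of_add _ hk) N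
  rw [mul_div_mul_right _ _ (pow_ne_zero _ hq0)] at h1
  rw [h1, warnaarMul_eq hc, warnaarKernel, warnaarKernel,
    show (k * q ^ (2 * j)) ^ 2 / (a * q ^ (2 * j)) ^ 2 = k ^ 2 / a ^ 2 by
      rw [pow_mul']; field_simp,
    show j + N - j = N by omega, Nat.sub_zero, pow_zero, pow_zero, mul_one, one_mul,
    show a * q ^ (2 * j) / (s * q ^ j) = q ^ j * a / s by rw [pow_mul']; field_simp,
    show q ^ N * (s * q ^ j) = q ^ (j + N) * s by ring, mul_comm s (q ^ j)]
  have n1 := qPoch_ne_zero hk (2 * j)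
  have n2 := qPoch_ne_zero h.c_pow (2 * j)
  have n3 := one_sub_pow_mul_ne_zero hs hk j
  have n4 := one_add_pow_mul_ne_zero hs h hc j
  refine eq_of_eq_mul_of_eq_one (u := qPoch k q (2 * j) / qPoch k q (2 * j)
    * (qPoch c q (2 * j) / qPoch c q (2 * j)) * ((1 - q ^ j * s) / (1 - q ^ j * s)))
    (by rw [div_self n1, div_self n2, div_self n3, mul_one, mul_one]) ?_
  rw [div_self n4]
  generalize k ^ 2 / a ^ 2 = x
  generalize 1 - q ^ j * s = d
  generalize 1 + q ^ j * a / s = d'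
  generalize 1 - q ^ (j + N) * s = f
  generalize 1 + a / s = f''
  generalize 1 - s = f'''
  simp only [div_eq_mul_inv]
  ring

/-- Warnaar's first chain: the inner sum is the `10φ9` of Andrews and Berkovich. -/
theorem warnaar_series (hq0 : q ≠ 0) (h : GeneralChainDefined q a k a c)
    (hs : s ^ 2 = k) (hc : c = a ^ 2 / k) (hk : ∀ m : ℕ, k * q ^ m ≠ 1) {w t : K}
    (hw : w ^ 2 = q) (ht : t ^ 2 = a) (N : ℕ) :
    generalInner q a k a c (warnaarMul q a k s) N 0 = andrewsBerkovichSeries q a k w t s N := by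
  have ha0 := h.a_ne
  have hk0 := h.k_ne
  have hc0 := h.c_ne
  have hs0 : s ≠ 0 := by rintro rfl; exact hk0 (by rw [← hs]; ring)
  rw [generalInner_zero_eq h, andrewsBerkovichSeries, phi]
  refine Finset.sum_congr rfl fun r _ => ?_
  simp only [List.map_cons, List.map_nil, List.prod_cons, List.prod_nil, mul_one]
  have e1 : q ^ r = (q * c / k) ^ r * (k ^ 2 / a ^ 2) ^ r := by
    rw [← mul_pow, hc]
    congr 1
    field_simp
  have n1 := one_sub_pow_mul_ne_zero hs hk r
  have n2 := one_sub_pow_mul_ne_zero hs hk 0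
  have n3 := one_add_pow_mul_ne_zero hs h hc 0
  rw [pow_zero, one_mul] at n2 n3
  have hsq : ∀ m : ℕ, s * q ^ m ≠ 1 := fun m h0 =>
    one_sub_pow_mul_ne_zero hs hk m (by rw [mul_comm, h0, sub_self])
  have n4 := qPoch_ne_zero hsq r
  have n5 : qPoch (q * s) q r ≠ 0 := by
    rw [mul_comm]; exact qPoch_ne_zero (mul_self_pow_ne_one fun m => hsq _) r
  have p1 := qPoch_mul_neg (a * w / s) q r
  have p2 := qPoch_mul_neg (a / s) q r
  have p3 := qPoch_mul_neg (s * w) q r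
  have p4 := qPoch_mul_neg s q r
  rw [show (a * w / s) ^ 2 = c * q by rw [div_pow, mul_pow, hw, hs, hc]; ring] at p1
  rw [show (a / s) ^ 2 = c by rw [div_pow, hs, hc]] at p2
  rw [show (s * w) ^ 2 = k * q by rw [mul_pow, hw, hs]] at p3
  rw [hs] at p4
  -- The two rational factors of the multiplier account for the asymmetric parameters of the series:
  -- this one changes the lower parameter √k to q√k, and `m2` changes the upper parameter -a/√k to
  -- -aq/√k.
  have m1 : (1 - s) / (1 - q ^ r * s) / qPoch s q r = 1 / qPoch (q * s) q r := by
    have := qPoch_mul_eq s q r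
    rw [mul_comm s (q ^ r), mul_comm s q] at this
    rw [div_div, div_eq_div_iff (mul_ne_zero n1 n4) n5]
    linear_combination -this
  have m2 : (1 + q ^ r * a / s) / (1 + a / s) * qPoch (-(a / s)) q r
      = qPoch (-(a * q / s)) q r := by
    have := qPoch_mul_eq (-(a / s)) q r
    rw [show 1 - -(a / s) * q ^ r = 1 + q ^ r * a / s by ring,
      show 1 - -(a / s) = 1 + a / s by ring, show -(a / s) * q = -(a * q / s) by ring] at this
    rw [div_mul_eq_mul_div, div_eq_iff n3]
    linear_combination this
  rw [very_well_poised_factor h.a_pow' ht, warnaarMul_eq hc, qPoch_two_mul, qPoch_two_mul]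
  generalize (1 - s) / (1 - q ^ r * s) = d at m1 ⊢
  generalize (1 + q ^ r * a / s) / (1 + a / s) = p₃ at m2 ⊢
  rw [← p1, ← p2, ← p3, ← p4, e1, ← m2, show a / c = k / a by rw [hc]; field_simp,
    show c * q = a ^ 2 * q / k by rw [hc]; field_simp]
  clear p1 p2 p3 p4 m2
  generalize k ^ 2 / a ^ 2 = x
  generalize -(a * w / s) = p₁
  generalize a * w / s = p₂
  generalize -(a / s) = p₉
  generalize a / s = p₄
  generalize a * q / (k * q ^ N) = p₅
  generalize a ^ 2 * q / k = p₆
  generalize (q ^ N)⁻¹ = p₇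
  generalize (q * c / k) ^ r = p₈
  generalize k / a = p₁₀
  simp only [div_eq_mul_inv, mul_inv, one_mul] at m1 ⊢
  rw [← m1]
  ring

end Warnaar

/-! ### The Liu-Ma chain and the q-analogue of Watson's sum. -/

section LiuMa
variable {K : Type*} [Field K] {q a k c : K}

theorem sum_even_index (f : ℕ → K) (M : ℕ) :
    ∑ r ∈ Finset.range (2 * M + 1), (if Even (2 * M + r) then f r else 0)
      = ∑ ρ ∈ Finset.range (M + 1), f (2 * ρ) := by
  have h : ∀ M r : ℕ, (if Even (2 * M + r) then f r else 0) = if Even r then f r else 0 := by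
    intro M r
    simp [Nat.even_add]
  simp only [h]
  induction M with
  | zero => simp
  | succ M ih =>
    rw [show 2 * (M + 1) + 1 = 2 * M + 1 + 1 + 1 by ring, Finset.sum_range_succ,
      Finset.sum_range_succ, ih, Finset.sum_range_succ _ (M + 1)]
    simp [show 2 * M + 1 + 1 = 2 * (M + 1) by ring]

theorem sum_odd_index (f : ℕ → K) (M : ℕ) :
    ∑ r ∈ Finset.range (2 * M + 1 + 1), (if Even (2 * M + 1 + r) then f r else 0)
      = ∑ ρ ∈ Finset.range (M + 1), f (2 * ρ + 1) := by
  rw [Finset.sum_range_succ', ← sum_even_index (fun r => f (r + 1))]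
  simp only [Nat.even_add, Nat.even_add_one, even_two_mul]
  simp

/-- The kernel of the Liu-Ma chain, with `p` in place of `n ↦ (k; q²)_n`. -/
def liuMaKernel (q a k : K) (p : ℕ → K) (n j : ℕ) : K :=
  if Even (n + j) then
    (1 - a ^ 2 / k * q ^ (2 * j)) / (1 - a ^ 2 / k)
      * (p ((n + j) / 2) * qPoch (k ^ 2 / a ^ 2) (q ^ 2) ((n - j) / 2)
        / (qPoch (a ^ 2 / k * q ^ 2) (q ^ 2) ((n + j) / 2)
          * qPoch (q ^ 2) (q ^ 2) ((n - j) / 2)))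
      * (-k / a) ^ j
  else 0

theorem liuMaBeta_eq (β : ℕ → K) (n : ℕ) :
    liuMaBeta q a k β n
      = ∑ j ∈ Finset.range (n + 1), liuMaKernel q a k (qPoch k (q ^ 2)) n j * β j := by
  simp only [liuMaKernel, ite_mul, zero_mul]
  -- Reversing the order makes the index n - 2j run upwards through the numbers of the parity of n.
  rw [liuMaBeta, ← Finset.sum_range_reflect]
  obtain ⟨M, rfl | rfl⟩ := Nat.even_or_odd' n
  · rw [sum_even_index, show 2 * M / 2 = M by omega]
    refine Finset.sum_congr rfl fun ρ hρ => ?_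
    have hρ := Finset.mem_range.1 hρ
    rw [show M + 1 - 1 - ρ = M - ρ by omega,
      show 2 * (2 * M) - 4 * (M - ρ) = 2 * (2 * ρ) by omega,
      show 2 * M - (M - ρ) = M + ρ by omega, show 2 * M - 2 * (M - ρ) = 2 * ρ by omega,
      show (2 * M + 2 * ρ) / 2 = M + ρ by omega, show (2 * M - 2 * ρ) / 2 = M - ρ by omega]
    ring_nf
  · rw [sum_odd_index, show (2 * M + 1) / 2 = M by omega]
    refine Finset.sum_congr rfl fun ρ hρ => ?_
    have hρ := Finset.mem_range.1 hρ
    rw [show M + 1 - 1 - ρ = M - ρ by omega,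
      show 2 * (2 * M + 1) - 4 * (M - ρ) = 2 * (2 * ρ + 1) by omega,
      show 2 * M + 1 - (M - ρ) = M + 1 + ρ by omega,
      show 2 * M + 1 - 2 * (M - ρ) = 2 * ρ + 1 by omega,
      show (2 * M + 1 + (2 * ρ + 1)) / 2 = M + 1 + ρ by omega,
      show (2 * M + 1 - (2 * ρ + 1)) / 2 = M - ρ by omega]
    ring_nf

theorem liuMaMul_eq (hc : c = a ^ 2 / k) (n : ℕ) :
    liuMaMul q a k n = qPoch (c * q) (q ^ 2) n / qPoch (k * q) (q ^ 2) n * (-k / a) ^ n := by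
  rw [liuMaMul, hc]
  ring_nf

theorem mul_sq_pow_ne_one {x q : K} (h : ∀ m : ℕ, x * q ^ m ≠ 1) (m : ℕ) :
    x * (q ^ 2) ^ m ≠ 1 := by
  rw [← pow_mul]
  exact h _

/-- Splitting (x; q)_{2r} into (x; q²)_r (x q; q²)_r turns the sum into Jackson's sum in base q²
with base parameter c, further parameters c q, c/a, c q/a, and f = k²/a². -/
theorem liuMa_sum_even (hq0 : q ≠ 0) (hq : ∀ m : ℕ, q * q ^ m ≠ 1) (ha0 : a ≠ 0)
    (hk0 : k ≠ 0) (ha : ∀ m : ℕ, a * q ^ (m + 1) ≠ 1) (hc : c = a ^ 2 / k)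
    (hc1 : ∀ m : ℕ, c * (q ^ 2) ^ m ≠ 1) (M : ℕ) :
    ∑ r ∈ Finset.range (M + 1),
      (1 - c * (q ^ 2) ^ (2 * r)) / (1 - c)
        * (qPoch c q (2 * r) * qPoch (c / a) q (2 * r) / (qPoch q q (2 * r) * qPoch (a * q) q (2 * r)))
        * (k ^ 2 / a ^ 2) ^ r
        * (qPoch (k ^ 2 / a ^ 2) (q ^ 2) (M - r) / qPoch (q ^ 2) (q ^ 2) (M - r))
        * (qPoch (k * (q ^ 2) ^ M) (q ^ 2) r / qPoch (c * (q ^ 2) ^ (M + 1)) (q ^ 2) r)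
      = qPoch (c * q ^ 2) (q ^ 2) M * qPoch (k / a) q (2 * M) * qPoch (k * q) (q ^ 2) M
        / (qPoch q q (2 * M) * qPoch (a * q) q (2 * M)) := by
  have e1 : c / a * (c / a * q) * (k ^ 2 / a ^ 2) = q := by rw [hc]; field_simp
  have e2 : c * q * (c / a * q) * (k ^ 2 / a ^ 2) = a * q * q := by rw [hc]; field_simp
  have e3 : c * q * (c / a) * (k ^ 2 / a ^ 2) = a * q := by rw [hc]; field_simp
  have e4 : c / a * q * (k ^ 2 / a ^ 2) = k / a * q := by rw [hc]; field_simp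
  have e5 : c / a * (k ^ 2 / a ^ 2) = k / a := by rw [hc]; field_simp
  have e6 : c * q * (k ^ 2 / a ^ 2) = k * q := by rw [hc]; field_simp
  have e7 : c * (k ^ 2 / a ^ 2) = k := by rw [hc]; field_simp
  have J := jackson_sum (q := q ^ 2) (a := c) (b := c * q) (c := c / a) (d := c / a * q)
    (f := k ^ 2 / a ^ 2) (pow_ne_zero _ hq0)
    (fun m => by
      rw [show q ^ 2 * (q ^ 2) ^ m = q * q ^ (2 * m + 1) by ring]; exact hq _) hc1
    (by rw [e1]; exact mul_sq_pow_ne_one hq)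
    (by rw [e2]; exact mul_sq_pow_ne_one (mul_self_pow_ne_one fun m => by
          rw [mul_assoc, ← pow_succ']; exact ha _))
    (by rw [e3]; exact mul_sq_pow_ne_one (mul_self_pow_ne_one ha))
    (by rw [hc]; field_simp) M
  rw [e1, e2, e3, e4, e5, e6, e7] at J
  refine Eq.trans (Finset.sum_congr rfl fun r _ => ?_) (J.trans ?_)
  · rw [qPoch_two_mul, qPoch_two_mul, qPoch_two_mul, qPoch_two_mul, show q * q = q ^ 2 by ring]
    generalize k ^ 2 / a ^ 2 = x
    generalize c / a = v
    simp only [div_eq_mul_inv, mul_inv]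
    ring
  · rw [qPoch_two_mul, qPoch_two_mul, qPoch_two_mul, show q * q = q ^ 2 by ring]
    generalize k / a = u
    simp only [div_eq_mul_inv, mul_inv]
    ring

/-- The splitting of (x; q)_{2r+1} leaves a factor 1 - x and gives Jackson's sum in base q² with
base parameter c q². The leftover factors combine through -(k/a)(1 - c/a) = 1 - k/a, because c =
a²/k. -/
theorem liuMa_sum_odd (hq0 : q ≠ 0) (hq : ∀ m : ℕ, q * q ^ m ≠ 1) (ha0 : a ≠ 0)
    (hk0 : k ≠ 0) (ha : ∀ m : ℕ, a * q ^ (m + 1) ≠ 1) (hc : c = a ^ 2 / k)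
    (hc1 : ∀ m : ℕ, c * (q ^ 2) ^ m ≠ 1) (M : ℕ) :
    -k / a * ∑ r ∈ Finset.range (M + 1),
      (1 - c * q ^ 2 * (q ^ 2) ^ (2 * r)) / (1 - c * q ^ 2)
        * (qPoch c q (2 * r + 1) * qPoch (c / a) q (2 * r + 1)
          / (qPoch q q (2 * r + 1) * qPoch (a * q) q (2 * r + 1)))
        * (k ^ 2 / a ^ 2) ^ r
        * (qPoch (k ^ 2 / a ^ 2) (q ^ 2) (M - r) / qPoch (q ^ 2) (q ^ 2) (M - r))
        * (qPoch (k * q ^ 2 * (q ^ 2) ^ M) (q ^ 2) r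
          / qPoch (c * q ^ 2 * (q ^ 2) ^ (M + 1)) (q ^ 2) r)
      = (1 - c) * (qPoch (c * q ^ 2 * q ^ 2) (q ^ 2) M * qPoch (k / a) q (2 * M + 1)
          * qPoch (k * q) (q ^ 2) M)
        / (qPoch q q (2 * M + 1) * qPoch (a * q) q (2 * M + 1)) := by
  have e1 : c / a * q * (c / a * q ^ 2) * (k ^ 2 / a ^ 2) = q * q ^ 2 := by rw [hc]; field_simp
  have e2 : c * q * (c / a * q ^ 2) * (k ^ 2 / a ^ 2) = a * q * q ^ 2 := by rw [hc]; field_simp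
  have e3 : c * q * (c / a * q) * (k ^ 2 / a ^ 2) = a * q * q := by rw [hc]; field_simp
  have e4 : c / a * q ^ 2 * (k ^ 2 / a ^ 2) = k / a * q ^ 2 := by rw [hc]; field_simp
  have e5 : c / a * q * (k ^ 2 / a ^ 2) = k / a * q := by rw [hc]; field_simp
  have e6 : c * q * (k ^ 2 / a ^ 2) = k * q := by rw [hc]; field_simp
  have e7 : c * q ^ 2 * (k ^ 2 / a ^ 2) = k * q ^ 2 := by rw [hc]; field_simp
  have e8 : -k / a * (1 - c / a) = 1 - k / a := by rw [hc]; field_simp; ring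
  have J := jackson_sum (q := q ^ 2) (a := c * q ^ 2) (b := c * q) (c := c / a * q)
    (d := c / a * q ^ 2) (f := k ^ 2 / a ^ 2) (pow_ne_zero _ hq0)
    (fun m => by
      rw [show q ^ 2 * (q ^ 2) ^ m = q * q ^ (2 * m + 1) by ring]; exact hq _)
    (mul_self_pow_ne_one fun m => hc1 _)
    (by rw [e1]; exact fun m => by
          rw [show q * q ^ 2 * (q ^ 2) ^ m = q * q ^ (2 * m + 2) by ring]; exact hq _)
    (by rw [e2]; exact fun m => by
          rw [show a * q * q ^ 2 * (q ^ 2) ^ m = a * q ^ (2 * m + 2 + 1) by ring]; exact ha _)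
    (by rw [e3]; exact fun m => by
          rw [show a * q * q * (q ^ 2) ^ m = a * q ^ (2 * m + 1 + 1) by ring]; exact ha _)
    (by rw [hc]; field_simp) M
  rw [e1, e2, e3, e4, e5, e6, e7] at J
  have hterm : ∀ r ∈ Finset.range (M + 1), (1 - c * q ^ 2 * (q ^ 2) ^ (2 * r)) / (1 - c * q ^ 2)
        * (qPoch c q (2 * r + 1) * qPoch (c / a) q (2 * r + 1)
          / (qPoch q q (2 * r + 1) * qPoch (a * q) q (2 * r + 1)))
        * (k ^ 2 / a ^ 2) ^ r
        * (qPoch (k ^ 2 / a ^ 2) (q ^ 2) (M - r) / qPoch (q ^ 2) (q ^ 2) (M - r))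
        * (qPoch (k * q ^ 2 * (q ^ 2) ^ M) (q ^ 2) r
          / qPoch (c * q ^ 2 * (q ^ 2) ^ (M + 1)) (q ^ 2) r)
      = (1 - c) * (1 - c / a) / ((1 - q) * (1 - a * q))
        * ((1 - c * q ^ 2 * (q ^ 2) ^ (2 * r)) / (1 - c * q ^ 2)
        * (qPoch (c * q ^ 2) (q ^ 2) r * qPoch (c * q) (q ^ 2) r * qPoch (c / a * q) (q ^ 2) r
            * qPoch (c / a * q ^ 2) (q ^ 2) r
          / (qPoch (q ^ 2) (q ^ 2) r * qPoch (q * q ^ 2) (q ^ 2) r * qPoch (a * q * q ^ 2) (q ^ 2) r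
            * qPoch (a * q * q) (q ^ 2) r))
        * (k ^ 2 / a ^ 2) ^ r
        * (qPoch (k ^ 2 / a ^ 2) (q ^ 2) (M - r) / qPoch (q ^ 2) (q ^ 2) (M - r))
        * (qPoch (k * q ^ 2 * (q ^ 2) ^ M) (q ^ 2) r
          / qPoch (c * q ^ 2 * (q ^ 2) ^ (M + 1)) (q ^ 2) r)) := by
    intro r _
    simp only [qPoch_two_mul_add_one, show q * q = q ^ 2 by ring]
    generalize k ^ 2 / a ^ 2 = x
    generalize c / a = v
    generalize 1 - v = v'
    generalize 1 - c = c'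
    generalize 1 - c * q ^ 2 = c''
    generalize 1 - c * q ^ 2 * (q ^ 2) ^ (2 * r) = c'''
    generalize 1 - q = q'
    generalize 1 - a * q = a'
    simp only [div_eq_mul_inv, mul_inv]
    ring
  rw [Finset.sum_congr rfl hterm, ← Finset.mul_sum, J]
  simp only [qPoch_two_mul_add_one, show q * q = q ^ 2 by ring]
  rw [← e8]
  generalize k / a = u
  generalize -k / a = u'
  generalize c / a = v
  generalize 1 - v = v'
  generalize 1 - c = c'
  generalize 1 - q = q'
  generalize 1 - a * q = a'
  simp only [div_eq_mul_inv, mul_inv]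
  ring

/-- The matrix of a WP-Bailey pair with `(k)_{n+j}` replaced using `p` in place of
`n ↦ (k; q²)_n`. -/
def splitKernel (q a k : K) (p : ℕ → K) (n j : ℕ) : K :=
  qPoch (k / a) q (n - j) * (p ((n + j + 1) / 2) * qPoch (k * q) (q ^ 2) ((n + j) / 2))
    / (qPoch q q (n - j) * qPoch (a * q) q (n + j))

/-- Among the factors of (k; q)_{n+j}, those with even powers of q form a product of length
⌈(n+j)/2⌉ and those with odd powers one of length ⌊(n+j)/2⌋. -/
theorem splitKernel_eq (n j : ℕ) :
    splitKernel q a k (qPoch k (q ^ 2)) n j = wpKernel q a k n j := by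
  rw [splitKernel, wpKernel]
  congr 2
  obtain ⟨m, hm | hm⟩ := Nat.even_or_odd' (n + j)
  · rw [hm, show (2 * m + 1) / 2 = m by omega, show 2 * m / 2 = m by omega, qPoch_two_mul]
  · rw [hm, show (2 * m + 1 + 1) / 2 = m + 1 by omega, show (2 * m + 1) / 2 = m by omega,
      qPoch_two_mul_add_one, qPoch_succ_left]
    ring

/-- Both sides are homogeneous in p, and only its recursion from n₀ onwards matters: p is evaluated
at arguments at least i + ⌈N/2⌉. Taking p = (k; q²)_n gives the identity for (A). A p normalized to
1 at n₀ gives the evaluation of the inner sum even when (k; q²)_{n₀} vanishes. -/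
theorem liuMa_kernel_sum (hq0 : q ≠ 0) (hq : ∀ m : ℕ, q * q ^ m ≠ 1) (ha0 : a ≠ 0)
    (hk0 : k ≠ 0) (ha : ∀ m : ℕ, a * q ^ (m + 1) ≠ 1) (hc : c = a ^ 2 / k)
    (hkq : ∀ m : ℕ, k * q * (q ^ 2) ^ m ≠ 1)
    (hc1 : ∀ m : ℕ, c * (q ^ 2) ^ m ≠ 1) (p : ℕ → K) (n₀ i N : ℕ)
    (hp : ∀ m r, n₀ ≤ m → p (m + r) = p m * qPoch (k * (q ^ 2) ^ m) (q ^ 2) r)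
    (hn : n₀ ≤ i + (N + 1) / 2) :
    ∑ r ∈ Finset.range (N + 1), liuMaKernel q a k p (i + N) (i + r) * wpKernel q a c (i + r) i
      = liuMaMul q a k i * splitKernel q a k p (i + N) i := by
  have hQ : (q ^ 2) ^ i ≠ 0 := pow_ne_zero _ (pow_ne_zero _ hq0)
  have hpow : q ^ (2 * i) = (q ^ 2) ^ i := pow_mul _ _ _
  have ha' : ∀ m : ℕ, a * (q ^ 2) ^ i * q ^ (m + 1) ≠ 1 := fun m => by
    rw [← hpow, mul_assoc, ← pow_add]; exact ha (2 * i + m)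
  have hc' : c * (q ^ 2) ^ i = (a * (q ^ 2) ^ i) ^ 2 / (k * (q ^ 2) ^ i) := by
    rw [hc]; field_simp
  have f1 : c * (q ^ 2) ^ i / (a * (q ^ 2) ^ i) = c / a := mul_div_mul_right _ _ hQ
  have f2 : (k * (q ^ 2) ^ i) ^ 2 / (a * (q ^ 2) ^ i) ^ 2 = k ^ 2 / a ^ 2 := by
    rw [mul_pow, mul_pow, mul_div_mul_right _ _ (pow_ne_zero _ hQ)]
  have f3 : k * (q ^ 2) ^ i / (a * (q ^ 2) ^ i) = k / a := mul_div_mul_right _ _ hQ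
  have f4 : -(k * (q ^ 2) ^ i) / (a * (q ^ 2) ^ i) = -k / a := by
    rw [← neg_mul, mul_div_mul_right _ _ hQ]
  have f5 : ∀ ρ : ℕ, (-k / a) ^ (2 * ρ) = (k ^ 2 / a ^ 2) ^ ρ := fun ρ => by
    rw [pow_mul, div_pow, neg_sq]
  have n1 := qPoch_ne_zero hkq i
  have n2 := sub_ne_zero.2 (hc1 0).symm
  rw [pow_zero, mul_one] at n2
  have n3 := qPoch_ne_zero (mul_self_pow_ne_one fun m => hc1 _) i
  have n4 := qPoch_ne_zero (mul_pow_ne_one_of_add i (mul_self_pow_ne_one fun m => hc1 (m + 1)))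
  have t1 := qPoch_mul_eq c (q ^ 2) i
  have t2 : qPoch c q (2 * i) = qPoch c (q ^ 2) i * qPoch (c * q) (q ^ 2) i := qPoch_two_mul _ _ _
  have t3 : (1 - c * (q ^ 2) ^ i) / (1 - c) * qPoch c q (2 * i) / qPoch (c * q ^ 2) (q ^ 2) i
      = qPoch (c * q) (q ^ 2) i := by
    rw [t2, div_mul_eq_mul_div, div_div, div_eq_iff (mul_ne_zero n2 n3)]
    linear_combination qPoch (c * q) (q ^ 2) i * t1
  -- The kernel keeps only indices r of the parity of N, so the two parities lead to the two
  -- different Jackson sums.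
  obtain ⟨M, rfl | rfl⟩ := Nat.even_or_odd' N
  · have S := liuMa_sum_even hq0 hq (mul_ne_zero ha0 hQ) (mul_ne_zero hk0 hQ) ha' hc'
      (mul_pow_ne_one_of_add i hc1) M
    rw [f1, f2, f3] at S
    have nC := sub_ne_zero.2 (hc1 i).symm
    have hsplit : ∀ r, liuMaKernel q a k p (i + 2 * M) (i + r) * wpKernel q a c (i + r) i
        = if Even (2 * M + r) then (1 - c * q ^ (2 * (i + r))) / (1 - c)
            * (p ((i + 2 * M + (i + r)) / 2)
                * qPoch (k ^ 2 / a ^ 2) (q ^ 2) ((i + 2 * M - (i + r)) / 2)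
              / (qPoch (c * q ^ 2) (q ^ 2) ((i + 2 * M + (i + r)) / 2)
                * qPoch (q ^ 2) (q ^ 2) ((i + 2 * M - (i + r)) / 2)))
            * (-k / a) ^ (i + r) * wpKernel q a c (i + r) i else 0 := by
      intro r
      have : Even (i + 2 * M + (i + r)) ↔ Even (2 * M + r) := by
        rw [show i + 2 * M + (i + r) = 2 * i + (2 * M + r) by ring, Nat.even_add]
        simp
      rw [liuMaKernel, hc, ite_mul, zero_mul]
      simp only [this]
    simp only [hsplit]
    rw [sum_even_index]
    have hterm : ∀ ρ ∈ Finset.range (M + 1), (1 - c * q ^ (2 * (i + 2 * ρ))) / (1 - c)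
            * (p ((i + 2 * M + (i + 2 * ρ)) / 2)
                * qPoch (k ^ 2 / a ^ 2) (q ^ 2) ((i + 2 * M - (i + 2 * ρ)) / 2)
              / (qPoch (c * q ^ 2) (q ^ 2) ((i + 2 * M + (i + 2 * ρ)) / 2)
                * qPoch (q ^ 2) (q ^ 2) ((i + 2 * M - (i + 2 * ρ)) / 2)))
            * (-k / a) ^ (i + 2 * ρ) * wpKernel q a c (i + 2 * ρ) i
        = (1 - c * (q ^ 2) ^ i) / (1 - c) * p (i + M) / qPoch (c * q ^ 2) (q ^ 2) (i + M)
            * (-k / a) ^ i * qPoch c q (2 * i) / qPoch (a * q) q (2 * i)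
          * ((1 - c * (q ^ 2) ^ i * (q ^ 2) ^ (2 * ρ)) / (1 - c * (q ^ 2) ^ i)
        * (qPoch (c * (q ^ 2) ^ i) q (2 * ρ) * qPoch (c / a) q (2 * ρ)
          / (qPoch q q (2 * ρ) * qPoch (a * (q ^ 2) ^ i * q) q (2 * ρ)))
        * (k ^ 2 / a ^ 2) ^ ρ
        * (qPoch (k ^ 2 / a ^ 2) (q ^ 2) (M - ρ) / qPoch (q ^ 2) (q ^ 2) (M - ρ))
        * (qPoch (k * (q ^ 2) ^ i * (q ^ 2) ^ M) (q ^ 2) ρ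
          / qPoch (c * (q ^ 2) ^ i * (q ^ 2) ^ (M + 1)) (q ^ 2) ρ)) := by
      intro ρ hρ
      have hρ := Finset.mem_range.1 hρ
      rw [show (i + 2 * M + (i + 2 * ρ)) / 2 = i + M + ρ by omega,
        show (i + 2 * M - (i + 2 * ρ)) / 2 = M - ρ by omega, hp (i + M) ρ (by omega),
        qPoch_add (c * q ^ 2) (q ^ 2) (i + M) ρ, wpKernel_add, hpow, pow_add (-k / a), f5,
        show k * (q ^ 2) ^ (i + M) = k * (q ^ 2) ^ i * (q ^ 2) ^ M by ring,
        show c * q ^ 2 * (q ^ 2) ^ (i + M) = c * (q ^ 2) ^ i * (q ^ 2) ^ (M + 1) by ring,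
        show c * q ^ (2 * (i + 2 * ρ)) = c * (q ^ 2) ^ i * (q ^ 2) ^ (2 * ρ) by ring]
      clear S hsplit
      generalize k ^ 2 / a ^ 2 = x
      generalize c / a = v
      generalize -k / a = u
      generalize 1 - c * (q ^ 2) ^ i * (q ^ 2) ^ (2 * ρ) = d
      generalize 1 - c * (q ^ 2) ^ i = d' at *
      generalize 1 - c = d'' at *
      symm
      refine eq_of_eq_mul_of_eq_one (div_self nC) ?_
      simp only [div_eq_mul_inv, mul_inv]
      ring
    rw [Finset.sum_congr rfl hterm, ← Finset.mul_sum, S, liuMaMul_eq hc, splitKernel,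
      show (i + 2 * M + i + 1) / 2 = i + M by omega, show (i + 2 * M + i) / 2 = i + M by omega,
      show i + 2 * M - i = 2 * M by omega, show i + 2 * M + i = 2 * i + 2 * M by ring,
      qPoch_add (a * q) q (2 * i), qPoch_add (k * q), qPoch_add (c * q ^ 2), hpow, ← t3,
      show c * q ^ 2 * (q ^ 2) ^ i = c * (q ^ 2) ^ i * q ^ 2 by ring,
      show k * q * (q ^ 2) ^ i = k * (q ^ 2) ^ i * q by ring,
      show a * q * (q ^ 2) ^ i = a * (q ^ 2) ^ i * q by ring]
    have n5 : qPoch (c * (q ^ 2) ^ i * q ^ 2) (q ^ 2) M ≠ 0 := by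
      have := n4 M
      rwa [show c * q ^ 2 * (q ^ 2) ^ i = c * (q ^ 2) ^ i * q ^ 2 by ring] at this
    clear S hsplit hterm t1 t2 t3 f1 f2 f3 f4 f5
    generalize k / a = u
    generalize -k / a = u'
    generalize 1 - c * (q ^ 2) ^ i = d'
    generalize 1 - c = d''
    generalize qPoch (c * (q ^ 2) ^ i * q ^ 2) (q ^ 2) M = y1 at *
    generalize qPoch (k * q) (q ^ 2) i = y2 at *
    refine Eq.trans (b := d' / d'' * p (i + M) / qPoch (c * q ^ 2) (q ^ 2) i * u' ^ i
      * qPoch c q (2 * i) / qPoch (a * q) q (2 * i) * (qPoch u q (2 * M)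
        * qPoch (k * (q ^ 2) ^ i * q) (q ^ 2) M
        / (qPoch q q (2 * M) * qPoch (a * (q ^ 2) ^ i * q) q (2 * M)))) ?_ ?_
    · refine eq_of_eq_mul_of_eq_one (div_self n5) ?_
      simp only [div_eq_mul_inv, mul_inv]
      ring
    · symm
      refine eq_of_eq_mul_of_eq_one (div_self n1) ?_
      simp only [div_eq_mul_inv, mul_inv]
      ring
  · have S := liuMa_sum_odd hq0 hq (mul_ne_zero ha0 hQ) (mul_ne_zero hk0 hQ) ha' hc'
      (mul_pow_ne_one_of_add i hc1) M
    rw [f1, f2, f3, f4] at S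
    have nC := sub_ne_zero.2 (hc1 (i + 1)).symm
    rw [show c * (q ^ 2) ^ (i + 1) = c * (q ^ 2) ^ i * q ^ 2 by ring] at nC
    have hsplit : ∀ r, liuMaKernel q a k p (i + (2 * M + 1)) (i + r) * wpKernel q a c (i + r) i
        = if Even (2 * M + 1 + r) then (1 - c * q ^ (2 * (i + r))) / (1 - c)
            * (p ((i + (2 * M + 1) + (i + r)) / 2)
                * qPoch (k ^ 2 / a ^ 2) (q ^ 2) ((i + (2 * M + 1) - (i + r)) / 2)
              / (qPoch (c * q ^ 2) (q ^ 2) ((i + (2 * M + 1) + (i + r)) / 2)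
                * qPoch (q ^ 2) (q ^ 2) ((i + (2 * M + 1) - (i + r)) / 2)))
            * (-k / a) ^ (i + r) * wpKernel q a c (i + r) i else 0 := by
      intro r
      have : Even (i + (2 * M + 1) + (i + r)) ↔ Even (2 * M + 1 + r) := by
        rw [show i + (2 * M + 1) + (i + r) = 2 * i + (2 * M + 1 + r) by ring, Nat.even_add]
        simp
      rw [liuMaKernel, hc, ite_mul, zero_mul]
      simp only [this]
    simp only [hsplit]
    rw [sum_odd_index]
    have hterm : ∀ ρ ∈ Finset.range (M + 1), (1 - c * q ^ (2 * (i + (2 * ρ + 1)))) / (1 - c)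
            * (p ((i + (2 * M + 1) + (i + (2 * ρ + 1))) / 2)
                * qPoch (k ^ 2 / a ^ 2) (q ^ 2) ((i + (2 * M + 1) - (i + (2 * ρ + 1))) / 2)
              / (qPoch (c * q ^ 2) (q ^ 2) ((i + (2 * M + 1) + (i + (2 * ρ + 1))) / 2)
                * qPoch (q ^ 2) (q ^ 2) ((i + (2 * M + 1) - (i + (2 * ρ + 1))) / 2)))
            * (-k / a) ^ (i + (2 * ρ + 1)) * wpKernel q a c (i + (2 * ρ + 1)) i
        = (1 - c * (q ^ 2) ^ i * q ^ 2) / (1 - c) * p (i + (M + 1))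
            / qPoch (c * q ^ 2) (q ^ 2) (i + (M + 1))
            * (-k / a) ^ i * qPoch c q (2 * i) / qPoch (a * q) q (2 * i)
          * (-k / a * ((1 - c * (q ^ 2) ^ i * q ^ 2 * (q ^ 2) ^ (2 * ρ))
              / (1 - c * (q ^ 2) ^ i * q ^ 2)
        * (qPoch (c * (q ^ 2) ^ i) q (2 * ρ + 1) * qPoch (c / a) q (2 * ρ + 1)
          / (qPoch q q (2 * ρ + 1) * qPoch (a * (q ^ 2) ^ i * q) q (2 * ρ + 1)))
        * (k ^ 2 / a ^ 2) ^ ρ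
        * (qPoch (k ^ 2 / a ^ 2) (q ^ 2) (M - ρ) / qPoch (q ^ 2) (q ^ 2) (M - ρ))
        * (qPoch (k * (q ^ 2) ^ i * q ^ 2 * (q ^ 2) ^ M) (q ^ 2) ρ
          / qPoch (c * (q ^ 2) ^ i * q ^ 2 * (q ^ 2) ^ (M + 1)) (q ^ 2) ρ))) := by
      intro ρ hρ
      have hρ := Finset.mem_range.1 hρ
      rw [show (i + (2 * M + 1) + (i + (2 * ρ + 1))) / 2 = i + (M + 1) + ρ by omega,
        show (i + (2 * M + 1) - (i + (2 * ρ + 1))) / 2 = M - ρ by omega,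
        hp (i + (M + 1)) ρ (by omega),
        qPoch_add (c * q ^ 2) (q ^ 2) (i + (M + 1)) ρ, wpKernel_add, hpow, pow_add (-k / a),
        pow_succ (-k / a) (2 * ρ), f5,
        show k * (q ^ 2) ^ (i + (M + 1)) = k * (q ^ 2) ^ i * q ^ 2 * (q ^ 2) ^ M by ring,
        show c * q ^ 2 * (q ^ 2) ^ (i + (M + 1))
          = c * (q ^ 2) ^ i * q ^ 2 * (q ^ 2) ^ (M + 1) by ring,
        show c * q ^ (2 * (i + (2 * ρ + 1)))
          = c * (q ^ 2) ^ i * q ^ 2 * (q ^ 2) ^ (2 * ρ) by ring]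
      clear S hsplit
      generalize k ^ 2 / a ^ 2 = x
      generalize c / a = v
      generalize -k / a = u
      generalize 1 - c * (q ^ 2) ^ i * q ^ 2 * (q ^ 2) ^ (2 * ρ) = d
      generalize 1 - c * (q ^ 2) ^ i * q ^ 2 = d' at *
      generalize 1 - c = d'' at *
      symm
      refine eq_of_eq_mul_of_eq_one (div_self nC) ?_
      simp only [div_eq_mul_inv, mul_inv]
      ring
    rw [Finset.sum_congr rfl hterm, ← Finset.mul_sum, ← Finset.mul_sum, S, liuMaMul_eq hc,
      splitKernel,
      show (i + (2 * M + 1) + i + 1) / 2 = i + (M + 1) by omega,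
      show (i + (2 * M + 1) + i) / 2 = i + M by omega,
      show i + (2 * M + 1) - i = 2 * M + 1 by omega,
      show i + (2 * M + 1) + i = 2 * i + (2 * M + 1) by ring,
      qPoch_add (a * q) q (2 * i), qPoch_add (k * q), qPoch_add (c * q ^ 2), hpow, ← t3,
      show c * q ^ 2 * (q ^ 2) ^ i = c * (q ^ 2) ^ i * q ^ 2 by ring,
      show k * q * (q ^ 2) ^ i = k * (q ^ 2) ^ i * q by ring,
      show a * q * (q ^ 2) ^ i = a * (q ^ 2) ^ i * q by ring,
      qPoch_succ_left (c * (q ^ 2) ^ i * q ^ 2)]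
    have n5 : qPoch (c * (q ^ 2) ^ i * q ^ 2 * q ^ 2) (q ^ 2) M ≠ 0 := by
      have := n4 (M + 1)
      rw [show c * q ^ 2 * (q ^ 2) ^ i = c * (q ^ 2) ^ i * q ^ 2 by ring, qPoch_succ_left] at this
      exact right_ne_zero_of_mul this
    clear S hsplit hterm t1 t2 t3 f1 f2 f3 f4 f5
    generalize k / a = u
    generalize -k / a = u'
    generalize 1 - c * (q ^ 2) ^ i * q ^ 2 = d at *
    generalize 1 - c * (q ^ 2) ^ i = d'
    generalize 1 - c = d''
    generalize qPoch (c * (q ^ 2) ^ i * q ^ 2 * q ^ 2) (q ^ 2) M = y1 at *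
    generalize qPoch (k * q) (q ^ 2) i = y2 at *
    refine Eq.trans (b := d' / d'' * p (i + (M + 1)) / qPoch (c * q ^ 2) (q ^ 2) i * u' ^ i
      * qPoch c q (2 * i) / qPoch (a * q) q (2 * i) * (qPoch u q (2 * M + 1)
        * qPoch (k * (q ^ 2) ^ i * q) (q ^ 2) M
        / (qPoch q q (2 * M + 1) * qPoch (a * (q ^ 2) ^ i * q) q (2 * M + 1)))) ?_ ?_
    · refine eq_of_eq_mul_of_eq_one (u := y1 / y1 * (d / d))
        (by rw [div_self n5, div_self nC, mul_one]) ?_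
      simp only [div_eq_mul_inv, mul_inv]
      ring
    · symm
      refine eq_of_eq_mul_of_eq_one (div_self n1) ?_
      simp only [div_eq_mul_inv, mul_inv]
      ring

/-- The Liu-Ma chain maps WP-Bailey pairs to WP-Bailey pairs. -/
theorem liuMa_isWPBaileyPair (hq0 : q ≠ 0) (hq : ∀ m : ℕ, q * q ^ m ≠ 1) (ha0 : a ≠ 0)
    (hk0 : k ≠ 0) (ha : ∀ m : ℕ, a * q ^ (m + 1) ≠ 1) (hc : c = a ^ 2 / k)
    (hkq : ∀ m : ℕ, k * q * (q ^ 2) ^ m ≠ 1) (hc1 : ∀ m : ℕ, c * (q ^ 2) ^ m ≠ 1)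
    {α β : ℕ → K} (h : IsWPBaileyPair q a c α β) :
    IsWPBaileyPair q a k (fun n => liuMaMul q a k n * α n) (liuMaBeta q a k β) :=
  isWPBaileyPair_of_kernel (M := liuMaKernel q a k (qPoch k (q ^ 2)))
    (fun i N => by
      rw [liuMa_kernel_sum hq0 hq ha0 hk0 ha hc hkq hc1 _ 0 i N
        (fun m r _ => qPoch_add _ _ _ _) (Nat.zero_le _), splitKernel_eq])
    h (liuMaBeta_eq β)

/-- As r grows, the new factor of (k q^N; q)_r goes alternately to the even-power and the odd-power
product. The left side uses the normalized p, so (k; q²)_{⌈N/2⌉} is absent. -/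
theorem shifted_split_factor (N r : ℕ) :
    qPoch (k * (q ^ 2) ^ ((N + 1) / 2)) (q ^ 2) ((N + r + 1) / 2 - (N + 1) / 2)
        * qPoch (k * q) (q ^ 2) ((N + r) / 2)
      = qPoch (k * q) (q ^ 2) (N / 2) * qPoch (k * q ^ N) q r := by
  induction r with
  | zero => simp
  | succ r ih =>
    rw [qPoch_succ, ← mul_assoc, ← ih]
    obtain ⟨m, hm | hm⟩ := Nat.even_or_odd' (N + r)
    · rw [show (N + (r + 1) + 1) / 2 - (N + 1) / 2 = (N + r + 1) / 2 - (N + 1) / 2 + 1 by omega,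
        show (N + (r + 1)) / 2 = (N + r) / 2 by omega, qPoch_succ, mul_assoc k ((q ^ 2) ^ _),
        ← pow_add,
        show (N + 1) / 2 + ((N + r + 1) / 2 - (N + 1) / 2) = m by omega,
        show k * (q ^ 2) ^ m = k * q ^ N * q ^ r by rw [← pow_mul, ← hm, pow_add]; ring]
      ring
    · rw [show (N + (r + 1) + 1) / 2 - (N + 1) / 2 = (N + r + 1) / 2 - (N + 1) / 2 by omega,
        show (N + (r + 1)) / 2 = (N + r) / 2 + 1 by omega, qPoch_succ,
        show (N + r) / 2 = m by omega,
        show k * q * (q ^ 2) ^ m = k * q ^ N * q ^ r by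
          rw [← pow_mul, mul_assoc, ← pow_succ', ← hm, pow_add]; ring]
      ring

/-- The Liu-Ma chain: the inner sum in a form without the factor `(k; q)_N`. -/
theorem liuMa_inner (hq0 : q ≠ 0) (hq : ∀ m : ℕ, q * q ^ m ≠ 1)
    (h : GeneralChainDefined q a k a c) (hc : c = a ^ 2 / k)
    (hkq : ∀ m : ℕ, k * q * (q ^ 2) ^ m ≠ 1) (hc1 : ∀ m : ℕ, c * (q ^ 2) ^ m ≠ 1) (N : ℕ) :
    qPoch (k * q) (q ^ 2) (N / 2) / qPoch (a * q) q N
      * (qPoch (k / a) q N / qPoch q q N * generalInner q a k a c (liuMaMul q a k) N 0)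
      = if Even N then qPoch (k ^ 2 / a ^ 2) (q ^ 2) (N / 2)
        / (qPoch (c * q ^ 2) (q ^ 2) (N / 2) * qPoch (q ^ 2) (q ^ 2) (N / 2)) else 0 := by
  -- Here p(m) plays the part of (k; q²)_m / (k; q²)_{n₀} with n₀ = ⌈N/2⌉, written as a product so
  -- that it makes sense when the denominator vanishes.
  have h1 := sum_unitAlpha (g := liuMaMul q a k)
    (M := liuMaKernel q a k
      (fun m => qPoch (k * (q ^ 2) ^ ((N + 1) / 2)) (q ^ 2) (m - (N + 1) / 2)) N)
    (T := splitKernel q a k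
      (fun m => qPoch (k * (q ^ 2) ^ ((N + 1) / 2)) (q ^ 2) (m - (N + 1) / 2)) N)
    hq0 hq h.a_ne h.c_ne h.a_pow' h.c_pow N (fun i hi => by
      obtain ⟨n, hn⟩ : ∃ n, N = i + n := ⟨N - i, by omega⟩
      have := liuMa_kernel_sum hq0 hq h.a_ne h.k_ne h.a_pow hc hkq hc1
        (fun m => qPoch (k * (q ^ 2) ^ ((N + 1) / 2)) (q ^ 2) (m - (N + 1) / 2)) ((N + 1) / 2) i n
        (fun m r hm => by
          rw [show m + r - (N + 1) / 2 = m - (N + 1) / 2 + r by omega, qPoch_add, mul_assoc k,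
            ← pow_add, show (N + 1) / 2 + (m - (N + 1) / 2) = m by omega])
        (by omega)
      rw [← hn] at this
      rw [show N - i = n by omega, this, mul_comm])
  have h2 : liuMaKernel q a k
      (fun m => qPoch (k * (q ^ 2) ^ ((N + 1) / 2)) (q ^ 2) (m - (N + 1) / 2)) N 0
      = if Even N then qPoch (k ^ 2 / a ^ 2) (q ^ 2) (N / 2)
        / (qPoch (c * q ^ 2) (q ^ 2) (N / 2) * qPoch (q ^ 2) (q ^ 2) (N / 2)) else 0 := by
    have n2 := sub_ne_zero.2 (hc1 0).symm
    rw [pow_zero, mul_one] at n2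
    rw [liuMaKernel, ← hc, add_zero, Nat.sub_zero, mul_zero, pow_zero, pow_zero, mul_one, mul_one,
      div_self n2, one_mul]
    refine if_congr Iff.rfl ?_ rfl
    -- In column 0 the argument of p is ⌊N/2⌋, where the natural-number subtraction makes the
    -- normalized p equal to 1.
    rw [show N / 2 - (N + 1) / 2 = 0 by omega, qPoch_zero, one_mul]
  rw [← h2, ← h1, generalInner_zero hq0 hq h, Finset.mul_sum]
  refine Finset.sum_congr rfl fun r _ => ?_
  rw [splitKernel, shifted_split_factor, qPoch_add (a * q),
    show a * q * q ^ N = a * q ^ (N + 1) by ring]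
  simp only [div_eq_mul_inv, mul_inv]
  ring

/-- The Liu-Ma chain: evaluation of the inner sum. -/
theorem liuMa_inner_eq (hq0 : q ≠ 0) (hq : ∀ m : ℕ, q * q ^ m ≠ 1)
    (h : GeneralChainDefined q a k a c) (hc : c = a ^ 2 / k)
    (hkq : ∀ m : ℕ, k * q * (q ^ 2) ^ m ≠ 1) (hc1 : ∀ m : ℕ, c * (q ^ 2) ^ m ≠ 1) (N : ℕ) :
    generalInner q a k a c (liuMaMul q a k) N 0 = watsonProduct q a k N := by
  have h1 := liuMa_inner hq0 hq h hc hkq hc1 N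
  have n1 := qPoch_ne_zero hkq (N / 2)
  have n2 := qPoch_ne_zero h.k_div N
  have n3 := qPoch_ne_zero hq N
  have n4 := qPoch_ne_zero (mul_self_pow_ne_one h.a_pow) N
  have n5 := qPoch_ne_zero (mul_self_pow_ne_one fun m => hc1 (m + 1)) (N / 2)
  have n6 : qPoch (q ^ 2) (q ^ 2) (N / 2) ≠ 0 := qPoch_ne_zero (fun m => by
    rw [show q ^ 2 * (q ^ 2) ^ m = q * q ^ (2 * m + 1) by ring]; exact hq _) _
  rw [watsonProduct, show q ^ 2 * a ^ 2 / k = c * q ^ 2 by rw [hc]; ring]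
  by_cases hN : Even N
  · rw [if_pos hN] at h1 ⊢
    have t : qPoch q q N = qPoch q (q ^ 2) (N / 2) * qPoch (q ^ 2) (q ^ 2) (N / 2) := by
      rw [← Nat.two_mul_div_two_of_even hN, qPoch_two_mul, show q * q = q ^ 2 by ring,
        Nat.mul_div_cancel_left _ two_pos]
    rw [t] at h1 n3
    have n7 := left_ne_zero_of_mul n3
    clear t
    generalize generalInner q a k a c (liuMaMul q a k) N 0 = I at *
    generalize qPoch (k * q) (q ^ 2) (N / 2) = x1 at *
    generalize qPoch (k / a) q N = x2 at *
    generalize qPoch (a * q) q N = x4 at *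
    generalize qPoch (c * q ^ 2) (q ^ 2) (N / 2) = x5 at *
    generalize qPoch (q ^ 2) (q ^ 2) (N / 2) = x6 at *
    generalize qPoch q (q ^ 2) (N / 2) = x7 at *
    generalize qPoch (k ^ 2 / a ^ 2) (q ^ 2) (N / 2) = x8 at *
    field_simp at h1 ⊢
    linear_combination h1
  · rw [if_neg hN] at h1 ⊢
    simpa [n1, n2, n3, n4] using h1

theorem liuMaMul_shift (hq0 : q ≠ 0) (j r : ℕ) :
    liuMaMul q a k (r + j) = liuMaMul q a k j
      * liuMaMul q (a * q ^ (2 * j)) (k * q ^ (2 * j)) r := by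
  have hj : q ^ j ≠ 0 := pow_ne_zero _ hq0
  have e1 : q * (a * q ^ (2 * j)) ^ 2 / (k * q ^ (2 * j)) = q * a ^ 2 / k * (q ^ 2) ^ j := by
    rw [← pow_mul, pow_mul']; field_simp
  have e2 : -(k * q ^ (2 * j)) / (a * q ^ (2 * j)) = -k / a := by
    rw [← neg_mul, mul_div_mul_right _ _ (pow_ne_zero _ hq0)]
  have e3 : k * q ^ (2 * j) * q = k * q * (q ^ 2) ^ j := by rw [← pow_mul]; ring
  rw [liuMaMul, liuMaMul, liuMaMul, e1, e2, e3, add_comm r j, pow_add (-k / a)]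
  simp only [qPoch_add, div_eq_mul_inv, mul_inv]
  ring

/-- The Liu-Ma chain: the kernel of the general chain. -/
theorem liuMa_generalBeta (hq0 : q ≠ 0) (hq : ∀ m : ℕ, q * q ^ m ≠ 1)
    (h : GeneralChainDefined q a k a c) (hc : c = a ^ 2 / k)
    (hkq : ∀ m : ℕ, k * q * (q ^ 2) ^ m ≠ 1) (hc1 : ∀ m : ℕ, c * (q ^ 2) ^ m ≠ 1)
    (β : ℕ → K) (n : ℕ) :
    generalBeta q a k a c (liuMaMul q a k) β n = liuMaBeta q a k β n := by
  rw [liuMaBeta_eq]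
  refine generalBeta_eq (M := liuMaKernel q a k (qPoch k (q ^ 2))) hq0 h _ (liuMaMul_shift hq0)
    (fun j N => ?_) β n
  have ha0 := h.a_ne
  have hk0 := h.k_ne
  have hQ : q ^ (2 * j) ≠ 0 := pow_ne_zero _ hq0
  have h1 := liuMa_inner hq0 hq (h.shift hq0 j)
    (by rw [hc]; field_simp)
    (fun m => by
      rw [show k * q ^ (2 * j) * q * (q ^ 2) ^ m = k * q * (q ^ 2) ^ (j + m) by ring]
      exact hkq _)
    (fun m => by
      rw [show c * q ^ (2 * j) * (q ^ 2) ^ m = c * (q ^ 2) ^ (j + m) by ring]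
      exact hc1 _) N
  rw [mul_div_mul_right _ _ hQ, show (k * q ^ (2 * j)) ^ 2 / (a * q ^ (2 * j)) ^ 2
    = k ^ 2 / a ^ 2 by rw [mul_pow, mul_pow, mul_div_mul_right _ _ (pow_ne_zero _ hQ)]] at h1
  generalize generalInner q (a * q ^ (2 * j)) (k * q ^ (2 * j)) (a * q ^ (2 * j))
    (c * q ^ (2 * j)) (liuMaMul q (a * q ^ (2 * j)) (k * q ^ (2 * j))) N 0 = I at *
  have hev : Even (j + N + j) ↔ Even N := by
    rw [show j + N + j = 2 * j + N by ring, Nat.even_add]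
    simp
  have hkq' : ∀ m : ℕ, k * q ^ (2 * j) * q * (q ^ 2) ^ m ≠ 1 := fun m => by
    rw [show k * q ^ (2 * j) * q * (q ^ 2) ^ m = k * q * (q ^ 2) ^ (j + m) by ring]
    exact hkq _
  rw [liuMaKernel, ← hc]
  by_cases hN : Even N
  · rw [if_pos (hev.2 hN)]
    rw [if_pos hN] at h1
    obtain ⟨H, rfl⟩ := hN
    rw [show (H + H) / 2 = H by omega] at h1
    rw [show (j + (H + H) + j) / 2 = j + H by omega, show (j + (H + H) - j) / 2 = H by omega,
      liuMaMul_eq hc, show H + H = 2 * H by ring, qPoch_two_mul (k * q ^ (2 * j)),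
      qPoch_two_mul k, qPoch_two_mul c, qPoch_add k, qPoch_add (c * q ^ 2), pow_mul q 2 j]
    rw [show H + H = 2 * H by ring, pow_mul q 2 j,
      show c * (q ^ 2) ^ j * q ^ 2 = c * q ^ 2 * (q ^ 2) ^ j by ring] at h1
    have n1 := qPoch_ne_zero hkq j
    have n3 := qPoch_ne_zero hc1 j
    have n4 : qPoch (c * q) (q ^ 2) j ≠ 0 := qPoch_ne_zero (fun m => by
      rw [show c * q * (q ^ 2) ^ m = c * q ^ (2 * m + 1) by ring]; exact h.c_pow _) j
    have n5 := sub_ne_zero.2 (hc1 0).symm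
    rw [pow_zero, mul_one] at n5
    have n6 := qPoch_ne_zero (mul_self_pow_ne_one fun m => hc1 (m + 1)) j
    have t1 := qPoch_mul_eq c (q ^ 2) j
    have t3 : (1 - c * (q ^ 2) ^ j) / ((1 - c) * qPoch (c * q ^ 2) (q ^ 2) j)
        = 1 / qPoch c (q ^ 2) j := by
      rw [div_eq_div_iff (mul_ne_zero n5 n6) n3]
      linear_combination t1
    -- The kernel entry is recovered by multiplying the normalized evaluation back by (k q^(2j);
    -- q²)_H, which may be zero but is never divided out.
    refine Eq.trans (b := 1 / qPoch c (q ^ 2) j * qPoch k (q ^ 2) j * (-k / a) ^ j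
      * qPoch (k * (q ^ 2) ^ j) (q ^ 2) H
      * (qPoch (k ^ 2 / a ^ 2) (q ^ 2) H
        / (qPoch (c * q ^ 2 * (q ^ 2) ^ j) (q ^ 2) H * qPoch (q ^ 2) (q ^ 2) H))) ?_ ?_
    · rw [← h1]
      clear h1 t1 t3
      generalize qPoch (k * q) (q ^ 2) j = y1 at *
      generalize qPoch (c * q) (q ^ 2) j = y2 at *
      generalize k / a = u
      generalize -k / a = u'
      refine eq_of_eq_mul_of_eq_one (u := y1 / y1 * (y2 / y2))
        (by rw [div_self n1, div_self n4, mul_one]) ?_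
      simp only [div_eq_mul_inv, mul_inv]
      ring
    · rw [← t3]
      generalize 1 - c * (q ^ 2) ^ j = d
      generalize 1 - c = d'
      generalize k ^ 2 / a ^ 2 = x
      generalize -k / a = u'
      simp only [div_eq_mul_inv, mul_inv]
      ring
  · rw [if_neg (mt hev.1 hN)]
    rw [if_neg hN] at h1
    have n1 := qPoch_ne_zero hkq' (N / 2)
    have n4 := qPoch_ne_zero (mul_self_pow_ne_one (h.shift hq0 j).a_pow) N
    have h2 := (mul_eq_zero.1 h1).resolve_left (div_ne_zero n1 n4)
    rw [show qPoch (k / a) q N * qPoch (k * q ^ (2 * j)) q N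
          / (qPoch q q N * qPoch (a * q ^ (2 * j) * q) q N) * I
        = qPoch (k * q ^ (2 * j)) q N / qPoch (a * q ^ (2 * j) * q) q N
          * (qPoch (k / a) q N / qPoch q q N * I) by ring, h2, mul_zero, mul_zero]

/-- The Liu-Ma chain: the inner sum is the series in the `q`-analogue of Watson's sum. -/
theorem liuMa_series (h : GeneralChainDefined q a k a c)
    (hc : c = a ^ 2 / k) {w t s : K} (hw : w ^ 2 = q) (ht : t ^ 2 = a) (hs : s ^ 2 = k) (N : ℕ) :
    generalInner q a k a c (liuMaMul q a k) N 0 = watsonSeries q a k w t s N := by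
  have ha0 := h.a_ne
  have hk0 := h.k_ne
  have hc0 := h.c_ne
  rw [generalInner_zero_eq h, watsonSeries, phi]
  refine Finset.sum_congr rfl fun r _ => ?_
  simp only [List.map_cons, List.map_nil, List.prod_cons, List.prod_nil, mul_one]
  have e1 : (-(q * a / k)) ^ r = (q * c / k) ^ r * (-k / a) ^ r := by
    rw [← mul_pow, hc]
    congr 1
    field_simp
  have p1 := qPoch_mul_neg (a * w / s) q r
  have p3 := qPoch_mul_neg (w * s) q r
  rw [show (a * w / s) ^ 2 = c * q by rw [div_pow, mul_pow, hw, hs, hc]; ring] at p1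
  rw [show (w * s) ^ 2 = k * q by rw [mul_pow, hw, hs, mul_comm]] at p3
  rw [very_well_poised_factor h.a_pow' ht, liuMaMul_eq hc,
    ← p1, ← p3, e1, show a / c = k / a by rw [hc]; field_simp,
    show c * q = a ^ 2 * q / k by rw [hc]; field_simp]
  clear p1 p3
  generalize (-k / a) ^ r = x
  generalize -(a * w / s) = p₁
  generalize a * w / s = p₂
  generalize a * q / (k * q ^ N) = p₅
  generalize a ^ 2 * q / k = p₆
  generalize (q ^ N)⁻¹ = p₇
  generalize (q * c / k) ^ r = p₈
  generalize k / a = p₁₀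
  simp only [div_eq_mul_inv, mul_inv]
  ring

end LiuMa

end WPBailey

/-! ### Assembly of the four chains. -/

theorem mainTheorem2 {K : Type*} [Field K] (q a k : K)
    (hq0 : q ≠ 0) (hq : ∀ m : ℕ, q ^ (m + 1) ≠ 1)
    (ha0 : a ≠ 0) (hk0 : k ≠ 0) (ha : ∀ m : ℕ, a * q ^ (m + 1) ≠ 1) :
    -- Andrews' first chain
    (∀ ρ₁ ρ₂ c : K, ρ₁ ≠ 0 → ρ₂ ≠ 0 → c = k * ρ₁ * ρ₂ / (a * q) →
      (∀ m : ℕ, a * q / ρ₁ * q ^ m ≠ 1) → (∀ m : ℕ, a * q / ρ₂ * q ^ m ≠ 1) →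
      (∀ m : ℕ, k * ρ₁ / a * q ^ m ≠ 1) → (∀ m : ℕ, k * ρ₂ / a * q ^ m ≠ 1) →
      (∀ m : ℕ, c * q ^ m ≠ 1) →
      (∀ α β : ℕ → K, IsWPBaileyPair q a c α β →
        IsWPBaileyPair q a k (fun n => andrewsOneMul q a ρ₁ ρ₂ n * α n)
          (andrewsOneBeta q a k c ρ₁ ρ₂ β)) ∧
      (GeneralChainDefined q a k a c →
        (∀ (α : ℕ → K) (n : ℕ), generalAlpha (andrewsOneMul q a ρ₁ ρ₂) α n
          = andrewsOneMul q a ρ₁ ρ₂ n * α n) ∧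
        (∀ (β : ℕ → K) (n : ℕ), generalBeta q a k a c (andrewsOneMul q a ρ₁ ρ₂) β n
          = andrewsOneBeta q a k c ρ₁ ρ₂ β n) ∧
        (∀ n j : ℕ, j ≤ n →
          (a * q ^ (2 * j)) ^ 2 * q
            = (ρ₁ * q ^ j) * (ρ₂ * q ^ j) * (a / c) * (k * q ^ (n + j)) * (q ^ (n - j))⁻¹ ∧
          (∀ t : K, t ^ 2 = a →
            generalInner q a k a c (andrewsOneMul q a ρ₁ ρ₂) n j
              = andrewsOneMul q a ρ₁ ρ₂ j
                * jacksonSeries q (a * q ^ (2 * j)) (t * q ^ j) (ρ₁ * q ^ j) (ρ₂ * q ^ j)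
                    (a / c) (k * q ^ (n + j)) (n - j)) ∧
          generalInner q a k a c (andrewsOneMul q a ρ₁ ρ₂) n j
            = andrewsOneMul q a ρ₁ ρ₂ j
              * jacksonProduct q (a * q ^ (2 * j)) (ρ₁ * q ^ j) (ρ₂ * q ^ j) (a / c)
                  (n - j)))) ∧
    -- Andrews' second chain
    (∀ c : K, c = q * a ^ 2 / k → (∀ m : ℕ, k * q ^ m ≠ 1) →
      (∀ α β : ℕ → K, IsWPBaileyPair q a c α β →
        IsWPBaileyPair q a k (fun n => andrewsTwoMul q a k n * α n) (andrewsTwoBeta q a k β)) ∧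
      (GeneralChainDefined q a k a c →
        (∀ (α : ℕ → K) (n : ℕ), generalAlpha (andrewsTwoMul q a k) α n
          = andrewsTwoMul q a k n * α n) ∧
        (∀ (β : ℕ → K) (n : ℕ), generalBeta q a k a c (andrewsTwoMul q a k) β n
          = andrewsTwoBeta q a k β n) ∧
        (∀ n j : ℕ, j ≤ n →
          (∀ w t s : K, w ^ 2 = q → t ^ 2 = a → s ^ 2 = k →
            generalInner q a k a c (andrewsTwoMul q a k) n j
              = andrewsTwoMul q a k j
                * gasperRahmanSeries q (a * q ^ (2 * j)) (k * q ^ (2 * j)) w (t * q ^ j)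
                    (s * q ^ j) (n - j)) ∧
          generalInner q a k a c (andrewsTwoMul q a k) n j
            = andrewsTwoMul q a k j
              * gasperRahmanProduct q (a * q ^ (2 * j)) (k * q ^ (2 * j)) (n - j)))) ∧
    -- Warnaar's first chain
    (∀ s c : K, s ^ 2 = k → c = a ^ 2 / k → (∀ m : ℕ, k * q ^ m ≠ 1) → 1 + a / s ≠ 0 →
      (∀ α β : ℕ → K, IsWPBaileyPair q a c α β →
        IsWPBaileyPair q a k (fun n => warnaarMul q a k s n * α n)
          (warnaarBeta q a k s c β)) ∧
      (GeneralChainDefined q a k a c →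
        (∀ (α : ℕ → K) (n : ℕ), generalAlpha (warnaarMul q a k s) α n
          = warnaarMul q a k s n * α n) ∧
        (∀ (β : ℕ → K) (n : ℕ), generalBeta q a k a c (warnaarMul q a k s) β n
          = warnaarBeta q a k s c β n) ∧
        (∀ n j : ℕ, j ≤ n →
          (∀ w t : K, w ^ 2 = q → t ^ 2 = a →
            generalInner q a k a c (warnaarMul q a k s) n j
              = warnaarMul q a k s j
                * andrewsBerkovichSeries q (a * q ^ (2 * j)) (k * q ^ (2 * j)) w (t * q ^ j)
                    (s * q ^ j) (n - j)) ∧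
          generalInner q a k a c (warnaarMul q a k s) n j
            = warnaarMul q a k s j
              * andrewsBerkovichProduct q (a * q ^ (2 * j)) (k * q ^ (2 * j)) (s * q ^ j)
                  (n - j)))) ∧
    -- The Liu-Ma chain
    (∀ c : K, c = a ^ 2 / k → (∀ m : ℕ, k * q * (q ^ 2) ^ m ≠ 1) →
      (∀ m : ℕ, a ^ 2 / k * (q ^ 2) ^ m ≠ 1) →
      (∀ α β : ℕ → K, IsWPBaileyPair q a c α β →
        IsWPBaileyPair q a k (fun n => liuMaMul q a k n * α n) (liuMaBeta q a k β)) ∧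
      (GeneralChainDefined q a k a c →
        (∀ (α : ℕ → K) (n : ℕ), generalAlpha (liuMaMul q a k) α n
          = liuMaMul q a k n * α n) ∧
        (∀ (β : ℕ → K) (n : ℕ), generalBeta q a k a c (liuMaMul q a k) β n
          = liuMaBeta q a k β n) ∧
        (∀ n j : ℕ, j ≤ n →
          (∀ w t s : K, w ^ 2 = q → t ^ 2 = a → s ^ 2 = k →
            generalInner q a k a c (liuMaMul q a k) n j
              = liuMaMul q a k j
                * watsonSeries q (a * q ^ (2 * j)) (k * q ^ (2 * j)) w (t * q ^ j) (s * q ^ j)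
                    (n - j)) ∧
          generalInner q a k a c (liuMaMul q a k) n j
            = liuMaMul q a k j
              * watsonProduct q (a * q ^ (2 * j)) (k * q ^ (2 * j)) (n - j)))) := by
  have hq' : ∀ m : ℕ, q * q ^ m ≠ 1 := fun m => by rw [← pow_succ']; exact hq m
  refine ⟨fun ρ₁ ρ₂ c hρ₁ hρ₂ hc h1 h2 h3 h4 h5 => ⟨fun α β hp => ?_, fun h => ⟨fun _ _ => rfl,
      andrewsOne_generalBeta hq0 hq' h hρ₁ hρ₂ hc h1 h2 h3 h4, fun n j hj => ?_⟩⟩,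
    fun c hc hk => ⟨fun α β hp => ?_, fun h => ⟨fun _ _ => rfl,
      andrewsTwo_generalBeta hq0 hq' h hc hk, fun n j hj => ?_⟩⟩,
    fun s c hs hc hk _ => ⟨fun α β hp => ?_, fun h => ⟨fun _ _ => rfl,
      warnaar_generalBeta hq0 hq' h hs hc hk, fun n j hj => ?_⟩⟩,
    fun c hc hkq hc1 => ⟨fun α β hp => ?_, fun h => ⟨fun _ _ => rfl,
      liuMa_generalBeta hq0 hq' h hc hkq (by rwa [hc]), fun n j hj => ?_⟩⟩⟩
  · exact isWPBaileyPair_of_kernel (M := andrewsOneKernel q a k c ρ₁ ρ₂)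
      (fun i N => andrewsOne_kernel_sum hq0 hq' ha0 hk0 ha hρ₁ hρ₂ hc h1 h2 h3 h4 h5 i N) hp
      (andrewsOneBeta_eq β)
  · obtain ⟨N, rfl⟩ := Nat.exists_eq_add_of_le hj
    have hc0 := h.c_ne
    have hqj : q ^ j ≠ 0 := pow_ne_zero _ hq0
    have hqN : q ^ N ≠ 0 := pow_ne_zero _ hq0
    have hcj : c * q ^ (2 * j) = k * q ^ (2 * j) * (ρ₁ * q ^ j) * (ρ₂ * q ^ j)
        / (a * q ^ (2 * j) * q) := by rw [hc, pow_mul']; field_simp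
    have e1 : a * q ^ (2 * j) * q / (ρ₁ * q ^ j) = a * q / ρ₁ * q ^ j := by
      rw [pow_mul']; field_simp
    have e2 : a * q ^ (2 * j) * q / (ρ₂ * q ^ j) = a * q / ρ₂ * q ^ j := by
      rw [pow_mul']; field_simp
    have e3 : a * q ^ (2 * j) / (c * q ^ (2 * j)) = a / c := by field_simp
    have e4 : k * q ^ (2 * j) * q ^ N = k * q ^ (j + N + j) := by ring
    -- With n = j + N, the statements for I_{n,j} become those for j = 0 at the shifted parameters;
    -- the same reduction serves the other three chains.
    rw [generalInner_shift hq0 j N (andrewsOneMul_shift hq0 hρ₁ hρ₂ j), Nat.add_sub_cancel_left]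
    refine ⟨?_, fun t ht => ?_, ?_⟩
    · rw [← e4, hc, pow_mul']
      field_simp
    · rw [andrewsOne_series (h.shift hq0 j) (mul_ne_zero hρ₁ hqj) (mul_ne_zero hρ₂ hqj) hq0 hcj
        (t := t * q ^ j) (by rw [← ht]; ring) N, e3, e4]
    · rw [andrewsOne_inner hq0 hq' (h.shift hq0 j) (mul_ne_zero hρ₁ hqj) (mul_ne_zero hρ₂ hqj) hcj
        (by rw [e1]; exact mul_pow_ne_one_of_add _ h1)
        (by rw [e2]; exact mul_pow_ne_one_of_add _ h2) N, e3]
  · exact isWPBaileyPair_of_kernel (M := andrewsTwoKernel q a k)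
      (fun i N => andrewsTwo_kernel_sum hq0 hq' ha0 hk0 ha hc hk i N) hp (fun _ => rfl)
  · obtain ⟨N, rfl⟩ := Nat.exists_eq_add_of_le hj
    have hqj : q ^ j ≠ 0 := pow_ne_zero _ hq0
    have hcj : c * q ^ (2 * j) = q * (a * q ^ (2 * j)) ^ 2 / (k * q ^ (2 * j)) := by
      rw [hc, pow_mul']; field_simp
    rw [generalInner_shift hq0 j N (andrewsTwoMul_shift hq0 j), Nat.add_sub_cancel_left]
    refine ⟨fun w t s hw ht hs => ?_, ?_⟩
    · rw [andrewsTwo_series hq0 (h.shift hq0 j) hcj hw (t := t * q ^ j) (s := s * q ^ j)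
        (by rw [← ht]; ring) (by rw [← hs]; ring) N]
    · rw [andrewsTwo_inner_eq hq0 hq' (h.shift hq0 j) hcj (mul_pow_ne_one_of_add _ hk) N]
  · exact isWPBaileyPair_of_kernel (M := warnaarKernel q a k s)
      (fun i N => warnaar_kernel_sum hq0 hq' ha0 hk0 ha hs hc hk i N) hp
      (warnaarBeta_eq ha0 hk0 hc β)
  · obtain ⟨N, rfl⟩ := Nat.exists_eq_add_of_le hj
    have hqj : q ^ j ≠ 0 := pow_ne_zero _ hq0
    have hcj : c * q ^ (2 * j) = (a * q ^ (2 * j)) ^ 2 / (k * q ^ (2 * j)) := by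
      rw [hc, pow_mul']; field_simp
    have hsj : (s * q ^ j) ^ 2 = k * q ^ (2 * j) := by rw [← hs]; ring
    rw [generalInner_shift hq0 j N (warnaarMul_shift hq0 hs h hc hk j), Nat.add_sub_cancel_left]
    refine ⟨fun w t hw ht => ?_, ?_⟩
    · rw [warnaar_series hq0 (h.shift hq0 j) hsj hcj (mul_pow_ne_one_of_add _ hk) hw
        (t := t * q ^ j) (by rw [← ht]; ring) N]
    · rw [warnaar_inner_eq hq0 hq' (h.shift hq0 j) hsj hcj (mul_pow_ne_one_of_add _ hk) N]
  · exact liuMa_isWPBaileyPair hq0 hq' ha0 hk0 ha hc hkq (by rwa [hc]) hp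
  · obtain ⟨N, rfl⟩ := Nat.exists_eq_add_of_le hj
    have hqj : q ^ (2 * j) ≠ 0 := pow_ne_zero _ hq0
    have hcj : c * q ^ (2 * j) = (a * q ^ (2 * j)) ^ 2 / (k * q ^ (2 * j)) := by
      rw [hc]; field_simp
    rw [generalInner_shift hq0 j N (liuMaMul_shift hq0 j), Nat.add_sub_cancel_left]
    refine ⟨fun w t s hw ht hs => ?_, ?_⟩
    · rw [liuMa_series (h.shift hq0 j) hcj hw (t := t * q ^ j) (s := s * q ^ j)
        (by rw [← ht]; ring) (by rw [← hs]; ring) N]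
    · rw [liuMa_inner_eq hq0 hq' (h.shift hq0 j) hcj
        (fun m => by
          rw [show k * q ^ (2 * j) * q * (q ^ 2) ^ m = k * q * (q ^ 2) ^ (j + m) by ring]
          exact hkq _)
        (fun m => by
          rw [show c * q ^ (2 * j) * (q ^ 2) ^ m = c * (q ^ 2) ^ (j + m) by ring, hc]
          exact hc1 _) N]
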